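/- **Notation.** Let $d\ge 1$ and $\mathscr X=(0,1)^d$. For $m\in\mathbb N$, let $\mathscr H^m_{\mathsf{mix}}$ be the order-$m$ Sobolev space with dominating mixed smoothness on $\mathscr X$: the set of $g\in L^2(\mathscr X)$ such that, for every multi-index $\alpha=(\alpha_1,\dots,\alpha_d)$ with $0\le\alpha_j\le m$ for all $j$, the weak partial derivative $\partial^{\alpha_1}_{x_1}\cdots\partial^{\alpha_d}_{x_d}g$ exists and lies in $L^2(\mathscr X)$. For each $j=1,\dots,d$ let $-\infty\le a_j\le 0$ and $1\le b_j\le\infty$, let $p_j,q_j$ be positive functions on $(a_j,b_j)$ with $p_j/q_j$ strictly increasing, and put $$k_j(x,y)=p_j(x\wedge y)\,q_j(x\vee y)\quad (x,y\in(a_j,b_j)),\qquad k(\mathbf x,\mathbf y)=\prod_{j=1}^d k_j(x_j,y_j)\quad\Bigl(\mathbf x,\mathbf y\in\mathscr I:=\prod_{j=1}^d(a_j,b_j)\Bigr).$$ These are positive semidefinite kernels; $\mathscr H_{k_j}$ and $\mathscr H_k$ denote their reproducing kernel Hilbert spaces, and for $g:(0,1)\to\mathbb R$ put $\|g\|_{\mathscr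 H_{k_j}(0,1)}=\inf\{\|h\|_{\mathscr H_{k_j}}: h\in\mathscr H_{k_j},\ h|_{(0,1)}=g\}$ (with $\inf\emptyset=\infty$). **Sturm–Liouville assumption.** For each $j$: 1. There are a continuously differentiable $u_j$ and a continuous $v_j$ on $(a_j,b_j)$ such that $p_j$ and $q_j$ are continuously differentiable and satisfy $\mathcal L_j[p_j]=\mathcal L_j[q_j]=0$ on $(a_j,b_j)$, where $\mathcal L_j[g]=-(u_jg')'+v_jg$. 2. With the same $u_j,v_j$, $\langle g,h\rangle_{\mathscr H_{k_j}}=\int_{a_j}^{b_j}g\,\mathcal L_j[h]\,dx$ (hence, exchanging $g$ and $h$, also $\langle g,h\rangle_{\mathscr H_{k_j}}=\int_{a_j}^{b_j}\mathcal L_j[g]\,h\,dx$) for all $g,h\in\mathscr H_{k_j}$ for which the distribution $\mathcal L_j[h]$ is a locally integrable function and $g\,\mathcal L_j[h]$ is integrable on $(a_j,b_j)$. 3. There are constants $C,\tilde C>0$ such that $C\int_0^1|D^1g|^2\,dx\le\|g\|^2_{\mathscr H_{k_j}(0,1)}$ for all $g:(0,1)\to\mathbb R$ and $\|g\|^2_{\mathscr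 H_{k_j}(0,1)}\le\tilde C\int_0^1\bigl(|g|^2+|D^1g|^2\bigr)dx$ for all continuous $g:(0,1)\to\mathbb R$, where $D^1g$ is the weak derivative and $\int_0^1|D^1g|^2\,dx=\infty$ if $D^1g$ does not exist. Moreover, for every $w\in L^2(a_j,b_j)$ the integral $\int_{a_j}^{b_j}k_j(x,s)w(s)\,ds$ converges absolutely for all $x\in(0,1)$, and as a function of $x$ it has a second weak derivative in $L^2(0,1)$. Let $\mathscr H^2_k$ be the set of $g\in\mathscr H_k$ for which there is $w\in L^2(\mathscr I)$ with $g(\mathbf x)=\int_{\mathscr I}k(\mathbf x,\mathbf s)w(\mathbf s)\,d\mathbf s$ (absolutely convergent) for all $\mathbf x\in\mathscr I$, and let $\mathscr H^2_k(\mathscr X)=\{h|_{\mathscr X}:h\in\mathscr H^2_k\}$. **Proposition.** Let $k$ satisfy the Sturm–Liouville assumption. Then $\mathscr H^2_k(\mathscr X)=\mathscr H^2_{\mathsf{mix}}$ as sets of functions, where functions that agree almost everywhere are identified. Precisely: a function $g:\mathscr X\to\mathbb R$ belongs to $\mathscr H^2_k(\mathscr X)$ if and only if it is continuous and belongs to $\mathscr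 H^2_{\mathsf{mix}}$; and $g$ belongs to $\mathscr H^2_{\mathsf{mix}}$ if and only if it agrees almost everywhere with some element of $\mathscr H^2_k(\mathscr X)$. -/

import Mathlib

open MeasureTheory
open scoped ENNReal ContDiff

/- Subsets of `ℝ` and of `ℝ^d` carry Lebesgue measure. -/
attribute [local instance] MeasureTheory.Measure.Subtype.measureSpace

/-! ### Test functions, weak derivatives, dominating mixed smoothness -/

/-- Smooth functions whose support is a compact subset of `S`. -/
def IsTestFunction {E : Type*} [NormedAddCommGroup E] [NormedSpace ℝ E] (S : Set E)
    (φ : E → ℝ) : Prop :=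
  ContDiff ℝ ∞ φ ∧ HasCompactSupport φ ∧ tsupport φ ⊆ S

/-- `f` is the weak derivative of order `m` of `g` on the set `S ⊆ ℝ`. -/
def IsWeakDeriv (S : Set ℝ) (m : ℕ) (g f : S → ℝ) : Prop :=
  LocallyIntegrable g ∧ LocallyIntegrable f ∧
    ∀ φ : ℝ → ℝ, IsTestFunction S φ →
      ∫ x : S, g x * iteratedDeriv m φ x = (-1) ^ m * ∫ x : S, f x * φ x

/-- The unit interval `(0,1)`. -/
abbrev unitIoo : Set ℝ := Set.Ioo 0 1

/-- The open unit cube `(0,1)^d`. -/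
def openCube (d : ℕ) : Set (Fin d → ℝ) := {x | ∀ j, x j ∈ unitIoo}

/-- The partial derivative `∂φ/∂x_j`. -/
noncomputable def partialDeriv {d : ℕ} (j : Fin d) (φ : (Fin d → ℝ) → ℝ) : (Fin d → ℝ) → ℝ :=
  fun x => fderiv ℝ φ x (Pi.single j 1)

/-- `∂^α φ`, the partial derivative of order `α j` in each variable `x_j`. -/
noncomputable def mixedPartial {d : ℕ} (α : Fin d → ℕ) (φ : (Fin d → ℝ) → ℝ) :
    (Fin d → ℝ) → ℝ :=
  (List.finRange d).foldr (fun j ψ => (partialDeriv j)^[α j] ψ) φ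

/-- `f` is the weak partial derivative `∂^α g` on `(0,1)^d`. -/
def IsWeakPartial {d : ℕ} (α : Fin d → ℕ) (g f : openCube d → ℝ) : Prop :=
  LocallyIntegrable g ∧ LocallyIntegrable f ∧
    ∀ φ : (Fin d → ℝ) → ℝ, IsTestFunction (openCube d) φ →
      ∫ x : openCube d, g x * mixedPartial α φ x
        = (-1) ^ (∑ j, α j) * ∫ x : openCube d, f x * φ x

/-- The order-`m` Sobolev space with dominating mixed smoothness on `(0,1)^d`: the functions in
`L²` all of whose weak partial derivatives of order at most `m` in each variable are in `L²`. -/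
def mixedSobolev (d m : ℕ) : Set (openCube d → ℝ) :=
  {g | MemLp g 2 ∧ ∀ α : Fin d → ℕ, (∀ j, α j ≤ m) → ∃ f, MemLp f 2 ∧ IsWeakPartial α g f}

/-! ### Real kernels and their reproducing kernel Hilbert spaces -/

/-- A real kernel as an operator-valued matrix, the form in which `RKHS.OfKernel` takes it. -/
def kernelMatrix {X : Type*} (k : X → X → ℝ) : Matrix X X (ℝ →L[ℝ] ℝ) :=
  Matrix.of fun x y => k x y • ContinuousLinearMap.id ℝ ℝ

/-- Scaled measures of intersections form a positive semidefinite kernel. -/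
theorem kernelMatrix_posSemidef {X α : Type*} [MeasurableSpace α] (μ : Measure α)
    (A : X → Set α) (hA : ∀ x, MeasurableSet (A x)) (hμ : ∀ x, μ (A x) ≠ ⊤) (c : X → ℝ)
    (k : X → X → ℝ) (hk : ∀ x y, k x y = c x * c y * μ.real (A x ∩ A y)) :
    (kernelMatrix k).PosSemidef := by
  have key := (RKHS.posSemidef_tfae (𝕜 := ℝ) (K := kernelMatrix k)).out 0 2
  rw [key]
  refine ⟨?_, fun w => ?_⟩
  · ext x y
    simp [kernelMatrix, star, hk x y, hk y x, Set.inter_comm (A x), mul_comm (c x),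
      ContinuousLinearMap.adjoint_id]
  · let e : X → Lp ℝ 2 μ := fun x => c x • indicatorConstLp 2 (hA x) (hμ x) (1 : ℝ)
    have he : ∀ x y, inner ℝ (e x) (e y) = k x y := by
      intro x y
      simp only [e, real_inner_smul_left, real_inner_smul_right]
      rw [L2.real_inner_indicatorConstLp_one_indicatorConstLp_one (hA x) (hA y) (hμ x) (hμ y), hk]
      ring
    have h0 : 0 ≤ inner ℝ (w.sum fun x r => r • e x) (w.sum fun x r => r • e x) :=
      real_inner_self_nonneg
    refine h0.trans_eq ?_
    simp only [Finsupp.sum, sum_inner, inner_sum, real_inner_smul_left, real_inner_smul_right, he,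
      map_sum, kernelMatrix, Matrix.of_apply]
    refine Finset.sum_congr rfl fun x _ => Finset.sum_congr rfl fun y _ => ?_
    simp
    ring

/-! ### Tensor Markov kernels -/

/-- The open interval of reals between two extended reals. -/
def erealIoo (a b : EReal) : Set ℝ := {x | a < (x : EReal) ∧ (x : EReal) < b}

/-- A tensor Markov kernel on `∏ (a_j, b_j)`, where `-∞ ≤ a_j ≤ 0` and `1 ≤ b_j ≤ ∞`, given by
positive functions `p_j`, `q_j` on `(a_j, b_j)` with `p_j / q_j` strictly increasing. -/
structure TensorMarkovKernel (d : ℕ) where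
  a : Fin d → EReal
  b : Fin d → EReal
  p : Fin d → ℝ → ℝ
  q : Fin d → ℝ → ℝ
  a_le : ∀ j, a j ≤ 0
  le_b : ∀ j, 1 ≤ b j
  p_pos : ∀ j, ∀ x ∈ erealIoo (a j) (b j), 0 < p j x
  q_pos : ∀ j, ∀ x ∈ erealIoo (a j) (b j), 0 < q j x
  strictMono : ∀ j, StrictMonoOn (fun x => p j x / q j x) (erealIoo (a j) (b j))

namespace TensorMarkovKernel

variable {d : ℕ} (T : TensorMarkovKernel d)

/-- The interval `(a_j, b_j)`. -/
def interval (j : Fin d) : Set ℝ := erealIoo (T.a j) (T.b j)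

/-- The box `∏ (a_j, b_j)`. -/
def box : Set (Fin d → ℝ) := {x | ∀ j, x j ∈ T.interval j}

/-- `k_j(x, y) = p_j(x ∧ y) q_j(x ∨ y)`. -/
def kernel₁ (j : Fin d) (x y : ℝ) : ℝ := T.p j (min x y) * T.q j (max x y)

/-- `k(x, y) = ∏ k_j(x_j, y_j)`. -/
def kernel (x y : Fin d → ℝ) : ℝ := ∏ j, T.kernel₁ j (x j) (y j)

theorem unitIoo_subset (j : Fin d) : unitIoo ⊆ T.interval j := fun x hx =>
  ⟨(T.a_le j).trans_lt (by exact_mod_cast hx.1), lt_of_lt_of_le (by exact_mod_cast hx.2) (T.le_b j)⟩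

theorem openCube_subset : openCube d ⊆ T.box := fun _ hx j => T.unitIoo_subset j (hx j)

theorem kernel₁_eq (j : Fin d) {x y : ℝ} (hx : x ∈ T.interval j) (hy : y ∈ T.interval j) :
    T.kernel₁ j x y
      = T.q j x * T.q j y * min (T.p j x / T.q j x) (T.p j y / T.q j y) := by
  have hqx := (T.q_pos j x hx).ne'
  have hqy := (T.q_pos j y hy).ne'
  rcases le_total x y with h | h
  · have := (T.strictMono j).monotoneOn hx hy h
    simp only [kernel₁, min_eq_left h, max_eq_right h]
    rw [min_eq_left this]; field_simp
  · have := (T.strictMono j).monotoneOn hy hx h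
    simp only [kernel₁, min_eq_right h, max_eq_left h]
    rw [min_eq_right this]; field_simp

theorem ratio_pos (j : Fin d) {x : ℝ} (hx : x ∈ T.interval j) : 0 < T.p j x / T.q j x :=
  div_pos (T.p_pos j x hx) (T.q_pos j x hx)

instance factPosSemidef₁ (j : Fin d) :
    Fact (kernelMatrix fun x y : T.interval j => T.kernel₁ j x y).PosSemidef := ⟨by
  refine kernelMatrix_posSemidef volume (fun x : T.interval j => Set.Ioc 0 (T.p j x / T.q j x))
    (fun _ => measurableSet_Ioc) (fun _ => by simp) (fun x => T.q j x)
    (fun x y : T.interval j => T.kernel₁ j x y) fun x y => ?_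
  rw [T.kernel₁_eq j x.2 y.2, Set.Ioc_inter_Ioc, Real.volume_real_Ioc_of_le]
  · simp
  · simpa using ⟨(T.ratio_pos j x.2).le, (T.ratio_pos j y.2).le⟩⟩

instance factPosSemidef :
    Fact (kernelMatrix fun x y : T.box => T.kernel x y).PosSemidef := ⟨by
  refine kernelMatrix_posSemidef volume
    (fun x => Set.univ.pi fun j => Set.Ioc 0 (T.p j (x.1 j) / T.q j (x.1 j)))
    (fun _ => MeasurableSet.univ_pi fun _ => measurableSet_Ioc)
    (fun x => by simp [Real.volume_pi_Ioc, ENNReal.prod_ne_top])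
    (fun x => ∏ j, T.q j (x.1 j)) _ fun x y => ?_
  rw [← Set.pi_inter_distrib, Measure.real, volume_pi_pi, ENNReal.toReal_prod,
    ← Finset.prod_mul_distrib, ← Finset.prod_mul_distrib, kernel]
  refine Finset.prod_congr rfl fun j _ => ?_
  have hx := T.ratio_pos j (x.2 j)
  have hy := T.ratio_pos j (y.2 j)
  rw [T.kernel₁_eq j (x.2 j) (y.2 j), Set.Ioc_inter_Ioc, Real.volume_Ioc,
    ENNReal.toReal_ofReal] <;> simp [hx.le, hy.le]⟩

/-- The reproducing kernel Hilbert space of `k_j` on `(a_j, b_j)`. -/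
abbrev Space₁ (j : Fin d) : Type :=
  RKHS.OfKernel (kernelMatrix fun x y : T.interval j => T.kernel₁ j x y)

/-- The reproducing kernel Hilbert space of `k` on `∏ (a_j, b_j)`. -/
abbrev Space : Type := RKHS.OfKernel (kernelMatrix fun x y : T.box => T.kernel x y)

/-! ### The Sturm–Liouville assumption -/

/-- `L[φ] = -(u φ')' + v φ`. -/
noncomputable def slOp (u v φ : ℝ → ℝ) (x : ℝ) : ℝ :=
  -deriv (fun y => u y * deriv φ y) x + v x * φ x

/-- `L[h] = f` in the sense of distributions on `S`; the operator `L` is formally symmetric. -/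
def IsWeakSL (S : Set ℝ) (u v : ℝ → ℝ) (h f : S → ℝ) : Prop :=
  LocallyIntegrable h ∧ LocallyIntegrable f ∧
    ∀ φ : ℝ → ℝ, IsTestFunction S φ → ∫ x : S, h x * slOp u v φ x = ∫ x : S, f x * φ x

/-- `p_j` and `q_j` are `C¹` solutions of `-(u g')' + v g = 0` on `(a_j, b_j)`, with `u` of class
`C¹` and `v` continuous. -/
def SolvesODE (j : Fin d) (u v : ℝ → ℝ) : Prop :=
  ContDiffOn ℝ 1 u (T.interval j) ∧ ContinuousOn v (T.interval j) ∧
    ∀ g ∈ ({T.p j, T.q j} : Set (ℝ → ℝ)), ContDiffOn ℝ 1 g (T.interval j) ∧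
      ∀ x ∈ T.interval j, DifferentiableAt ℝ (fun y => u y * deriv g y) x ∧ slOp u v g x = 0

/-- `⟨g, h⟩ = ∫ g L[h] = ∫ L[g] h` in the Hilbert space of `k_j`. The first equation is required
of all `g`, `h` for which `L[h]` is a function and `g L[h]` is integrable; the second is the first
with `g` and `h` exchanged. -/
def InnerEqSL (j : Fin d) (u v : ℝ → ℝ) : Prop :=
  ∀ (g h : T.Space₁ j) (f : T.interval j → ℝ), IsWeakSL (T.interval j) u v h f →
    Integrable (fun x => g x * f x) → inner ℝ g h = ∫ x, g x * f x

/-- The squared norm of `g` in the restriction to `(0,1)` of the Hilbert space of `k_j`; it is `∞`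
if `g` is not in the restriction. -/
noncomputable def restrNormSq (j : Fin d) (g : unitIoo → ℝ) : ℝ≥0∞ :=
  ⨅ (h : T.Space₁ j) (_ : ∀ x : unitIoo, h (Set.inclusion (T.unitIoo_subset j) x) = g x),
    ‖h‖ₑ ^ 2

/-- `∫ |D¹g|²` over `(0,1)` for the weak derivative `D¹g`; it is `∞` if there is none. -/
noncomputable def derivNormSq (g : unitIoo → ℝ) : ℝ≥0∞ :=
  ⨅ (f : unitIoo → ℝ) (_ : IsWeakDeriv unitIoo 1 g f), ∫⁻ x, ‖f x‖ₑ ^ 2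

/-- The restriction to `(0,1)` of the Hilbert space of `k_j` is the first-order Sobolev space, with
equivalent norms. -/
def RestrNormEquiv (j : Fin d) : Prop :=
  ∃ c C : ℝ, 0 < c ∧ 0 < C ∧
    (∀ g : unitIoo → ℝ, ENNReal.ofReal c * derivNormSq g ≤ T.restrNormSq j g) ∧
    ∀ g : unitIoo → ℝ, Continuous g →
      T.restrNormSq j g ≤ ENNReal.ofReal C * ((∫⁻ x, ‖g x‖ₑ ^ 2) + derivNormSq g)

/-- For `w` in `L²(a_j, b_j)`, the transform `∫ k_j(·, s) w(s) ds` is defined on `(0,1)` and has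
its second weak derivative in `L²(0,1)`. -/
def TransformRegular (j : Fin d) : Prop :=
  ∀ w : T.interval j → ℝ, MemLp w 2 →
    (∀ x ∈ unitIoo, Integrable fun s : T.interval j => T.kernel₁ j x s * w s) ∧
    ∃ f : unitIoo → ℝ, MemLp f 2 ∧
      IsWeakDeriv unitIoo 2 (fun x => ∫ s : T.interval j, T.kernel₁ j x s * w s) f

/-- The Sturm–Liouville assumption on a tensor Markov kernel. -/
def SturmLiouville : Prop :=
  ∀ j, (∃ u v : ℝ → ℝ, T.SolvesODE j u v ∧ T.InnerEqSL j u v) ∧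
    T.RestrNormEquiv j ∧ T.TransformRegular j

/-! ### The space of kernel integral transforms -/

/-- The elements of the Hilbert space of `k` of the form `∫ k(·, s) w(s) ds` with `w ∈ L²`. -/
def spaceTwo : Set T.Space :=
  {g | ∃ w : T.box → ℝ, MemLp w 2 ∧ ∀ x : T.box,
    Integrable (fun s : T.box => T.kernel x s * w s) ∧ g x = ∫ s : T.box, T.kernel x s * w s}

/-- The restrictions to `(0,1)^d` of the functions in `spaceTwo`. -/
def restrSpaceTwo : Set (openCube d → ℝ) :=
  {g | ∃ h ∈ T.spaceTwo, ∀ x : openCube d, h (Set.inclusion T.openCube_subset x) = g x}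

end TensorMarkovKernel

/-! ### Weak derivatives on the unit interval -/

namespace IsTestFunction

variable {E : Type*} [NormedAddCommGroup E] [NormedSpace ℝ E] {S : Set E} {φ ψ : E → ℝ}

/-! In one variable the kernel is a multiple of the Green function of L[g] = -(u g')' + v g. The
functions p and q solve L[r] = 0, the quantity u (p' q - p q') is a nonzero constant c, and the
transform K satisfies L[K w] = c w. So K w gains two derivatives. Conversely, a function h with two
weak derivatives on (0,1) agrees with the transform of w = L[h] / c on (0,1) up to a combination of
q and p. That combination is supplied by values of w outside [0,1]: on (0,1) the section k(·, s) is
a multiple of q for s < 0 and of p for s > 1. The coefficients needed are u (p' h - p h') / c at 0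
and u (q h' - q' h) / c at 1.

This requires c ≠ 0, room on both sides of [0,1], and control of p and q far out;
`SturmLiouville.exists_slPair` extracts all three. If c = 0, then L vanishes identically and the
formula for the inner product makes the Hilbert space trivial. If the interval ended at 0 or 1,
evaluation at that endpoint would be represented by a multiple of q or p. Such an element is killed
by L, hence is zero, although the constant 1 has boundary value 1. Finally, convergence of the
transform for every w in L² puts the kernel sections in L², by the converse of Cauchy–Schwarz.
Dividing by a weight equal to p on the left, q on the right and 1 on [0,1] turns k into a bounded
kernel over a finite measure.

In d variables the operators are tensor products, and each factor is an integral operator with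
bounded kernel plus a multiplication operator. `splitMul` and `splitPoint` write such a sum as one
weighted pairing on a product space, in which both evaluation maps are measure preserving up to a
constant. Products of such maps have the same property, so `exists_transfer` bounds the whole tensor
product on L² without any theory of tensor products of operators.

Applied to the derivatives of the kernel, this gives `exists_memLp_sideTransform_mixedPartial`:
transforms have dominating mixed smoothness. Applied to the one-variable inverse (`integral_eq_sum`,
`exists_inverse`), it gives `exists_sideTransform_ae_eq`: every function of dominating mixed
smoothness is a.e. a transform of a compactly supported w. Compact support makes the transform a
Bochner integral of kernel sections, hence an element of the Hilbert space. All elements are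
continuous, which fixes the representative. -/

theorem eq_zero (h : IsTestFunction S φ) {x : E} (hx : x ∉ S) : φ x = 0 :=
  image_eq_zero_of_notMem_tsupport fun h' => hx (h.2.2 h')

theorem continuous (h : IsTestFunction S φ) : Continuous φ := h.1.continuous

theorem exists_bound (h : IsTestFunction S φ) : ∃ C, ∀ x, ‖φ x‖ ≤ C :=
  h.2.1.exists_bound_of_continuous h.continuous

theorem deriv {S : Set ℝ} {φ : ℝ → ℝ} (h : IsTestFunction S φ) : IsTestFunction S (deriv φ) :=
  ⟨(contDiff_infty_iff_deriv.1 h.1).2, h.2.1.deriv,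
    (closure_minimal support_deriv_subset isClosed_closure).trans h.2.2⟩

theorem iteratedDeriv {S : Set ℝ} {φ : ℝ → ℝ} (h : IsTestFunction S φ) (n : ℕ) :
    IsTestFunction S (iteratedDeriv n φ) := by
  induction n with
  | zero => simpa using h
  | succ n ih => rw [iteratedDeriv_succ]; exact ih.deriv

theorem sub (h : IsTestFunction S φ) (h' : IsTestFunction S ψ) :
    IsTestFunction S (fun x => φ x - ψ x) :=
  ⟨h.1.sub h'.1, h.2.1.sub h'.2.1,
    (tsupport_sub φ ψ).trans (Set.union_subset h.2.2 h'.2.2)⟩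

theorem const_mul (h : IsTestFunction S φ) (c : ℝ) : IsTestFunction S (fun x => c * φ x) :=
  ⟨contDiff_const.mul h.1, h.2.1.mul_left, (tsupport_mul_subset_right).trans h.2.2⟩

end IsTestFunction

theorem IsCompact.exists_Ioo_subset_unitIoo {K : Set ℝ} (hK : IsCompact K) (h : K ⊆ unitIoo) :
    ∃ a b : ℝ, 0 < a ∧ a < b ∧ b < 1 ∧ K ⊆ Set.Ioo a b := by
  rcases K.eq_empty_or_nonempty with rfl | hne
  · exact ⟨1/3, 2/3, by norm_num, by norm_num, by norm_num, by simp⟩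
  · obtain ⟨x, hx, hx'⟩ := hK.exists_isLeast hne
    obtain ⟨y, hy, hy'⟩ := hK.exists_isGreatest hne
    have h1 := h hx
    have h2 := h hy
    have hxy := hx' hy
    refine ⟨x / 2, (y + 1) / 2, by linarith [h1.1], by linarith [h1.1, h2.2], by linarith [h2.2],
      fun z hz => ⟨by linarith [hx' hz, h1.1], by linarith [hy' hz, h2.2]⟩⟩

theorem exists_isTestFunction_unitIoo_integral_eq_one :
    ∃ ψ : ℝ → ℝ, IsTestFunction unitIoo ψ ∧ ∫ x, ψ x = 1 := by
  let f : ContDiffBump (1/2 : ℝ) := ⟨1/8, 1/4, by norm_num, by norm_num⟩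
  refine ⟨f.normed volume, ⟨f.contDiff_normed, f.hasCompactSupport_normed, ?_⟩, f.integral_normed⟩
  rw [f.tsupport_normed_eq, Real.closedBall_eq_Icc]
  exact Set.Icc_subset_Ioo (by norm_num [f]) (by norm_num [f])

/-- A test function with vanishing integral is the derivative of a test function. -/
theorem IsTestFunction.exists_deriv_eq {ψ : ℝ → ℝ} (h : IsTestFunction unitIoo ψ)
    (h0 : ∫ x, ψ x = 0) : ∃ φ, IsTestFunction unitIoo φ ∧ _root_.deriv φ = ψ := by
  obtain ⟨a, b, ha, hab, hb, hK⟩ := IsCompact.exists_Ioo_subset_unitIoo h.2.1 h.2.2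
  have hout : ∀ x, x ∉ Set.Ioo a b → ψ x = 0 := fun x hx =>
    image_eq_zero_of_notMem_tsupport fun h' => hx (hK h')
  have hder : ∀ x, HasDerivAt (fun x => ∫ t in a..x, ψ t) (ψ x) x := fun x =>
    intervalIntegral.integral_hasDerivAt_right (h.continuous.intervalIntegrable _ _)
      (h.continuous.stronglyMeasurableAtFilter _ _) h.continuous.continuousAt
  have hd : _root_.deriv (fun x => ∫ t in a..x, ψ t) = ψ := funext fun x => (hder x).deriv
  have hsupp : Function.support (fun x => ∫ t in a..x, ψ t) ⊆ Set.Icc a b := by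
    intro x hx
    by_contra hx'
    apply hx
    simp only [Set.mem_Icc, not_and_or, not_le] at hx'
    rcases hx' with hx' | hx'
    · refine (intervalIntegral.integral_congr (g := fun _ => 0) fun t ht => ?_).trans (by simp)
      rw [Set.uIcc_of_ge hx'.le] at ht
      exact hout t fun h2 => not_lt.2 ht.2 h2.1
    · change ∫ t in a..x, ψ t = 0
      rw [← h0]
      refine intervalIntegral.integral_eq_integral_of_support_subset fun t ht => ?_
      by_contra h3
      refine ht (hout t fun h2 => h3 ⟨h2.1, h2.2.le.trans hx'.le⟩)
  refine ⟨fun x => ∫ t in a..x, ψ t,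
    ⟨contDiff_infty_iff_deriv.2 ⟨fun x => (hder x).differentiableAt, by rw [hd]; exact h.1⟩, ?_, ?_⟩, hd⟩
  · exact HasCompactSupport.of_support_subset_isCompact isCompact_Icc hsupp
  · exact (closure_minimal hsupp isClosed_Icc).trans (Set.Icc_subset_Ioo ha hb)

theorem integral_unitIoo_eq (f : ℝ → ℝ) : ∫ x in unitIoo, f x = ∫ x in (0:ℝ)..1, f x := by
  rw [intervalIntegral.integral_of_le zero_le_one, integral_Ioc_eq_integral_Ioo]

theorem IsTestFunction.integral_unitIoo {φ : ℝ → ℝ} (h : IsTestFunction unitIoo φ) :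
    ∫ x in unitIoo, φ x = ∫ x, φ x :=
  setIntegral_eq_integral_of_forall_compl_eq_zero fun _ hx => h.eq_zero hx

/-- A function with an integrable weak derivative is an indefinite integral of it. -/
theorem ae_eq_const_add_integral {h h₁ : ℝ → ℝ} (hi : LocallyIntegrableOn h unitIoo)
    (hi₁ : IntegrableOn h₁ unitIoo)
    (hw : ∀ φ, IsTestFunction unitIoo φ →
      ∫ x in unitIoo, h x * deriv φ x = - ∫ x in unitIoo, h₁ x * φ x) :
    ∃ C : ℝ, ∀ᵐ x, x ∈ unitIoo → h x = C + ∫ t in (0:ℝ)..x, h₁ t := by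
  have hii : IntervalIntegrable h₁ volume 0 1 :=
    (intervalIntegrable_iff_integrableOn_Ioo_of_le zero_le_one).2 hi₁
  set H : ℝ → ℝ := fun x => ∫ t in (0:ℝ)..x, h₁ t with hH
  have hac : AbsolutelyContinuousOnInterval H 0 1 :=
    hii.absolutelyContinuousOnInterval_intervalIntegral (by simp)
  have hHi : IntegrableOn H unitIoo := by
    have := hac.continuousOn.integrableOn_compact (μ := volume) isCompact_uIcc
    rw [Set.uIcc_of_le zero_le_one] at this
    exact this.mono_set Set.Ioo_subset_Icc_self
  have hHw : ∀ φ, IsTestFunction unitIoo φ →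
      ∫ x in unitIoo, H x * deriv φ x = - ∫ x in unitIoo, h₁ x * φ x := by
    intro φ hφ
    have := hac.integral_mul_deriv_eq_deriv_mul
      ((hφ.1.of_le (by norm_cast)).contDiffOn.absolutelyContinuousOnInterval)
    rw [integral_unitIoo_eq, integral_unitIoo_eq, this, hφ.eq_zero (x := 0) (by simp),
      hφ.eq_zero (x := 1) (by simp)]
    simp only [mul_zero, sub_zero, zero_sub, neg_inj]
    refine intervalIntegral.integral_congr_ae ?_
    filter_upwards [hii.ae_hasDerivAt_integral] with x hx hx'
    rw [(hx (Set.uIoc_subset_uIcc hx') 0 (by simp)).deriv]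
  -- The du Bois-Reymond argument: for a test function ψ, the difference ψ - (∫ψ) ψ₀ has integral
  -- zero, so it is the derivative of a test function and is annihilated by h - H. Thus h - H acts
  -- on ψ as the constant C.
  obtain ⟨ψ₀, hψ₀, hψ₀1⟩ := exists_isTestFunction_unitIoo_integral_eq_one
  have hHl : LocallyIntegrableOn H unitIoo := hHi.locallyIntegrableOn
  have hmul : ∀ {f φ : ℝ → ℝ}, LocallyIntegrableOn f unitIoo → IsTestFunction unitIoo φ →
      IntegrableOn (fun x => f x * φ x) unitIoo := by
    intro f φ hf hφ
    obtain ⟨C, hC⟩ := hφ.exists_bound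
    have h1 : IntegrableOn (fun x => f x * φ x) (tsupport φ) :=
      Integrable.mul_bdd (c := C) (hf.integrableOn_compact_subset hφ.2.2 hφ.2.1)
        hφ.continuous.aestronglyMeasurable (ae_of_all _ hC)
    refine ((integrableOn_iff_integrable_of_support_subset ?_).1 h1).integrableOn
    intro x hx
    by_contra hx'
    exact hx (by simp [image_eq_zero_of_notMem_tsupport hx'])
  set C := ∫ x in unitIoo, (h x - H x) * ψ₀ x with hC
  refine ⟨C, ?_⟩
  have key := isOpen_Ioo.ae_eq_zero_of_integral_contDiff_smul_eq_zero (U := unitIoo)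
    (μ := volume.restrict unitIoo)
    (f := fun x => h x - H x - C) ?_ ?_
  · rw [ae_restrict_iff' measurableSet_Ioo] at key
    filter_upwards [key] with x hx hx'
    linarith [hx hx' hx']
  · exact (((hi.sub hHl).sub ((locallyIntegrable_const C).locallyIntegrableOn _)).mono_measure
      Measure.restrict_le_self)
  · intro ψ h1 h2 h3
    have hψ : IsTestFunction unitIoo ψ := ⟨h1, h2, h3⟩
    have hint : ∀ {φ : ℝ → ℝ}, IsTestFunction unitIoo φ → Integrable φ := fun h =>
      h.continuous.integrable_of_hasCompactSupport h.2.1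
    obtain ⟨φ, hφ, hφd⟩ := (hψ.sub (hψ₀.const_mul (∫ x, ψ x))).exists_deriv_eq (by
      rw [integral_sub (hint hψ) ((hint hψ₀).const_mul _), integral_const_mul, hψ₀1]; ring)
    have e1 : ∫ x in unitIoo, (h x - H x) * deriv φ x = 0 := by
      simp_rw [sub_mul]
      rw [integral_sub (hmul hi hφ.deriv) (hmul hHl hφ.deriv), hw φ hφ, hHw φ hφ, sub_self]
    rw [hφd] at e1
    have hd : LocallyIntegrableOn (fun x => h x - H x) unitIoo := hi.sub hHl
    have e2 : ∫ x in unitIoo, (h x - H x) * ψ x = (∫ x, ψ x) * C := by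
      have : ∀ x, (h x - H x) * (ψ x - (∫ x, ψ x) * ψ₀ x)
          = (h x - H x) * ψ x - (∫ x, ψ x) * ((h x - H x) * ψ₀ x) := fun x => by ring
      simp_rw [this] at e1
      rw [integral_sub (hmul hd hψ) ((hmul hd hψ₀).const_mul _), integral_const_mul] at e1
      linarith
    have : ∀ x, ψ x • (h x - H x - C) = (h x - H x) * ψ x - C * ψ x := fun x => by
      simp; ring
    simp_rw [this]
    rw [integral_sub (hmul hd hψ) ((hint hψ).restrict.const_mul _), integral_const_mul, e2,
      hψ.integral_unitIoo]
    ring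

/-- Integration by parts for a function with an integrable weak derivative. -/
theorem exists_boundary_values {h h₁ : ℝ → ℝ} (hi : IntegrableOn h unitIoo)
    (hi₁ : IntegrableOn h₁ unitIoo)
    (hw : ∀ φ, IsTestFunction unitIoo φ →
      ∫ x in unitIoo, h x * deriv φ x = - ∫ x in unitIoo, h₁ x * φ x) :
    ∃ H₀ H₁ : ℝ, ∀ X X' : ℝ → ℝ, (∀ x ∈ Set.Icc (0:ℝ) 1, HasDerivAt X (X' x) x) →
      ContinuousOn X' (Set.Icc 0 1) →
      (∫ x in unitIoo, h x * X' x) + ∫ x in unitIoo, h₁ x * X x = H₁ * X 1 - H₀ * X 0 := by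
  obtain ⟨C, hC⟩ := ae_eq_const_add_integral hi.locallyIntegrableOn hi₁ hw
  have hii : IntervalIntegrable h₁ volume 0 1 :=
    (intervalIntegrable_iff_integrableOn_Ioo_of_le zero_le_one).2 hi₁
  set H : ℝ → ℝ := fun x => ∫ t in (0:ℝ)..x, h₁ t with hH
  have hac : AbsolutelyContinuousOnInterval H 0 1 :=
    hii.absolutelyContinuousOnInterval_intervalIntegral (by simp)
  -- The boundary values of the continuous representative C + H, where H vanishes at 0.
  refine ⟨C, C + H 1, fun X X' hX hX' => ?_⟩
  have hXac : AbsolutelyContinuousOnInterval X 0 1 := by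
    apply ContDiffOn.absolutelyContinuousOnInterval
    rw [Set.uIcc_of_le zero_le_one, contDiffOn_one_iff_derivWithin (uniqueDiffOn_Icc zero_lt_one)]
    refine ⟨fun x hx => (hX x hx).differentiableAt.differentiableWithinAt, hX'.congr fun x hx => ?_⟩
    exact (hX x hx).hasDerivWithinAt.derivWithin (uniqueDiffOn_Icc zero_lt_one x hx)
  have hX'i : IntervalIntegrable X' volume 0 1 :=
    ContinuousOn.intervalIntegrable (by rwa [Set.uIcc_of_le zero_le_one])
  have key := hac.integral_mul_deriv_eq_deriv_mul hXac
  have e1 : ∫ x in (0:ℝ)..1, H x * deriv X x = ∫ x in (0:ℝ)..1, H x * X' x := by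
    refine intervalIntegral.integral_congr fun x hx => ?_
    rw [Set.uIcc_of_le zero_le_one] at hx
    simp only [(hX x hx).deriv]
  have e2 : ∫ x in (0:ℝ)..1, deriv H x * X x = ∫ x in (0:ℝ)..1, h₁ x * X x := by
    refine intervalIntegral.integral_congr_ae ?_
    filter_upwards [hii.ae_hasDerivAt_integral] with x hx hx'
    rw [(hx (Set.uIoc_subset_uIcc hx') 0 (by simp)).deriv]
  have e3 : ∫ x in unitIoo, h x * X' x = C * (X 1 - X 0) + ∫ x in (0:ℝ)..1, H x * X' x := by
    have : ∫ x in unitIoo, h x * X' x = ∫ x in unitIoo, (C * X' x + H x * X' x) := by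
      refine setIntegral_congr_ae measurableSet_Ioo ?_
      filter_upwards [hC] with x hx hx'
      rw [hx hx']; ring
    rw [this, integral_unitIoo_eq, intervalIntegral.integral_add (hX'i.const_mul C)
      (hX'i.continuousOn_mul hac.continuousOn), intervalIntegral.integral_const_mul,
      intervalIntegral.integral_eq_sub_of_hasDerivAt _ hX'i]
    rwa [Set.uIcc_of_le zero_le_one]
  rw [e3, integral_unitIoo_eq, ← e1, ← e2, key, hH]
  simp only [intervalIntegral.integral_same]
  ring

/-! ### Product measures -/

/-- Lebesgue measure on the unit interval, as a measure on `ℝ`. -/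
noncomputable abbrev unitVolume : Measure ℝ := volume.restrict unitIoo

/-- Lebesgue measure on the unit cube, as a measure on `ℝ^d`. -/
noncomputable abbrev cubeVolume (d : ℕ) : Measure (Fin d → ℝ) := Measure.pi fun _ => unitVolume

theorem openCube_eq_pi (d : ℕ) : openCube d = Set.univ.pi fun _ => unitIoo := by
  ext x; simp [openCube]

theorem isOpen_openCube (d : ℕ) : IsOpen (openCube d) := by
  rw [openCube_eq_pi]; exact isOpen_set_pi Set.finite_univ fun _ _ => isOpen_Ioo

theorem measurableSet_openCube (d : ℕ) : MeasurableSet (openCube d) :=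
  (isOpen_openCube d).measurableSet

theorem volume_restrict_openCube (d : ℕ) : volume.restrict (openCube d) = cubeVolume d := by
  rw [openCube_eq_pi, volume_pi, Measure.restrict_pi_pi]

theorem integrable_pi_iff_insertNth {n : ℕ} {m : Fin (n + 1) → Measure ℝ} [∀ i, SigmaFinite (m i)]
    (i : Fin (n + 1)) {f : (Fin (n + 1) → ℝ) → ℝ} :
    Integrable f (Measure.pi m) ↔ Integrable (fun z : ℝ × (Fin n → ℝ) => f (i.insertNth z.1 z.2))
      ((m i).prod (Measure.pi fun j => m (i.succAbove j))) :=
  ((measurePreserving_piFinSuccAbove m i).symm.integrable_comp_emb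
    (MeasurableEquiv.measurableEmbedding _)).symm

theorem integral_pi_insertNth {n : ℕ} {m : Fin (n + 1) → Measure ℝ} [∀ i, SigmaFinite (m i)]
    (i : Fin (n + 1)) (f : (Fin (n + 1) → ℝ) → ℝ) :
    ∫ x, f x ∂Measure.pi m = ∫ z : ℝ × (Fin n → ℝ), f (i.insertNth z.1 z.2)
      ∂(m i).prod (Measure.pi fun j => m (i.succAbove j)) :=
  ((measurePreserving_piFinSuccAbove m i).symm.integral_comp
    (MeasurableEquiv.measurableEmbedding _) f).symm

theorem integrable_mul_prod_of_bdd {d : ℕ} {m : Fin d → Measure ℝ}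
    {Θ : (Fin d → ℝ) → ℝ} (hΘ : Integrable Θ (Measure.pi m)) {η : Fin d → ℝ → ℝ}
    (hη : ∀ j, Measurable (η j) ∧ ∃ C, ∀ x, ‖η j x‖ ≤ C) :
    Integrable (fun x => Θ x * ∏ j, η j (x j)) (Measure.pi m) := by
  choose hm C hC using hη
  refine Integrable.mul_bdd (c := ∏ j, C j) hΘ ?_ (ae_of_all _ fun x => ?_)
  · exact (Finset.measurable_prod _ fun j _ =>
      (hm j).comp (measurable_pi_apply j)).aestronglyMeasurable
  · rw [norm_prod]
    exact Finset.prod_le_prod (fun _ _ => norm_nonneg _) fun j _ => hC j _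

theorem ae_eq_zero_of_integral_mul_test {θ : ℝ → ℝ} (hθ : Integrable θ unitVolume)
    (h : ∀ φ, IsTestFunction unitIoo φ → ∫ x, θ x * φ x ∂unitVolume = 0) :
    θ =ᵐ[unitVolume] 0 := by
  have := isOpen_Ioo.ae_eq_zero_of_integral_contDiff_smul_eq_zero (U := unitIoo)
    (μ := unitVolume) (f := θ) (hθ.locallyIntegrable.locallyIntegrableOn _) fun g h1 h2 h3 => by
      simpa [mul_comm] using h g ⟨h1, h2, h3⟩
  filter_upwards [this, ae_restrict_mem measurableSet_Ioo] with x hx hx' using hx hx'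

/-- An integrable function on the cube is determined by its integrals against products of test
functions. -/
theorem ae_eq_zero_of_integral_mul_prod_test {d : ℕ} {Θ : (Fin d → ℝ) → ℝ}
    (hΘ : Integrable Θ (cubeVolume d))
    (h : ∀ η : Fin d → ℝ → ℝ, (∀ j, IsTestFunction unitIoo (η j)) →
      ∫ x, Θ x * ∏ j, η j (x j) ∂cubeVolume d = 0) : Θ =ᵐ[cubeVolume d] 0 := by
  -- The factors indexed by S are freed from being test functions, one coordinate at a time. With
  -- all other factors fixed and integrated out, what remains is an integrable θ of the single
  -- variable x_i. It is orthogonal to all test functions, hence zero a.e., and then it is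
  -- orthogonal to any bounded factor.
  have key : ∀ (S : Finset (Fin d)) (η : Fin d → ℝ → ℝ),
      (∀ j ∈ S, Measurable (η j) ∧ ∃ C, ∀ x, ‖η j x‖ ≤ C) →
      (∀ j ∉ S, IsTestFunction unitIoo (η j)) →
      ∫ x, Θ x * ∏ j, η j (x j) ∂cubeVolume d = 0 := by
    intro S
    induction S using Finset.induction_on with
    | empty => exact fun η _ hη => h η fun j => hη j (by simp)
    | insert i S hi ih =>
      intro η hη hη'
      obtain ⟨n, rfl⟩ : ∃ n, d = n + 1 := ⟨d - 1, by have := i.2; omega⟩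
      have hb : ∀ j, Measurable (η j) ∧ ∃ C, ∀ x, ‖η j x‖ ≤ C := fun j => by
        by_cases hj : j ∈ insert i S
        · exact hη j hj
        · exact ⟨(hη' j hj).continuous.measurable, (hη' j hj).exists_bound⟩
      set θ : ℝ → ℝ := fun t => ∫ x', Θ (i.insertNth t x') * ∏ j, η (i.succAbove j) (x' j)
        ∂cubeVolume n with hθ
      have fub : ∀ φ : ℝ → ℝ, (Measurable φ ∧ ∃ C, ∀ x, ‖φ x‖ ≤ C) →
          ∫ x, Θ x * ∏ j, Function.update η i φ j (x j) ∂cubeVolume (n + 1)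
            = ∫ t, θ t * φ t ∂unitVolume ∧ Integrable (fun t => θ t * φ t) unitVolume := by
        intro φ hφ
        have hint := integrable_mul_prod_of_bdd (η := Function.update η i φ) hΘ fun j => by
          by_cases hj : j = i
          · subst hj; simpa using hφ
          · simpa [hj] using hb j
        have e : ∀ (t : ℝ) (x' : Fin n → ℝ), Θ (i.insertNth t x') *
            ∏ j, Function.update η i φ j (i.insertNth (α := fun _ => ℝ) t x' j)
            = Θ (i.insertNth t x') * (∏ j, η (i.succAbove j) (x' j)) * φ t := by
          intro t x'
          rw [Fin.prod_univ_succAbove _ i]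
          simp [Fin.succAbove_ne]
          ring
        have hint' := (integrable_pi_iff_insertNth i).1 hint
        rw [integral_pi_insertNth i, integral_prod _ hint']
        simp_rw [e] at hint' ⊢
        have := hint'.integral_prod_left
        simp_rw [integral_mul_const] at this ⊢
        exact ⟨rfl, this⟩
      have h1 := (fub (fun _ => 1) ⟨measurable_const, 1, by simp⟩).2
      simp only [mul_one] at h1
      have hz : θ =ᵐ[unitVolume] 0 := by
        refine ae_eq_zero_of_integral_mul_test h1 fun φ hφ => ?_
        rw [← (fub φ ⟨hφ.continuous.measurable, hφ.exists_bound⟩).1]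
        refine ih _ (fun j hj => ?_) (fun j hj => ?_)
        · have : j ≠ i := fun h => hi (h ▸ hj)
          simpa [this] using hb j
        · by_cases hj' : j = i
          · subst hj'; simpa using hφ
          · simpa [hj'] using hη' j (by simp [hj, hj'])
      have := (fub (η i) (hb i)).1
      rw [Function.update_eq_self] at this
      rw [this, integral_congr_ae (g := fun _ => 0)]
      · simp
      · filter_upwards [hz] with t ht
        simp [ht]
  -- With every factor free, indicators are allowed. Rectangles form a π-system generating the
  -- σ-algebra, so all set integrals vanish.
  have hrect : ∀ A : Fin d → Set ℝ, (∀ j, MeasurableSet (A j)) →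
      ∫ x in Set.univ.pi A, Θ x ∂cubeVolume d = 0 := by
    intro A hA
    rw [← integral_indicator (MeasurableSet.univ_pi hA),
      ← key Finset.univ (fun j => (A j).indicator 1) (fun j _ => ⟨measurable_one.indicator (hA j), 1,
        fun x => by by_cases hx : x ∈ A j <;> simp [hx]⟩) (by simp)]
    refine integral_congr_ae (ae_of_all _ fun x => ?_)
    by_cases hx : x ∈ Set.univ.pi A
    · have h1 : ∀ j, (A j).indicator (1 : ℝ → ℝ) (x j) = 1 := fun j =>
        Set.indicator_of_mem (hx j (Set.mem_univ j)) _
      simp [hx, h1]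
    · have h2 := hx
      simp only [Set.mem_univ_pi, not_forall] at h2
      obtain ⟨j, hj⟩ := h2
      change _ = Θ x * ∏ j, (A j).indicator 1 (x j)
      rw [Set.indicator_of_notMem hx, Finset.prod_eq_zero (Finset.mem_univ j), mul_zero]
      exact Set.indicator_of_notMem hj _
  refine hΘ.ae_eq_zero_of_forall_setIntegral_eq_zero fun s hs _ => ?_
  refine MeasurableSpace.induction_on_inter (C := fun s _ => ∫ x in s, Θ x ∂cubeVolume d = 0)
    generateFrom_pi.symm isPiSystem_pi (by simp) ?_ ?_ ?_ s hs
  · rintro _ ⟨A, hA, rfl⟩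
    exact hrect A fun j => hA j (Set.mem_univ j)
  · intro t ht h0
    have h1 := integral_add_compl ht hΘ
    have h2 := hrect (fun _ => Set.univ) (fun _ => MeasurableSet.univ)
    rw [Set.pi_univ, setIntegral_univ] at h2
    rw [h0, h2] at h1
    simpa using h1
  · intro f hd hf h0
    rw [integral_iUnion hf hd hΘ.integrableOn]
    simp [h0]

/-! ### Transfer of square-integrable functions along a pair of maps -/

/-- Composition with ρ is an isometry of L² up to the scaling by C₂, and F is C₂ times its adjoint
applied to the square integrable function n · (f ∘ π). This gives L² boundedness of f ↦ F from
boundedness of n and invariance of the measures alone, a criterion stable under finite products. -/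
theorem exists_transfer {Ω X Y : Type*} [MeasurableSpace Ω] [MeasurableSpace X] [MeasurableSpace Y]
    {M : Measure Ω} {μ : Measure X} {ν : Measure Y} {π : Ω → X} {ρ : Ω → Y} {C₁ C₂ : ℝ≥0∞}
    (hπ : MeasurePreserving π M (C₁ • μ)) (hρ : MeasurePreserving ρ M (C₂ • ν))
    (hC₁ : C₁ ≠ ⊤) (hC₂ : C₂ ≠ ⊤) (hC₂' : C₂ ≠ 0) {n : Ω → ℝ} (hn : AEStronglyMeasurable n M)
    {N : ℝ} (hN : ∀ᵐ z ∂M, ‖n z‖ ≤ N) {f : X → ℝ} (hf : MemLp f 2 μ) :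
    ∃ F : Y → ℝ, MemLp F 2 ν ∧ ∀ ψ : Y → ℝ, MemLp ψ 2 ν →
      ∫ y, F y * ψ y ∂ν = ∫ z, n z * f (π z) * ψ (ρ z) ∂M := by
  have hG : MemLp (fun z => n z * f (π z)) 2 M :=
    ((hf.smul_measure hC₁).comp_measurePreserving hπ).mul (p := ⊤) (memLp_top_of_bound hn N hN)
  let U := (Lp.compMeasurePreservingₗᵢ (E := ℝ) (p := 2) ℝ ρ hρ).toContinuousLinearMap
  let F := ContinuousLinearMap.adjoint U (hG.toLp _)
  have hF : MemLp F 2 (C₂ • ν) := Lp.memLp F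
  have hF' : MemLp F 2 ν := by
    refine hF.of_measure_le_smul (c := C₂⁻¹) (by simp [hC₂']) ?_
    rw [smul_smul, ENNReal.inv_mul_cancel hC₂' hC₂, one_smul]
  refine ⟨fun y => C₂.toReal * F y, hF'.const_mul _, fun ψ hψ => ?_⟩
  have hψ' := hψ.smul_measure hC₂
  have h1 : inner ℝ F (hψ'.toLp ψ) = inner ℝ (hG.toLp _) (U (hψ'.toLp ψ)) :=
    ContinuousLinearMap.adjoint_inner_left U _ _
  rw [L2.inner_def, L2.inner_def] at h1
  have h2 : ∫ y, inner ℝ (F y) ((hψ'.toLp ψ) y) ∂(C₂ • ν) = C₂.toReal * ∫ y, F y * ψ y ∂ν := by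
    rw [← smul_eq_mul, ← integral_smul_measure]
    refine integral_congr_ae ?_
    filter_upwards [hψ'.coeFn_toLp] with y hy
    simp [hy, mul_comm]
  have h3 : ∫ z, inner ℝ ((hG.toLp _) z) (U (hψ'.toLp ψ) z) ∂M = ∫ z, n z * f (π z) * ψ (ρ z) ∂M := by
    refine integral_congr_ae ?_
    have h4 := Lp.coeFn_compMeasurePreserving (hψ'.toLp ψ) hρ
    have h5 := hρ.quasiMeasurePreserving.ae_eq_comp hψ'.coeFn_toLp
    filter_upwards [hG.coeFn_toLp, h4, h5] with z h6 h7 h8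
    have h9 : U (hψ'.toLp ψ) z = ψ (ρ z) := h7.trans h8
    rw [h6, h9]
    simp [mul_comm]
  simp_rw [mul_assoc C₂.toReal]
  rw [integral_const_mul, ← h2, h1, h3]

/-! ### Reproducing kernel Hilbert spaces of continuous kernels -/

section RKHS

variable {X : Type*} {k : X → X → ℝ} [Fact (kernelMatrix k).PosSemidef]

/-- The kernel function `k(·, x)`. -/
noncomputable def kernelSection (k : X → X → ℝ) [Fact (kernelMatrix k).PosSemidef] (x : X) :
    RKHS.OfKernel (kernelMatrix k) :=
  RKHS.kerFun (RKHS.OfKernel (kernelMatrix k)) x 1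

theorem kernelSection_apply (x y : X) : kernelSection k y x = k x y := by
  rw [kernelSection, RKHS.kerFun_apply, RKHS.OfKernel.kernel_ofKernel]
  simp [kernelMatrix]

theorem inner_kernelSection (f : RKHS.OfKernel (kernelMatrix k)) (x : X) :
    inner ℝ (kernelSection k x) f = f x := by
  rw [kernelSection, RKHS.kerFun_inner]; simp

/-- By the reproducing property, ‖k_y - k_x‖² = k(y,y) - k(y,x) - k(x,y) + k(x,x), which tends to 0
as y → x. -/
theorem continuous_kernelSection [TopologicalSpace X] (hk : Continuous fun z : X × X => k z.1 z.2) :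
    Continuous (kernelSection k) := by
  rw [continuous_iff_continuousAt]
  intro x
  rw [ContinuousAt, tendsto_iff_norm_sub_tendsto_zero]
  have h1 : ∀ y, ‖kernelSection k y - kernelSection k x‖ = √(k y y - k y x - k x y + k x x) := by
    intro y
    rw [norm_eq_sqrt_real_inner, inner_sub_left, inner_sub_right, inner_sub_right]
    simp only [inner_kernelSection, kernelSection_apply]
    ring_nf
  simp_rw [h1]
  have h2 : Continuous fun y => √(k y y - k y x - k x y + k x x) := by
    have a1 : Continuous fun y => k y y := hk.comp (continuous_id.prodMk continuous_id)
    have a2 : Continuous fun y => k y x := hk.comp (continuous_id.prodMk continuous_const)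
    have a3 : Continuous fun y => k x y := hk.comp (continuous_const.prodMk continuous_id)
    fun_prop
  have := h2.tendsto x
  simpa using this

theorem continuous_coe [TopologicalSpace X] (hk : Continuous fun z : X × X => k z.1 z.2)
    (f : RKHS.OfKernel (kernelMatrix k)) : Continuous f := by
  have : ⇑f = fun x => inner ℝ (kernelSection k x) f := funext fun x => (inner_kernelSection f x).symm
  rw [this]
  exact (continuous_kernelSection hk).inner continuous_const

/-- The integral of kernel functions against a finite measure of compact support. -/
theorem exists_coe_eq_integral [TopologicalSpace X] [SecondCountableTopology X] [MeasurableSpace X]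
    [OpensMeasurableSpace X] (hk : Continuous fun z : X × X => k z.1 z.2) {m : Measure X}
    {w : X → ℝ} (hw : Integrable w m) {J : Set X} (hJ : IsCompact J) (hwJ : ∀ x ∉ J, w x = 0) :
    ∃ h : RKHS.OfKernel (kernelMatrix k), ∀ x, h x = ∫ s, k x s * w s ∂m := by
  have hc := continuous_kernelSection hk
  obtain ⟨C, hC⟩ := hJ.exists_bound_of_continuousOn hc.continuousOn
  have hint : Integrable (fun s => w s • kernelSection k s) m := by
    refine (hw.norm.mul_const C).mono' (hw.1.smul hc.aestronglyMeasurable) (ae_of_all _ fun s => ?_)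
    rw [norm_smul]
    by_cases hs : s ∈ J
    · exact mul_le_mul_of_nonneg_left (hC s hs) (norm_nonneg _)
    · simp [hwJ s hs]
  -- A Bochner integral in the Hilbert space; it exists because the norms of the sections are
  -- bounded on the compact set that carries w. Pairing with the section at x moves inside the
  -- integral.
  refine ⟨∫ s, w s • kernelSection k s ∂m, fun x => ?_⟩
  rw [← inner_kernelSection, ← integral_inner hint]
  refine integral_congr_ae (ae_of_all _ fun s => ?_)
  simp only [real_inner_smul_right, inner_kernelSection, kernelSection_apply]
  ring

end RKHS

/-! ### Functions on subsets -/

theorem extend_val_of_mem {E : Type*} {S : Set E} (g : S → ℝ) {x : E} (hx : x ∈ S) :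
    Function.extend Subtype.val g 0 x = g ⟨x, hx⟩ :=
  Subtype.val_injective.extend_apply g 0 (⟨x, hx⟩ : S)

section Subtype

variable {E : Type*} [MeasureSpace E] {S : Set E}

theorem integral_subtype_eq (hS : MeasurableSet S) {f : S → ℝ} {F : E → ℝ} (h : ∀ x : S, f x = F x) :
    ∫ x, f x = ∫ x in S, F x := by
  rw [← integral_subtype hS]; simp [h]

theorem map_val_volume (hS : MeasurableSet S) :
    (volume : Measure S).map Subtype.val = volume.restrict S :=
  map_comap_subtype_coe hS _

theorem memLp_subtype_iff (hS : MeasurableSet S) {f : S → ℝ} {F : E → ℝ} (h : ∀ x : S, f x = F x)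
    {p : ℝ≥0∞} : MemLp f p ↔ MemLp F p (volume.restrict S) := by
  rw [← map_val_volume hS, (MeasurableEmbedding.subtype_coe hS).memLp_map_measure_iff]
  exact iff_of_eq (congrArg (fun f => MemLp f p) (funext h))

theorem integrable_subtype_iff (hS : MeasurableSet S) {f : S → ℝ} {F : E → ℝ}
    (h : ∀ x : S, f x = F x) : Integrable f ↔ IntegrableOn F S := by
  rw [← memLp_one_iff_integrable, memLp_subtype_iff hS h, memLp_one_iff_integrable, IntegrableOn]

theorem ae_subtype_iff (hS : MeasurableSet S) {P : E → Prop} :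
    (∀ᵐ x : S, P x) ↔ ∀ᵐ x ∂volume.restrict S, P x := by
  rw [← map_val_volume hS, (MeasurableEmbedding.subtype_coe hS).ae_map_iff]

variable [TopologicalSpace E]

theorem MeasureTheory.LocallyIntegrable.locallyIntegrableOn_extend [OpensMeasurableSpace E]
    (hS : IsOpen S) {f : S → ℝ} {F : E → ℝ}
    (h : ∀ x : S, f x = F x) (hf : LocallyIntegrable f) : LocallyIntegrableOn F S := by
  intro x hx
  obtain ⟨U, hU, hfU⟩ := hf ⟨x, hx⟩
  have hme := MeasurableEmbedding.subtype_coe hS.measurableSet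
  refine ⟨Subtype.val '' U, ?_, ?_⟩
  · rw [hS.nhdsWithin_eq hx]
    exact hS.isOpenMap_subtype_val.image_mem_nhds hU
  · have h1 : IntegrableOn F (Subtype.val '' U) ((volume : Measure S).map Subtype.val) := by
      rw [hme.integrableOn_map_iff, Set.preimage_image_eq _ Subtype.val_injective]
      exact (funext h : f = F ∘ Subtype.val) ▸ hfU
    rw [map_val_volume hS.measurableSet, IntegrableOn, Measure.restrict_restrict_of_subset] at h1
    · exact h1
    · rintro _ ⟨y, _, rfl⟩; exact y.2

theorem isLocallyFiniteMeasure_subtype [IsLocallyFiniteMeasure (volume : Measure E)]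
    (hS : MeasurableSet S) : IsLocallyFiniteMeasure (volume : Measure S) := by
  refine ⟨fun x => ?_⟩
  obtain ⟨U, hU, hfU⟩ := (volume : Measure E).finiteAt_nhds x
  refine ⟨Subtype.val ⁻¹' U, continuous_subtype_val.continuousAt hU, ?_⟩
  rw [show (volume : Measure S) = Measure.comap Subtype.val volume from rfl,
    (MeasurableEmbedding.subtype_coe hS).comap_apply]
  exact (measure_mono (Set.image_preimage_subset _ _)).trans_lt hfU

end Subtype

/-! ### A converse of the Cauchy–Schwarz inequality -/

/-- Truncations of f to sets of finite measure on which f is bounded define continuous functionals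
on L². They converge pointwise by dominated convergence, so by Banach–Steinhaus the limit w ↦ ∫ f w
is continuous. Its Riesz representative has the same integrals as f over sets of finite measure,
hence equals f a.e. -/
theorem memLp_two_of_forall_integrable_mul {X : Type*} [MeasurableSpace X] {μ : Measure X}
    [SigmaFinite μ] {f : X → ℝ} (hf : Measurable f)
    (h : ∀ w, MemLp w 2 μ → Integrable (fun x => f x * w x) μ) : MemLp f 2 μ := by
  let A : ℕ → Set X := fun n => spanningSets μ n ∩ {x | ‖f x‖ ≤ n}
  have hA : ∀ n, MeasurableSet (A n) := fun n =>
    (measurableSet_spanningSets μ n).inter (measurableSet_le hf.norm measurable_const)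
  have hAf : ∀ n, μ (A n) ≠ ⊤ := fun n =>
    ((measure_mono Set.inter_subset_left).trans_lt (measure_spanningSets_lt_top μ n)).ne
  have hfn : ∀ n, MemLp ((A n).indicator f) 2 μ := fun n => by
    rw [memLp_indicator_iff_restrict (hA n)]
    have : IsFiniteMeasure (μ.restrict (A n)) := isFiniteMeasure_restrict.2 (hAf n)
    refine MemLp.of_bound hf.aestronglyMeasurable n ?_
    filter_upwards [ae_restrict_mem (hA n)] with x hx using hx.2
  have hlim : ∀ x, ∀ᶠ n in Filter.atTop, x ∈ A n := fun x => by
    obtain ⟨N, hN⟩ := exists_nat_ge ‖f x‖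
    filter_upwards [Filter.eventually_ge_atTop (max N (spanningSetsIndex μ x))] with n hn
    refine ⟨?_, hN.trans (by exact_mod_cast (le_max_left _ _).trans hn)⟩
    exact monotone_spanningSets μ ((le_max_right _ _).trans hn) (mem_spanningSetsIndex μ x)
  have ht : Filter.Tendsto (fun n (w : Lp ℝ 2 μ) => innerSL ℝ ((hfn n).toLp _) w) Filter.atTop
      (nhds fun w => ∫ x, f x * w x ∂μ) := by
    rw [tendsto_pi_nhds]
    intro w
    have e : ∀ n, innerSL ℝ ((hfn n).toLp _) w = ∫ x, (A n).indicator f x * w x ∂μ := fun n => by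
      rw [innerSL_apply_apply, L2.inner_def]
      refine integral_congr_ae ?_
      filter_upwards [(hfn n).coeFn_toLp] with x hx
      simp [hx, mul_comm]
    simp_rw [e]
    refine tendsto_integral_of_dominated_convergence (fun x => ‖f x * w x‖)
      (fun n => ((hfn n).1.mul (Lp.memLp w).1)) (h w (Lp.memLp w)).norm
      (fun n => ae_of_all _ fun x => ?_) (ae_of_all _ fun x => ?_)
    · by_cases hx : x ∈ A n <;> simp [hx]; positivity
    · refine tendsto_const_nhds.congr' ?_
      filter_upwards [hlim x] with n hn
      simp [hn]
  let Λ := continuousLinearMapOfTendsto _ ht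
  let F := (InnerProductSpace.toDual ℝ (Lp ℝ 2 μ)).symm Λ
  have hF : ∀ w : Lp ℝ 2 μ, ∫ x, F x * w x ∂μ = ∫ x, f x * w x ∂μ := fun w => by
    have h1 : inner ℝ F w = Λ w := InnerProductSpace.toDual_symm_apply
    rw [L2.inner_def] at h1
    refine Eq.trans ?_ h1
    simp [mul_comm]
  have hind : ∀ s, ∀ hs : MeasurableSet s, ∀ hs' : μ s < ⊤, ∀ g : X → ℝ,
      (fun x => g x * indicatorConstLp 2 hs hs'.ne (1:ℝ) x)
        =ᵐ[μ] s.indicator g := by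
    intro s hs hs' g
    filter_upwards [indicatorConstLp_coeFn (p := 2) (hs := hs) (hμs := hs'.ne) (c := (1:ℝ))] with x hx
    rw [hx]; by_cases hxs : x ∈ s <;> simp [hxs]
  refine (memLp_congr_ae ?_).1 (Lp.memLp F)
  refine ae_eq_of_forall_setIntegral_eq_of_sigmaFinite (fun s hs hs' => ?_) (fun s hs hs' => ?_)
    fun s hs hs' => ?_
  · have := (Lp.memLp F).restrict s
    have hfin : IsFiniteMeasure (μ.restrict s) := isFiniteMeasure_restrict.2 hs'.ne
    exact this.integrable (by norm_num)
  · rw [← integrable_indicator_iff hs]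
    exact (h _ (Lp.memLp (indicatorConstLp 2 hs hs'.ne (1:ℝ)))).congr (hind s hs hs' f)
  · rw [← integral_indicator hs, ← integral_indicator hs, ← integral_congr_ae (hind s hs hs' f),
      ← integral_congr_ae (hind s hs hs' F), hF]

/-! ### Consequences of the Sturm–Liouville assumption in one variable -/

theorem isOpen_erealIoo (a b : EReal) : IsOpen (erealIoo a b) :=
  isOpen_Ioo.preimage continuous_coe_real_ereal

theorem ordConnected_erealIoo (a b : EReal) : (erealIoo a b).OrdConnected :=
  ⟨fun _ hx _ hy _ hz => ⟨hx.1.trans_le (EReal.coe_le_coe_iff.2 hz.1),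
    lt_of_le_of_lt (EReal.coe_le_coe_iff.2 hz.2) hy.2⟩⟩

/-- `r` is a `C¹` solution of `-(u r')' + v r = 0` on `I`. -/
structure IsSLSolution (I : Set ℝ) (u v r : ℝ → ℝ) : Prop where
  isOpen : IsOpen I
  u_contDiffOn : ContDiffOn ℝ 1 u I
  v_continuousOn : ContinuousOn v I
  contDiffOn : ContDiffOn ℝ 1 r I
  hasDerivAt_mul_deriv : ∀ x ∈ I, HasDerivAt (fun y => u y * deriv r y) (v x * r x) x

namespace IsSLSolution

variable {I : Set ℝ} {u v r s : ℝ → ℝ}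

theorem hasDerivAt_u (h : IsSLSolution I u v r) {x : ℝ} (hx : x ∈ I) :
    HasDerivAt u (deriv u x) x :=
  ((h.u_contDiffOn.differentiableOn (by norm_num)).differentiableAt (h.isOpen.mem_nhds hx)).hasDerivAt

theorem hasDerivAt (h : IsSLSolution I u v r) {x : ℝ} (hx : x ∈ I) :
    HasDerivAt r (deriv r x) x :=
  ((h.contDiffOn.differentiableOn (by norm_num)).differentiableAt (h.isOpen.mem_nhds hx)).hasDerivAt

theorem continuousOn_deriv_u (h : IsSLSolution I u v r) : ContinuousOn (deriv u) I :=
  h.u_contDiffOn.continuousOn_deriv_of_isOpen h.isOpen le_rfl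

theorem continuousOn_deriv (h : IsSLSolution I u v r) : ContinuousOn (deriv r) I :=
  h.contDiffOn.continuousOn_deriv_of_isOpen h.isOpen le_rfl

/-- The function u r' φ - r u φ' has compact support and derivative r L[φ], by the equation for r.
The case distinction on `tsupport` is needed because nothing is known about u and v outside I. -/
theorem integral_mul_slOp (h : IsSLSolution I u v r) {φ : ℝ → ℝ} (hφ : IsTestFunction I φ) :
    ∫ x in I, r x * TensorMarkovKernel.slOp u v φ x = 0 := by
  have hd : ∀ x, HasDerivAt φ (deriv φ x) x := fun x =>
    (hφ.1.differentiable (by norm_num)).differentiableAt.hasDerivAt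
  have hd' : ∀ x, HasDerivAt (deriv φ) (deriv (deriv φ) x) x := fun x =>
    (hφ.deriv.1.differentiable (by norm_num)).differentiableAt.hasDerivAt
  have hud : ∀ x ∈ I, HasDerivAt (fun y => u y * deriv φ y)
      (deriv u x * deriv φ x + u x * deriv (deriv φ) x) x := fun x hx =>
    (h.hasDerivAt_u hx).mul (hd' x)
  have hz : ∀ x, x ∉ tsupport φ → φ =ᶠ[nhds x] fun _ => 0 := fun x hx => by
    filter_upwards [(isClosed_tsupport φ).isOpen_compl.mem_nhds hx] with y hy
    exact image_eq_zero_of_notMem_tsupport hy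
  have hz' : ∀ x, x ∉ tsupport φ → deriv φ =ᶠ[nhds x] fun _ => 0 := fun x hx => by
    simpa using (hz x hx).deriv
  have hsl : ∀ x ∈ I, TensorMarkovKernel.slOp u v φ x
      = -(deriv u x * deriv φ x + u x * deriv (deriv φ) x) + v x * φ x := fun x hx => by
    rw [TensorMarkovKernel.slOp, (hud x hx).deriv]
  have hsl0 : ∀ x, x ∉ tsupport φ → TensorMarkovKernel.slOp u v φ x = 0 := fun x hx => by
    have : (fun y => u y * deriv φ y) =ᶠ[nhds x] fun _ => 0 := by
      filter_upwards [hz' x hx] with y hy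
      simp [hy]
    rw [TensorMarkovKernel.slOp, this.deriv_eq, (hz x hx).self_of_nhds]
    simp
  set G : ℝ → ℝ := fun x => u x * deriv r x * φ x - r x * (u x * deriv φ x) with hG
  have hGd : ∀ x, HasDerivAt G (r x * TensorMarkovKernel.slOp u v φ x) x := by
    intro x
    by_cases hx : x ∈ I
    · refine (((h.hasDerivAt_mul_deriv x hx).mul (hd x)).sub
        ((h.hasDerivAt hx).mul (hud x hx))).congr_deriv ?_
      rw [hsl x hx]; ring
    · have hx' : x ∉ tsupport φ := fun h' => hx (hφ.2.2 h')
      rw [hsl0 x hx', mul_zero]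
      refine (hasDerivAt_const x (0:ℝ)).congr_of_eventuallyEq ?_
      filter_upwards [hz x hx', hz' x hx'] with y h1 h2
      simp [hG, h1, h2]
  have hcs : ContinuousOn (fun x => r x * TensorMarkovKernel.slOp u v φ x) I := by
    refine h.contDiffOn.continuousOn.mul (ContinuousOn.congr ?_ hsl)
    exact (((h.continuousOn_deriv_u.mul hφ.deriv.continuous.continuousOn).add
      (h.u_contDiffOn.continuousOn.mul hφ.deriv.deriv.continuous.continuousOn)).neg).add
      (h.v_continuousOn.mul hφ.continuous.continuousOn)
  have hint : Integrable (fun x => r x * TensorMarkovKernel.slOp u v φ x) := by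
    refine (integrableOn_iff_integrable_of_support_subset (s := tsupport φ) fun x hx => ?_).1
      ((hcs.mono hφ.2.2).integrableOn_compact hφ.2.1)
    by_contra h'
    exact hx (by simp [hsl0 x h'])
  have hGc : Continuous G := continuous_iff_continuousAt.2 fun x => (hGd x).continuousAt
  have hGi : Integrable G := by
    refine hGc.integrable_of_hasCompactSupport (hφ.2.1.of_isClosed_subset isClosed_closure
      (closure_minimal (fun x hx => ?_) isClosed_closure))
    by_contra h'
    exact hx (by simp [hG, (hz x h').self_of_nhds, (hz' x h').self_of_nhds])
  rw [setIntegral_eq_integral_of_forall_compl_eq_zero fun x hx => by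
    rw [hsl0 x fun h' => hx (hφ.2.2 h'), mul_zero]]
  exact integral_eq_zero_of_hasDerivAt_of_integrable hGd hint hGi

/-- Lagrange's identity: the terms v r s cancel in the derivative of (u r') s - r (u s'). -/
theorem exists_wronskian_eq (h : IsSLSolution I u v r) (h' : IsSLSolution I u v s)
    (hI : I.OrdConnected) :
    ∃ c, ∀ x ∈ I, u x * (deriv r x * s x - r x * deriv s x) = c := by
  have hd : ∀ x ∈ I, HasDerivAt (fun x => u x * deriv r x * s x - r x * (u x * deriv s x)) 0 x := by
    intro x hx
    refine (((h.hasDerivAt_mul_deriv x hx).mul (h'.hasDerivAt hx)).sub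
      ((h.hasDerivAt hx).mul (h'.hasDerivAt_mul_deriv x hx))).congr_deriv ?_
    ring
  obtain ⟨c, hc⟩ := h.isOpen.exists_is_const_of_deriv_eq_zero hI.isPreconnected
    (fun x hx => (hd x hx).differentiableAt.differentiableWithinAt) fun x hx => (hd x hx).deriv
  exact ⟨c, fun x hx => by rw [← hc x hx]; ring⟩

/-- Where `u` does not vanish, solutions are twice continuously differentiable. -/
theorem hasDerivAt_deriv (h : IsSLSolution I u v r) (hu : ∀ x ∈ I, u x ≠ 0) {x : ℝ} (hx : x ∈ I) :
    HasDerivAt (deriv r) ((v x * r x - deriv u x * deriv r x) / u x) x := by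
  have h1 := (h.hasDerivAt_mul_deriv x hx).div (h.hasDerivAt_u hx) (hu x hx)
  have h2 : deriv r =ᶠ[nhds x] fun y => u y * deriv r y / u y := by
    filter_upwards [h.isOpen.mem_nhds hx] with y hy
    field_simp [hu y hy]
  refine (h1.congr_of_eventuallyEq h2).congr_deriv ?_
  have := hu x hx
  field_simp

theorem continuousOn_deriv_deriv (h : IsSLSolution I u v r) (hu : ∀ x ∈ I, u x ≠ 0) :
    ContinuousOn (deriv (deriv r)) I := by
  refine ContinuousOn.congr ?_ fun x hx => (h.hasDerivAt_deriv hu hx).deriv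
  exact ((h.v_continuousOn.mul h.contDiffOn.continuousOn).sub
    (h.continuousOn_deriv_u.mul h.continuousOn_deriv)).div h.u_contDiffOn.continuousOn hu

end IsSLSolution

theorem isWeakDeriv_one_zero : IsWeakDeriv unitIoo 1 (fun _ => 1) (fun _ => 0) := by
  have := isLocallyFiniteMeasure_subtype (S := unitIoo) measurableSet_Ioo
  refine ⟨locallyIntegrable_const _, locallyIntegrable_const _, fun φ hφ => ?_⟩
  rw [integral_subtype_eq measurableSet_Ioo (F := fun x => deriv φ x) (by simp),
    hφ.deriv.integral_unitIoo]
  simp only [pow_one, zero_mul, integral_zero, mul_zero]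
  refine integral_eq_zero_of_hasDerivAt_of_integrable (f := φ) (fun x =>
    (hφ.1.differentiable (by norm_num)).differentiableAt.hasDerivAt)
    (hφ.deriv.continuous.integrable_of_hasCompactSupport hφ.deriv.2.1)
    (hφ.continuous.integrable_of_hasCompactSupport hφ.2.1)

/-! ### Nonvanishing Wronskian, room beyond the endpoints, square integrability -/

namespace TensorMarkovKernel

variable {d : ℕ} (T : TensorMarkovKernel d) {j : Fin d} {u v : ℝ → ℝ}

theorem isOpen_interval (j : Fin d) : IsOpen (T.interval j) := isOpen_erealIoo _ _

theorem ordConnected_interval (j : Fin d) : (T.interval j).OrdConnected := ordConnected_erealIoo _ _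

theorem isSLSolution (h : T.SolvesODE j u v) {r : ℝ → ℝ} (hr : r = T.p j ∨ r = T.q j) :
    IsSLSolution (T.interval j) u v r := by
  obtain ⟨h1, h2⟩ := h.2.2 r hr
  refine ⟨T.isOpen_interval j, h.1, h.2.1, h1, fun x hx => ?_⟩
  have h3 := (h2 x hx).2
  rw [slOp] at h3
  exact (h2 x hx).1.hasDerivAt.congr_deriv (by linarith)

theorem continuous_kernel₁ (hp : ContinuousOn (T.p j) (T.interval j))
    (hq : ContinuousOn (T.q j) (T.interval j)) :
    Continuous fun z : T.interval j × T.interval j => T.kernel₁ j z.1 z.2 := by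
  have := T.ordConnected_interval j
  refine (hp.comp_continuous (by fun_prop) fun z => ?_).mul
    (hq.comp_continuous (by fun_prop) fun z => ?_)
  · rcases min_choice (z.1 : ℝ) z.2 with h | h <;> rw [h] <;> simp
  · rcases max_choice (z.1 : ℝ) z.2 with h | h <;> rw [h] <;> simp

/-- If L[e] = 0, the formula for the inner product gives ⟨e, e⟩ = ∫ e · 0 = 0. Both nondegeneracy
arguments below rest on this. -/
theorem eq_zero_of_isWeakSL_zero (h : T.InnerEqSL j u v) {e : T.Space₁ j} (he : Continuous e)
    (h0 : ∀ φ, IsTestFunction (T.interval j) φ → ∫ x : T.interval j, e x * slOp u v φ x = 0) :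
    e = 0 := by
  have := isLocallyFiniteMeasure_subtype (T.isOpen_interval j).measurableSet
  rw [← inner_self_eq_zero (𝕜 := ℝ), h e e (fun _ => 0) ⟨he.locallyIntegrable,
    locallyIntegrable_const _, fun φ hφ => by simpa using h0 φ hφ⟩ (by simp)]
  simp

/-- Were the constant zero, strict monotonicity of p/q would force u = 0, the equation for p would
then force v = 0, and L would annihilate every element of the Hilbert space. -/
theorem u_ne_zero_and_wronskian (hS : T.SolvesODE j u v) (hE : T.InnerEqSL j u v) :
    ∃ c : ℝ, c ≠ 0 ∧ ∀ x ∈ T.interval j, u x *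
      (deriv (T.p j) x * T.q j x - T.p j x * deriv (T.q j) x) = c := by
  have hp := T.isSLSolution hS (Or.inl rfl)
  have hq := T.isSLSolution hS (Or.inr rfl)
  obtain ⟨c, hc⟩ := hp.exists_wronskian_eq hq (T.ordConnected_interval j)
  refine ⟨c, fun hc0 => ?_, hc⟩
  subst hc0
  have hI := T.isOpen_interval j
  -- Near a point with u ≠ 0 the numerator p' q - p q' of (p/q)' vanishes, so p/q would be locally
  -- constant.
  have hu : ∀ x ∈ T.interval j, u x = 0 := by
    intro x hx
    by_contra hux
    have hev : ∀ᶠ y in nhds x, y ∈ T.interval j ∧ u y ≠ 0 :=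
      (hI.eventually_mem hx).and ((hp.hasDerivAt_u hx).continuousAt.eventually_ne hux)
    obtain ⟨ε, hε, hball⟩ := Metric.eventually_nhds_iff_ball.1 hev
    have hd : ∀ y ∈ Metric.ball x ε, HasDerivAt (fun x => T.p j x / T.q j x) 0 y := by
      intro y hy
      obtain ⟨hyI, hyu⟩ := hball y hy
      have hqy := (T.q_pos j y hyI).ne'
      refine ((hp.hasDerivAt hyI).div (hq.hasDerivAt hyI) hqy).congr_deriv ?_
      have := (mul_eq_zero.1 (hc y hyI)).resolve_left hyu
      rw [this, zero_div]
    have hx1 : x ∈ Metric.ball x ε := Metric.mem_ball_self hε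
    have hx2 : x + ε / 2 ∈ Metric.ball x ε := by
      rw [Metric.mem_ball, Real.dist_eq, add_sub_cancel_left, abs_of_pos (by positivity)]; linarith
    have h1 := Metric.isOpen_ball.is_const_of_deriv_eq_zero (convex_ball x ε).isPreconnected
      (fun y hy => (hd y hy).differentiableAt.differentiableWithinAt) (fun y hy => (hd y hy).deriv)
      hx1 hx2
    exact (T.strictMono j hx (hball _ hx2).1 (by linarith)).ne h1
  have hev : ∀ x ∈ T.interval j, ∀ g : ℝ → ℝ, (fun y => u y * g y) =ᶠ[nhds x] fun _ => 0 :=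
    fun x hx g => by
      filter_upwards [hI.mem_nhds hx] with y hy
      simp [hu y hy]
  have hv : ∀ x ∈ T.interval j, v x = 0 := by
    intro x hx
    have h1 := hp.hasDerivAt_mul_deriv x hx
    have h2 := (hasDerivAt_const x (0:ℝ)).congr_of_eventuallyEq (hev x hx (deriv (T.p j)))
    exact (mul_eq_zero.1 (h1.unique h2)).resolve_right (T.p_pos j x hx).ne'
  -- The section at 1/2 must now be the zero element, although its value at 1/2 is p(1/2) q(1/2) >
  -- 0.
  have hx : (1/2 : ℝ) ∈ T.interval j := T.unitIoo_subset j ⟨by norm_num, by norm_num⟩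
  have hk := T.continuous_kernel₁ hp.contDiffOn.continuousOn hq.contDiffOn.continuousOn
  have h0 := T.eq_zero_of_isWeakSL_zero hE (e := kernelSection _ ⟨1/2, hx⟩) (continuous_coe hk _) <| by
    intro φ _
    rw [integral_congr_ae (g := fun _ => 0) (ae_of_all _ fun y => ?_)]
    · simp
    · simp only [slOp, (hev y y.2 (deriv φ)).deriv_eq, hv y y.2]
      simp
  have h1 : kernelSection (fun x y : T.interval j => T.kernel₁ j x y) ⟨1/2, hx⟩ ⟨1/2, hx⟩ = 0 := by
    rw [h0]; simp
  rw [kernelSection_apply] at h1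
  simp only [kernel₁, min_self, max_self] at h1
  exact (mul_pos (T.p_pos j _ hx) (T.q_pos j _ hx)).ne' h1

/-- Elements of the Hilbert space of `k_j` are indefinite integrals on `(0,1)`. -/
theorem exists_eq_const_add_integral (hR : T.RestrNormEquiv j) {g : T.Space₁ j}
    (hg : Continuous g) :
    ∃ (C : ℝ) (f : ℝ → ℝ), IntegrableOn f unitIoo ∧
      ∀ x : unitIoo, g (Set.inclusion (T.unitIoo_subset j) x) = C + ∫ t in (0:ℝ)..x, f t := by
  obtain ⟨c, _, hc, _, h1, _⟩ := hR
  set g' : unitIoo → ℝ := fun x => g (Set.inclusion (T.unitIoo_subset j) x) with hg'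
  have hg'c : Continuous g' := hg.comp (continuous_inclusion _)
  have h2 : T.restrNormSq j g' < ⊤ := by
    refine lt_of_le_of_lt (iInf₂_le g fun x => rfl) ?_
    simp
  have h3 : derivNormSq g' < ⊤ := by
    by_contra h
    rw [not_lt, top_le_iff] at h
    have := (h1 g').trans_lt h2
    rw [h, ENNReal.mul_top (by simpa using hc)] at this
    exact lt_irrefl _ this
  simp only [derivNormSq, iInf_lt_top] at h3
  obtain ⟨f, hf, hfi⟩ := h3
  have hmeas := measurableSet_Ioo (a := (0:ℝ)) (b := 1)
  set F := Function.extend Subtype.val f 0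
  set G := Function.extend Subtype.val g' 0
  have hF : ∀ x : unitIoo, f x = F x := fun x => (Subtype.val_injective.extend_apply _ _ _).symm
  have hG : ∀ x : unitIoo, g' x = G x := fun x => (Subtype.val_injective.extend_apply _ _ _).symm
  have hfL : MemLp f 2 := by
    refine ⟨hf.2.1.aestronglyMeasurable, ?_⟩
    rw [eLpNorm_lt_top_iff_lintegral_rpow_enorm_lt_top (by simp) (by simp)]
    simpa using hfi
  have hFi : IntegrableOn F unitIoo :=
    ((memLp_subtype_iff hmeas hF).1 hfL).integrable (by norm_num)
  obtain ⟨C, hC⟩ := ae_eq_const_add_integral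
    (LocallyIntegrable.locallyIntegrableOn_extend isOpen_Ioo hG hf.1) hFi
    fun φ hφ => by
      have := hf.2.2 φ hφ
      rw [integral_subtype_eq hmeas (F := fun x => G x * deriv φ x) (by simp [hG]),
        integral_subtype_eq hmeas (F := fun x => F x * φ x) (by simp [hF])] at this
      simpa using this
  refine ⟨C, F, hFi, fun x => ?_⟩
  -- The weak derivative gives equality only a.e.; both sides are continuous on the open interval,
  -- so it holds everywhere.
  have hcont : ContinuousOn (fun x => C + ∫ t in (0:ℝ)..x, F t) unitIoo := by
    refine continuousOn_const.add ((ContinuousOn.mono ?_ (Set.Ioo_subset_Icc_self)))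
    have := (((intervalIntegrable_iff_integrableOn_Ioo_of_le zero_le_one).2
      hFi).absolutelyContinuousOnInterval_intervalIntegral (c := 0) (by simp)).continuousOn
    rwa [Set.uIcc_of_le zero_le_one] at this
  have hGc : ContinuousOn G unitIoo := by
    rw [continuousOn_iff_continuous_domRestrict]
    exact (funext hG : g' = unitIoo.domRestrict G) ▸ hg'c
  have := Measure.eqOn_open_of_ae_eq (μ := volume) (U := unitIoo) (f := G)
    (g := fun x => C + ∫ t in (0:ℝ)..x, F t)
    ((ae_restrict_iff' hmeas).2 hC) isOpen_Ioo hGc hcont x.2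
  exact (hG x).trans this

end TensorMarkovKernel

/-- Positive `C²` solutions `p`, `q` of a Sturm–Liouville equation with nonvanishing Wronskian on
an open interval around `[0,1]`, square integrable at the left and the right end respectively. -/
structure SLPair (I : Set ℝ) (p q u v : ℝ → ℝ) (c : ℝ) : Prop where
  left : IsSLSolution I u v p
  right : IsSLSolution I u v q
  ordConnected : I.OrdConnected
  Icc_subset : Set.Icc 0 1 ⊆ I
  left_pos : ∀ x ∈ I, 0 < p x
  right_pos : ∀ x ∈ I, 0 < q x
  ne_zero : c ≠ 0
  wronskian : ∀ x ∈ I, u x * (deriv p x * q x - p x * deriv q x) = c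
  memLp_left : MemLp p 2 (volume.restrict (I ∩ Set.Iio 0))
  memLp_right : MemLp q 2 (volume.restrict (I ∩ Set.Ioi 1))

theorem SLPair.u_ne_zero {I : Set ℝ} {p q u v : ℝ → ℝ} {c : ℝ} (h : SLPair I p q u v c) :
    ∀ x ∈ I, u x ≠ 0 := fun x hx h0 => h.ne_zero (by rw [← h.wronskian x hx, h0, zero_mul])

namespace TensorMarkovKernel

variable {d : ℕ} (T : TensorMarkovKernel d) {j : Fin d} {u v : ℝ → ℝ}

/-- The Hilbert space of `k_j` contains no solution of `L[e] = 0` representing a boundary value. -/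
theorem false_of_tendsto (hS : T.SolvesODE j u v) (hE : T.InnerEqSL j u v)
    (hR : T.RestrNormEquiv j) {r : ℝ → ℝ} (hr : r = T.p j ∨ r = T.q j) (x : ℕ → unitIoo) (A : ℕ → ℝ)
    (hA : ∀ y ∈ T.interval j, ∀ᶠ n in Filter.atTop, T.kernel₁ j y (x n) = A n * r y)
    (hlim : ∀ f : ℝ → ℝ, IntegrableOn f unitIoo → ∃ l, Filter.Tendsto
      (fun n => ∫ t in (0:ℝ)..x n, f t) Filter.atTop (nhds l)) : False := by
  have hp := T.isSLSolution hS (Or.inl rfl)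
  have hq := T.isSLSolution hS (Or.inr rfl)
  have hrs := T.isSLSolution hS hr
  have hk := T.continuous_kernel₁ hp.contDiffOn.continuousOn hq.contDiffOn.continuousOn
  let x' : ℕ → T.interval j := fun n => Set.inclusion (T.unitIoo_subset j) (x n)
  have hl : ∀ g : T.Space₁ j, ∃ l, Filter.Tendsto (fun n => g (x' n)) Filter.atTop (nhds l) := by
    intro g
    obtain ⟨C, f, hf, hgf⟩ := T.exists_eq_const_add_integral hR (continuous_coe hk g)
    obtain ⟨l, hl⟩ := hlim f hf
    exact ⟨C + l, by simpa only [x', hgf] using hl.const_add C⟩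
  choose l hl using hl
  have ht : Filter.Tendsto (fun n (g : T.Space₁ j) => innerSL ℝ (kernelSection
      (fun x y : T.interval j => T.kernel₁ j x y) (x' n)) g) Filter.atTop (nhds l) := by
    rw [tendsto_pi_nhds]
    intro g
    simpa [inner_kernelSection] using hl g
  -- The boundary value is a pointwise limit of continuous functionals, so it is continuous by
  -- Banach–Steinhaus and has a Riesz representative e.
  let ℓ := continuousLinearMapOfTendsto _ ht
  let e := (InnerProductSpace.toDual ℝ (T.Space₁ j)).symm ℓ
  have he : ∀ g, inner ℝ e g = l g := fun g => InnerProductSpace.toDual_symm_apply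
  have hev : ∀ y : T.interval j, Filter.Tendsto (fun n => T.kernel₁ j (x' n) y)
      Filter.atTop (nhds (e y)) := by
    intro y
    have h1 := hl (kernelSection (fun x y : T.interval j => T.kernel₁ j x y) y)
    rw [← he, real_inner_comm, inner_kernelSection] at h1
    simpa only [kernelSection_apply] using h1
  have hsymm : ∀ a b, T.kernel₁ j a b = T.kernel₁ j b a := fun a b => by
    simp only [kernel₁, min_comm a, max_comm a]
  have hrpos : ∀ y ∈ T.interval j, 0 < r y := by
    rcases hr with rfl | rfl
    exacts [T.p_pos j, T.q_pos j]
  have hAr : ∀ y : T.interval j, Filter.Tendsto (fun n => A n * r y) Filter.atTop (nhds (e y)) := by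
    intro y
    refine (hev y).congr' ?_
    filter_upwards [hA y y.2] with n hn
    rw [hsymm]; exact hn
  let y₀ : T.interval j := ⟨1/2, T.unitIoo_subset j ⟨by norm_num, by norm_num⟩⟩
  have hAlim : Filter.Tendsto A Filter.atTop (nhds (e y₀ / r y₀)) := by
    refine ((hAr y₀).div_const (r y₀)).congr fun n => ?_
    field_simp [(hrpos y₀ y₀.2).ne']
  have her : ∀ y : T.interval j, e y = e y₀ / r y₀ * r y := fun y =>
    tendsto_nhds_unique (hAr y) (hAlim.mul_const _)
  -- As a limit of multiples of r, e is a multiple of r, hence a solution of L[e] = 0.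
  have he0 : e = 0 := by
    refine T.eq_zero_of_isWeakSL_zero hE (continuous_coe hk e) fun φ hφ => ?_
    rw [integral_subtype_eq (T.isOpen_interval j).measurableSet
      (F := fun x => e y₀ / r y₀ * (r x * slOp u v φ x)) (fun x => by rw [her x]; ring),
      integral_const_mul, hrs.integral_mul_slOp hφ, mul_zero]
  obtain ⟨_, C, _, _, _, h1⟩ := hR
  -- Some element of the space equals 1 on (0,1) and therefore has boundary value 1, which
  -- contradicts e = 0.
  have h2 : T.restrNormSq j (fun _ => 1) < ⊤ := by
    refine (h1 _ continuous_const).trans_lt (ENNReal.mul_lt_top (by simp) ?_)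
    have h3 : derivNormSq (fun _ => 1) ≤ 0 := by
      refine (iInf₂_le _ isWeakDeriv_one_zero).trans ?_
      simp
    refine ENNReal.add_lt_top.2 ⟨?_, h3.trans_lt (by simp)⟩
    simp [Measure.Subtype.volume_univ measurableSet_Ioo.nullMeasurableSet]
  simp only [restrNormSq, iInf_lt_top] at h2
  obtain ⟨h, hh, _⟩ := h2
  have h3 : l h = 1 := by
    refine tendsto_nhds_unique (hl h) ?_
    simp only [x', hh]
    exact tendsto_const_nhds
  rw [← he, he0, inner_zero_left] at h3
  exact zero_ne_one h3

/-- If the interval began at 0, then for points x → 0 and fixed y one would eventually have k(y, x)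
= p(x) q(y), the situation excluded by `false_of_tendsto` with r = q. -/
theorem a_lt_zero (hS : T.SolvesODE j u v) (hE : T.InnerEqSL j u v) (hR : T.RestrNormEquiv j) :
    T.a j < 0 := by
  by_contra h
  have ha : T.a j = 0 := le_antisymm (T.a_le j) (not_lt.1 h)
  -- The shift by 2 keeps the sequence inside the open unit interval already at n = 0.
  have hpos : ∀ n : ℕ, (0:ℝ) < 1 / ((n:ℝ) + 2) := fun n => by positivity
  have hlt : ∀ n : ℕ, 1 / ((n:ℝ) + 2) < 1 := fun n => by
    rw [div_lt_one (by positivity)]; linarith [(n.cast_nonneg : (0:ℝ) ≤ n)]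
  have hx : Filter.Tendsto (fun n : ℕ => 1 / ((n:ℝ) + 2)) Filter.atTop (nhds 0) := by
    have := (tendsto_one_div_add_atTop_nhds_zero_nat (𝕜 := ℝ)).comp (Filter.tendsto_add_atTop_nat 1)
    refine this.congr fun n => ?_
    simp only [Function.comp]; push_cast; ring_nf
  refine T.false_of_tendsto hS hE hR (Or.inr rfl) (fun n => ⟨1 / ((n:ℝ) + 2), hpos n, hlt n⟩)
    (fun n => T.p j (1 / ((n:ℝ) + 2))) (fun y hy => ?_) (fun f hf => ?_)
  · have hy0 : 0 < y := by
      have := hy.1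
      rw [ha] at this
      exact_mod_cast this
    filter_upwards [hx.eventually (gt_mem_nhds hy0)] with n hn
    rw [kernel₁, min_eq_right hn.le, max_eq_left hn.le]
  · have hc := (((intervalIntegrable_iff_integrableOn_Ioo_of_le zero_le_one).2
      hf).absolutelyContinuousOnInterval_intervalIntegral (c := 0) (by simp)).continuousOn
    rw [Set.uIcc_of_le zero_le_one] at hc
    refine ⟨_, (hc 0 (by simp)).tendsto.comp (tendsto_nhdsWithin_iff.2 ⟨hx, ?_⟩)⟩
    exact Filter.Eventually.of_forall fun n => ⟨(hpos n).le, (hlt n).le⟩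

/-- The mirror image: near 1 the kernel factors as q(x) p(y), and r = p. -/
theorem one_lt_b (hS : T.SolvesODE j u v) (hE : T.InnerEqSL j u v) (hR : T.RestrNormEquiv j) :
    1 < T.b j := by
  by_contra h
  have hb : T.b j = 1 := le_antisymm (not_lt.1 h) (T.le_b j)
  have hpos : ∀ n : ℕ, (0:ℝ) < 1 / ((n:ℝ) + 2) := fun n => by positivity
  have hlt : ∀ n : ℕ, 1 / ((n:ℝ) + 2) < 1 := fun n => by
    rw [div_lt_one (by positivity)]; linarith [(n.cast_nonneg : (0:ℝ) ≤ n)]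
  have hx : Filter.Tendsto (fun n : ℕ => 1 - 1 / ((n:ℝ) + 2)) Filter.atTop (nhds 1) := by
    have := (tendsto_one_div_add_atTop_nhds_zero_nat (𝕜 := ℝ)).comp (Filter.tendsto_add_atTop_nat 1)
    have := this.const_sub 1
    rw [sub_zero] at this
    refine this.congr fun n => ?_
    simp only [Function.comp]; push_cast; ring_nf
  refine T.false_of_tendsto hS hE hR (Or.inl rfl)
    (fun n => ⟨1 - 1 / ((n:ℝ) + 2), by linarith [hlt n], by linarith [hpos n]⟩)
    (fun n => T.q j (1 - 1 / ((n:ℝ) + 2))) (fun y hy => ?_) (fun f hf => ?_)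
  · have hy0 : y < 1 := by
      have := hy.2
      rw [hb] at this
      exact_mod_cast this
    filter_upwards [hx.eventually (lt_mem_nhds hy0)] with n hn
    rw [kernel₁, min_eq_left hn.le, max_eq_right hn.le, mul_comm]
  · have hc := (((intervalIntegrable_iff_integrableOn_Ioo_of_le zero_le_one).2
      hf).absolutelyContinuousOnInterval_intervalIntegral (c := 0) (by simp)).continuousOn
    rw [Set.uIcc_of_le zero_le_one] at hc
    refine ⟨_, (hc 1 (by simp)).tendsto.comp (tendsto_nhdsWithin_iff.2 ⟨hx, ?_⟩)⟩
    exact Filter.Eventually.of_forall fun n => ⟨by linarith [hlt n], by linarith [hpos n]⟩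

/-- Convergence of ∫ k(x, s) w(s) ds for every w in L² forces the section into L², by the converse
of Cauchy–Schwarz. -/
theorem memLp_kernel₁ (hp : ContinuousOn (T.p j) (T.interval j))
    (hq : ContinuousOn (T.q j) (T.interval j)) (hT : T.TransformRegular j) {x : ℝ}
    (hx : x ∈ unitIoo) : MemLp (T.kernel₁ j x) 2 (volume.restrict (T.interval j)) := by
  have hI := (T.isOpen_interval j).measurableSet
  have hc : ContinuousOn (T.kernel₁ j x) (T.interval j) := by
    rw [continuousOn_iff_continuous_domRestrict]
    exact (T.continuous_kernel₁ hp hq).comp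
      (continuous_const.prodMk continuous_id : Continuous fun s : T.interval j =>
        ((⟨x, T.unitIoo_subset j hx⟩ : T.interval j), s))
  have hm : AEStronglyMeasurable (T.kernel₁ j x) (volume.restrict (T.interval j)) :=
    hc.aestronglyMeasurable hI
  refine (memLp_congr_ae hm.ae_eq_mk).2 (memLp_two_of_forall_integrable_mul
    hm.stronglyMeasurable_mk.measurable fun w hw => ?_)
  have h1 := (hT (fun s => w s) ((memLp_subtype_iff hI fun _ => rfl).2 hw)).1 x hx
  rw [integrable_subtype_iff hI (F := fun s => T.kernel₁ j x s * w s) fun _ => rfl] at h1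
  refine h1.congr ?_
  filter_upwards [hm.ae_eq_mk] with s hs
  rw [← hs]

theorem SturmLiouville.exists_slPair (hT : T.SturmLiouville) (j : Fin d) :
    ∃ u v c, SLPair (T.interval j) (T.p j) (T.q j) u v c := by
  obtain ⟨⟨u, v, hS, hE⟩, hR, hTr⟩ := hT j
  obtain ⟨c, hc, hw⟩ := T.u_ne_zero_and_wronskian hS hE
  have hp := T.isSLSolution hS (Or.inl rfl)
  have hq := T.isSLSolution hS (Or.inr rfl)
  have ha := T.a_lt_zero hS hE hR
  have hb := T.one_lt_b hS hE hR
  have hx : (1/2 : ℝ) ∈ unitIoo := ⟨by norm_num, by norm_num⟩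
  have hI := (T.isOpen_interval j).measurableSet
  have hL := T.memLp_kernel₁ hp.contDiffOn.continuousOn hq.contDiffOn.continuousOn hTr hx
  refine ⟨u, v, c, hp, hq, T.ordConnected_interval j, fun x hx => ⟨?_, ?_⟩, T.p_pos j, T.q_pos j,
    hc, hw, ?_, ?_⟩
  · exact ha.trans_le (by exact_mod_cast hx.1)
  · exact lt_of_le_of_lt (by exact_mod_cast hx.2) hb
  -- To the left of 0 the section at 1/2 is q(1/2) p(s), so its square integrability is that of p;
  -- to the right of 1 it is p(1/2) q(s).
  · have h1 := (hL.mono_measure (Measure.restrict_mono (Set.inter_subset_left (t := Set.Iio 0))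
      le_rfl)).const_mul (T.q j (1/2))⁻¹
    refine (memLp_congr_ae ?_).1 h1
    filter_upwards [ae_restrict_mem (hI.inter measurableSet_Iio)] with s hs
    have hs' : s ≤ 1/2 := hs.2.le.trans (by norm_num)
    have := (T.q_pos j _ (T.unitIoo_subset j hx)).ne'
    rw [kernel₁, min_eq_right hs', max_eq_left hs']
    field_simp
  · have h1 := (hL.mono_measure (Measure.restrict_mono (Set.inter_subset_left (t := Set.Ioi 1))
      le_rfl)).const_mul (T.p j (1/2))⁻¹
    refine (memLp_congr_ae ?_).1 h1
    filter_upwards [ae_restrict_mem (hI.inter measurableSet_Ioi)] with s hs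
    have hs' : 1/2 ≤ s := le_trans (by norm_num) hs.2.le
    have := (T.p_pos j _ (T.unitIoo_subset j hx)).ne'
    rw [kernel₁, min_eq_left hs', max_eq_right hs']
    field_simp

end TensorMarkovKernel

/-! ### Bounded measurable functions -/

/-- Bounded measurable functions. -/
def IsBddMeas {X : Type*} [MeasurableSpace X] (f : X → ℝ) : Prop :=
  Measurable f ∧ ∃ C, ∀ x, ‖f x‖ ≤ C

namespace IsBddMeas

variable {X Y : Type*} [MeasurableSpace X] [MeasurableSpace Y] {f g : X → ℝ}

theorem const (c : ℝ) : IsBddMeas fun _ : X => c := ⟨measurable_const, ‖c‖, fun _ => le_rfl⟩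

theorem comp {f : Y → ℝ} (hf : IsBddMeas f) {e : X → Y} (he : Measurable e) :
    IsBddMeas fun x => f (e x) :=
  ⟨hf.1.comp he, hf.2.imp fun _ h x => h (e x)⟩

theorem mul (hf : IsBddMeas f) (hg : IsBddMeas g) : IsBddMeas fun x => f x * g x := by
  obtain ⟨hf, C, hC⟩ := hf
  obtain ⟨hg, D, hD⟩ := hg
  refine ⟨hf.mul hg, C * D, fun x => ?_⟩
  rw [norm_mul]
  exact mul_le_mul (hC x) (hD x) (norm_nonneg _) ((norm_nonneg _).trans (hC x))

theorem add (hf : IsBddMeas f) (hg : IsBddMeas g) : IsBddMeas fun x => f x + g x := by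
  obtain ⟨hf, C, hC⟩ := hf
  obtain ⟨hg, D, hD⟩ := hg
  exact ⟨hf.add hg, C + D, fun x => (norm_add_le _ _).trans (add_le_add (hC x) (hD x))⟩

theorem ite (hf : IsBddMeas f) (hg : IsBddMeas g) {p : X → Prop} [DecidablePred p]
    (hp : MeasurableSet {x | p x}) : IsBddMeas fun x => if p x then f x else g x := by
  obtain ⟨hf, C, hC⟩ := hf
  obtain ⟨hg, D, hD⟩ := hg
  refine ⟨Measurable.ite hp hf hg, max C D, fun x => ?_⟩
  dsimp only
  split_ifs
  exacts [(hC x).trans (le_max_left _ _), (hD x).trans (le_max_right _ _)]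

theorem finset_prod {ι : Type*} [Fintype ι] {F : ι → X → ℝ} (hF : ∀ i, IsBddMeas (F i)) :
    IsBddMeas fun x => ∏ i, F i x := by
  choose hm C hC using hF
  refine ⟨Finset.measurable_prod _ fun i _ => hm i, ∏ i, C i, fun x => ?_⟩
  rw [norm_prod]
  exact Finset.prod_le_prod (fun _ _ => norm_nonneg _) fun i _ => hC i x

theorem indicator (hf : IsBddMeas f) {A : Set X} (hA : MeasurableSet A) :
    IsBddMeas (A.indicator f) := by
  refine ⟨hf.1.indicator hA, hf.2.imp fun C hC x => ?_⟩
  exact (norm_indicator_le_norm_self _ _).trans (hC x)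

theorem memLp (hf : IsBddMeas f) {μ : Measure X} [IsFiniteMeasure μ] {p : ℝ≥0∞} : MemLp f p μ := by
  obtain ⟨hf, C, hC⟩ := hf
  exact MemLp.of_bound hf.aestronglyMeasurable C (ae_of_all _ hC)

theorem integrable (hf : IsBddMeas f) {μ : Measure X} [IsFiniteMeasure μ] : Integrable f μ :=
  memLp_one_iff_integrable.1 hf.memLp

theorem integrable_mul (hf : IsBddMeas f) {μ : Measure X} (hg : Integrable g μ) :
    Integrable (fun x => f x * g x) μ := by
  obtain ⟨hf, C, hC⟩ := hf
  exact hg.bdd_mul hf.aestronglyMeasurable (ae_of_all _ hC)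

theorem of_isTestFunction {E : Type*} [NormedAddCommGroup E] [NormedSpace ℝ E] [MeasurableSpace E]
    [BorelSpace E] {S : Set E} {φ : E → ℝ} (hφ : IsTestFunction S φ) : IsBddMeas φ :=
  ⟨hφ.continuous.measurable, hφ.exists_bound⟩

theorem indicator_of_continuousOn {f : ℝ → ℝ} (hf : ContinuousOn f (Set.Icc 0 1)) {A : Set ℝ}
    (hA : MeasurableSet A) (hA' : A ⊆ Set.Icc 0 1) : IsBddMeas (A.indicator f) := by
  obtain ⟨C, hC⟩ := isCompact_Icc.exists_bound_of_continuousOn hf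
  refine ⟨?_, max C 0, fun x => ?_⟩
  · classical
    rw [← Set.piecewise_eq_indicator]
    exact (hf.mono hA').measurable_piecewise continuousOn_const hA
  · by_cases hx : x ∈ A
    · rw [Set.indicator_of_mem hx]; exact (hC x (hA' hx)).trans (le_max_left _ _)
    · rw [Set.indicator_of_notMem hx]; simp

end IsBddMeas

/-! ### Splitting an operator into an integral operator and a multiplication operator -/

/-- Lebesgue measure on `(0,2)`. -/
noncomputable abbrev doubleVolume : Measure ℝ := volume.restrict (Set.Ioo 0 2)

open Classical in
/-- The point at which the operator with multiplier `splitMul K m` evaluates its argument. -/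
noncomputable def splitPoint (s t : ℝ) : ℝ :=
  if t < 1 then t else if s ∈ unitIoo then s else t - 1

/-- With `t` in `(0,1)` the kernel `K`, with `t` in `[1,2)` the factor `m`. -/
noncomputable def splitMul (K : ℝ → ℝ → ℝ) (m : ℝ → ℝ) (s t : ℝ) : ℝ :=
  if t < 1 then K s t else unitIoo.indicator m s

theorem splitPoint_of_lt {s t : ℝ} (ht : t < 1) : splitPoint s t = t := by
  simp only [splitPoint, ht, if_true]

theorem splitPoint_of_mem {s t : ℝ} (ht : 1 ≤ t) (hs : s ∈ unitIoo) : splitPoint s t = s := by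
  simp only [splitPoint, not_lt.2 ht, hs, if_true, if_false]

theorem splitPoint_of_notMem {s t : ℝ} (ht : 1 ≤ t) (hs : s ∉ unitIoo) : splitPoint s t = t - 1 := by
  simp only [splitPoint, not_lt.2 ht, hs, if_false]

theorem measurable_splitPoint : Measurable fun z : ℝ × ℝ => splitPoint z.1 z.2 := by
  classical
  exact Measurable.ite (measurableSet_lt measurable_snd measurable_const) measurable_snd
    (Measurable.ite (measurable_fst measurableSet_Ioo) measurable_fst
      (measurable_snd.sub_const 1))

theorem isBddMeas_splitMul {K : ℝ → ℝ → ℝ} {m : ℝ → ℝ} (hK : IsBddMeas fun z : ℝ × ℝ => K z.1 z.2)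
    (hm : ContinuousOn m (Set.Icc 0 1)) : IsBddMeas fun z : ℝ × ℝ => splitMul K m z.1 z.2 :=
  hK.ite ((IsBddMeas.indicator_of_continuousOn hm measurableSet_Ioo Set.Ioo_subset_Icc_self).comp
    measurable_fst) (measurableSet_lt measurable_snd measurable_const)

theorem setLIntegral_Ioo_zero_two (f : ℝ → ℝ≥0∞) :
    ∫⁻ t in Set.Ioo 0 2, f t = (∫⁻ t in unitIoo, f t) + ∫⁻ t in Set.Ico 1 2, f t := by
  rw [← lintegral_union measurableSet_Ico, Set.Ioo_union_Ico_eq_Ioo (by norm_num) (by norm_num)]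
  rw [Set.disjoint_left]
  exact fun x hx hx' => not_le.2 hx.2 hx'.1

/-- Integrating out the auxiliary variable t recovers the two parts of the operator: t in (0,1)
yields the integral against K, and t in [1,2) contributes the local term with total weight 1. -/
theorem integral_splitMul_mul {K : ℝ → ℝ → ℝ} {m φ : ℝ → ℝ} {s : ℝ}
    (hK : Integrable (fun t => K s t * φ t) unitVolume) :
    ∫ t, splitMul K m s t * φ (splitPoint s t) ∂doubleVolume
      = (∫ t, K s t * φ t ∂unitVolume) + unitIoo.indicator m s * φ s := by
  have h1 : Set.EqOn (fun t => splitMul K m s t * φ (splitPoint s t)) (fun t => K s t * φ t)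
      unitIoo := fun t ht => by
    have := ht.2
    simp only [splitMul, this, if_true, splitPoint_of_lt]
  have h2 : Set.EqOn (fun t => splitMul K m s t * φ (splitPoint s t))
      (fun _ => unitIoo.indicator m s * φ s) (Set.Ico 1 2) := fun t ht => by
    by_cases hs : s ∈ unitIoo
    · simp only [splitMul, not_lt.2 ht.1, if_false, splitPoint_of_mem ht.1 hs]
    · simp only [splitMul, not_lt.2 ht.1, if_false, Set.indicator_of_notMem hs, zero_mul]
  rw [doubleVolume, ← Set.Ioo_union_Ico_eq_Ioo (show (0:ℝ) < 1 by norm_num) (show (1:ℝ) ≤ 2 by norm_num),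
    setIntegral_union]
  · rw [setIntegral_congr_fun measurableSet_Ioo h1, setIntegral_congr_fun measurableSet_Ico h2]
    norm_num
  · rw [Set.disjoint_left]
    exact fun x hx hx' => not_le.2 hx.2 hx'.1
  · exact measurableSet_Ico
  · exact (integrableOn_congr_fun h1 measurableSet_Ioo).2 hK
  · exact (integrableOn_congr_fun h2 measurableSet_Ico).2 (integrable_const _)

/-- For each s the piece t < 1 pushes forward to Lebesgue measure on (0,1), in total μ(univ) times
it. The piece t ≥ 1 gives μ on (0,1), which is Lebesgue measure, plus μ(complement) times Lebesgue
measure from the shift t - 1. Since μ(0,1) = 1, the second total is again μ(univ). The otherwise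
irrelevant values t - 1 are there to make this push-forward an exact multiple. -/
theorem measurePreserving_splitPoint {μ : Measure ℝ} [IsFiniteMeasure μ]
    (hμ : μ.restrict unitIoo = unitVolume) :
    MeasurePreserving (fun z : ℝ × ℝ => splitPoint z.1 z.2) (μ.prod doubleVolume)
      ((2 * μ Set.univ) • unitVolume) := by
  refine ⟨measurable_splitPoint, Measure.ext fun A hA => ?_⟩
  rw [Measure.map_apply measurable_splitPoint hA, Measure.prod_apply (measurable_splitPoint hA)]
  have h1 : ∀ s, doubleVolume (Prod.mk s ⁻¹' ((fun z : ℝ × ℝ => splitPoint z.1 z.2) ⁻¹' A))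
      = unitVolume A + (unitIoo.indicator (A.indicator 1) s
        + unitIooᶜ.indicator (fun _ => unitVolume A) s) := by
    intro s
    have hm : MeasurableSet (Prod.mk s ⁻¹' ((fun z : ℝ × ℝ => splitPoint z.1 z.2) ⁻¹' A)) :=
      measurable_prodMk_left (measurable_splitPoint hA)
    rw [← lintegral_indicator_one hm, doubleVolume, setLIntegral_Ioo_zero_two]
    congr 1
    · rw [← lintegral_indicator_one hA]
      refine setLIntegral_congr_fun measurableSet_Ioo fun t ht => ?_
      change A.indicator 1 (splitPoint s t) = _
      rw [splitPoint_of_lt ht.2]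
    · by_cases hs : s ∈ unitIoo
      · rw [Set.indicator_of_mem hs, Set.indicator_of_notMem (Set.notMem_compl_iff.2 hs), add_zero]
        rw [setLIntegral_congr_fun measurableSet_Ico (g := fun _ => A.indicator 1 s) fun t ht => by
          change A.indicator 1 (splitPoint s t) = _
          rw [splitPoint_of_mem ht.1 hs]]
        norm_num
      · rw [Set.indicator_of_notMem hs, Set.indicator_of_mem (by simpa using hs), zero_add]
        rw [setLIntegral_congr_fun measurableSet_Ico
          (g := fun t => A.indicator 1 (t - 1)) fun t ht => by
          change A.indicator 1 (splitPoint s t) = _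
          rw [splitPoint_of_notMem ht.1 hs]]
        rw [← lintegral_indicator_one hA, ← lintegral_indicator measurableSet_Ico,
          ← lintegral_indicator measurableSet_Ioo,
          ← lintegral_sub_right_eq_self (unitIoo.indicator (A.indicator 1)) (1:ℝ)]
        refine lintegral_congr_ae ?_
        have h0 : ∀ᵐ t : ℝ, t ≠ 1 := by simp [ae_iff]
        filter_upwards [h0] with t ht
        have : t ∈ Set.Ico (1:ℝ) 2 ↔ t - 1 ∈ unitIoo := by
          refine ⟨fun h => ⟨sub_pos.2 (lt_of_le_of_ne h.1 (Ne.symm ht)), by linarith [h.2]⟩,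
            fun h => ⟨by linarith [h.1], by linarith [h.2]⟩⟩
        simp only [Set.indicator_apply, this]
  simp_rw [h1]
  have h2 : μ unitIoo = 1 := by
    rw [← Measure.restrict_apply_univ, hμ]; simp
  have h3 : μ (A ∩ unitIoo) = unitVolume A := by
    rw [← hμ, Measure.restrict_apply hA]
  have h4 : μ Set.univ = 1 + μ unitIooᶜ := by
    rw [← h2, measure_add_measure_compl measurableSet_Ioo]
  rw [lintegral_add_left measurable_const, lintegral_add_left
    ((measurable_one.indicator hA).indicator measurableSet_Ioo), lintegral_const,
    Set.indicator_indicator, lintegral_indicator_one (measurableSet_Ioo.inter hA),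
    lintegral_indicator_const measurableSet_Ioo.compl, Set.inter_comm, h3, Measure.smul_apply,
    smul_eq_mul, h4]
  ring

/-! ### The normalized kernel of a Sturm–Liouville pair and its derivatives -/

/-- The kernel with `P` or `Q` in the first variable, normalized to be `Q` or `P` when the second
variable is to the left or to the right of `[0,1]`. -/
noncomputable def sideKernel (P Q P₀ Q₀ : ℝ → ℝ) (t s : ℝ) : ℝ :=
  if s < 0 then Q t else if 1 < s then P t else if t < s then P t * Q₀ s else Q t * P₀ s

theorem isBddMeas_sideKernel {P Q P₀ Q₀ : ℝ → ℝ} (hP : IsBddMeas P) (hQ : IsBddMeas Q)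
    (hP₀ : IsBddMeas P₀) (hQ₀ : IsBddMeas Q₀) :
    IsBddMeas fun z : ℝ × ℝ => sideKernel P Q P₀ Q₀ z.1 z.2 :=
  (hQ.comp measurable_fst).ite ((hP.comp measurable_fst).ite
    (((hP.comp measurable_fst).mul (hQ₀.comp measurable_snd)).ite
      ((hQ.comp measurable_fst).mul (hP₀.comp measurable_snd))
        (measurableSet_lt measurable_fst measurable_snd))
    (measurableSet_lt measurable_const measurable_snd))
    (measurableSet_lt measurable_snd measurable_const)

theorem IsBddMeas.swap {X Y : Type*} [MeasurableSpace X] [MeasurableSpace Y] {K : X → Y → ℝ}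
    (hK : IsBddMeas fun z : X × Y => K z.1 z.2) : IsBddMeas fun z : Y × X => K z.2 z.1 :=
  hK.comp measurable_swap

theorem IsBddMeas.section_right {X Y : Type*} [MeasurableSpace X] [MeasurableSpace Y]
    {K : X → Y → ℝ} (hK : IsBddMeas fun z : X × Y => K z.1 z.2) (x : X) : IsBddMeas (K x) :=
  hK.comp measurable_prodMk_left

/-- The `n`-th derivative of `r`, cut off to the unit interval. -/
noncomputable def cutDeriv (r : ℝ → ℝ) (n : ℕ) : ℝ → ℝ := (Set.Icc 0 1).indicator (deriv^[n] r)

theorem cutDeriv_of_mem (r : ℝ → ℝ) (n : ℕ) {x : ℝ} (hx : x ∈ Set.Icc (0:ℝ) 1) :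
    cutDeriv r n x = deriv^[n] r x := Set.indicator_of_mem hx _

/-- The `n`-th derivative of the normalized kernel in its first variable, off the diagonal. -/
noncomputable def sideKernelDeriv (p q : ℝ → ℝ) (n : ℕ) : ℝ → ℝ → ℝ :=
  sideKernel (cutDeriv p n) (cutDeriv q n) (cutDeriv p 0) (cutDeriv q 0)

/-- The jump across the diagonal of the derivative of order `n - 1` of the kernel. -/
noncomputable def sideKernelJump (p q : ℝ → ℝ) (n : ℕ) (s : ℝ) : ℝ :=
  if n = 2 then -(deriv p s * q s - p s * deriv q s) else 0

/-! ### Distributional derivatives of the normalized kernel -/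

theorem integral_mul_deriv_test {r r' ψ : ℝ → ℝ} {a b : ℝ} (ha : a ∈ Set.Icc (0:ℝ) 1)
    (hb : b ∈ Set.Icc (0:ℝ) 1) (hr : ∀ x ∈ Set.Icc (0:ℝ) 1, HasDerivAt r (r' x) x)
    (hr' : ContinuousOn r' (Set.Icc 0 1)) (hψ : IsTestFunction unitIoo ψ) :
    ∫ x in a..b, r x * deriv ψ x = r b * ψ b - r a * ψ a - ∫ x in a..b, r' x * ψ x := by
  have hsub : Set.uIcc a b ⊆ Set.Icc (0:ℝ) 1 := Set.ordConnected_Icc.uIcc_subset ha hb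
  exact intervalIntegral.integral_mul_deriv_eq_deriv_mul (fun x hx => hr x (hsub hx))
    (fun x _ => (hψ.1.differentiable (by norm_num)).differentiableAt.hasDerivAt)
    ((hr'.mono hsub).intervalIntegrable) (hψ.deriv.continuous.intervalIntegrable _ _)

namespace IsSLSolution

variable {I : Set ℝ} {u v r : ℝ → ℝ}

theorem continuousOn_iterate (h : IsSLSolution I u v r) (hu : ∀ x ∈ I, u x ≠ 0)
    {n : ℕ} (hn : n ≤ 2) : ContinuousOn (deriv^[n] r) I := by
  interval_cases n
  exacts [h.contDiffOn.continuousOn, h.continuousOn_deriv, h.continuousOn_deriv_deriv hu]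

theorem isBddMeas_cutDeriv (h : IsSLSolution I u v r) (hu : ∀ x ∈ I, u x ≠ 0)
    (hI : Set.Icc 0 1 ⊆ I) {n : ℕ} (hn : n ≤ 2) : IsBddMeas (cutDeriv r n) :=
  IsBddMeas.indicator_of_continuousOn ((h.continuousOn_iterate hu hn).mono hI) measurableSet_Icc
    subset_rfl

end IsSLSolution

namespace SLPair

variable {I : Set ℝ} {p q u v : ℝ → ℝ} {c : ℝ}

theorem isBddMeas_sideKernelDeriv (h : SLPair I p q u v c) {n : ℕ} (hn : n ≤ 2) :
    IsBddMeas fun z : ℝ × ℝ => sideKernelDeriv p q n z.1 z.2 :=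
  isBddMeas_sideKernel (h.left.isBddMeas_cutDeriv h.u_ne_zero h.Icc_subset hn)
    (h.right.isBddMeas_cutDeriv h.u_ne_zero h.Icc_subset hn)
    (h.left.isBddMeas_cutDeriv h.u_ne_zero h.Icc_subset (by norm_num))
    (h.right.isBddMeas_cutDeriv h.u_ne_zero h.Icc_subset (by norm_num))

theorem continuousOn_sideKernelJump (h : SLPair I p q u v c) (n : ℕ) :
    ContinuousOn (sideKernelJump p q n) I := by
  unfold sideKernelJump
  by_cases hn : n = 2
  · simp only [hn, if_true]
    exact ((h.left.continuousOn_deriv.mul h.right.contDiffOn.continuousOn).sub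
      (h.left.contDiffOn.continuousOn.mul h.right.continuousOn_deriv)).neg
  · simp only [hn, if_false]
    exact continuousOn_const

theorem integral_iterate_test (h : SLPair I p q u v c) {r : ℝ → ℝ} (hr : IsSLSolution I u v r)
    {ψ : ℝ → ℝ} (hψ : IsTestFunction unitIoo ψ) {a b : ℝ} (ha : a ∈ Set.Icc (0:ℝ) 1)
    (hb : b ∈ Set.Icc (0:ℝ) 1) :
    (∫ x in a..b, r x * deriv ψ x = r b * ψ b - r a * ψ a - ∫ x in a..b, deriv r x * ψ x) ∧
    ∫ x in a..b, r x * deriv (deriv ψ) x = r b * deriv ψ b - r a * deriv ψ a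
      - (deriv r b * ψ b - deriv r a * ψ a - ∫ x in a..b, deriv (deriv r) x * ψ x) := by
  have h1 : ∀ x ∈ Set.Icc (0:ℝ) 1, HasDerivAt r (deriv r x) x := fun x hx =>
    hr.hasDerivAt (h.Icc_subset hx)
  have h2 : ∀ x ∈ Set.Icc (0:ℝ) 1, HasDerivAt (deriv r) (deriv (deriv r) x) x := fun x hx =>
    (hr.hasDerivAt_deriv h.u_ne_zero (h.Icc_subset hx)).differentiableAt.hasDerivAt
  refine ⟨integral_mul_deriv_test ha hb h1 (hr.continuousOn_deriv.mono h.Icc_subset) hψ, ?_⟩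
  rw [integral_mul_deriv_test ha hb h1 (hr.continuousOn_deriv.mono h.Icc_subset) hψ.deriv,
    integral_mul_deriv_test ha hb h2
      ((hr.continuousOn_deriv_deriv h.u_ne_zero).mono h.Icc_subset) hψ]

/-- F need only agree with a continuous function on each side of s, which suits a kernel with a kink
on the diagonal. -/
theorem integral_unitIoo_split {f g F : ℝ → ℝ} {s : ℝ} (hs : s ∈ Set.Icc (0:ℝ) 1)
    (hf : ContinuousOn f (Set.Icc 0 1)) (hg : ContinuousOn g (Set.Icc 0 1))
    (hFf : ∀ x ∈ unitIoo, x < s → F x = f x) (hFg : ∀ x ∈ unitIoo, s ≤ x → F x = g x) :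
    ∫ x in unitIoo, F x = (∫ x in (0:ℝ)..s, f x) + ∫ x in s..1, g x := by
  have h0 : ∀ᵐ x : ℝ, x ≠ 1 := by simp [ae_iff]
  have h0' : ∀ᵐ x : ℝ, x ≠ s := by simp [ae_iff]
  have e1 : ∀ᵐ x : ℝ, x ∈ Set.uIoc 0 s → f x = F x := by
    filter_upwards [h0'] with x hx hx'
    rw [Set.uIoc_of_le hs.1] at hx'
    have := lt_of_le_of_ne hx'.2 hx
    exact (hFf x ⟨hx'.1, this.trans_le hs.2⟩ this).symm
  have e2 : ∀ᵐ x : ℝ, x ∈ Set.uIoc s 1 → g x = F x := by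
    filter_upwards [h0] with x hx hx'
    rw [Set.uIoc_of_le hs.2] at hx'
    exact (hFg x ⟨hs.1.trans_lt hx'.1, lt_of_le_of_ne hx'.2 hx⟩ hx'.1.le).symm
  have i1 : IntervalIntegrable F volume 0 s := by
    refine IntervalIntegrable.congr_ae ?_ ((ae_restrict_iff' measurableSet_uIoc).2 e1)
    refine (hf.mono ?_).intervalIntegrable
    rw [Set.uIcc_of_le hs.1]; exact Set.Icc_subset_Icc_right hs.2
  have i2 : IntervalIntegrable F volume s 1 := by
    refine IntervalIntegrable.congr_ae ?_ ((ae_restrict_iff' measurableSet_uIoc).2 e2)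
    refine (hg.mono ?_).intervalIntegrable
    rw [Set.uIcc_of_le hs.2]; exact Set.Icc_subset_Icc_left hs.1
  rw [integral_unitIoo_eq, ← intervalIntegral.integral_add_adjacent_intervals i1 i2,
    intervalIntegral.integral_congr_ae e1, intervalIntegral.integral_congr_ae e2]

/-- The weak derivatives of the normalized kernel in its first variable. -/
theorem integral_sideKernel_mul_iteratedDeriv (h : SLPair I p q u v c) {n : ℕ} (hn : n ≤ 2)
    {ψ : ℝ → ℝ} (hψ : IsTestFunction unitIoo ψ) (s : ℝ) :
    ∫ x in unitIoo, sideKernelDeriv p q 0 x s * iteratedDeriv n ψ x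
      = (-1) ^ n * ((∫ x in unitIoo, sideKernelDeriv p q n x s * ψ x)
        + unitIoo.indicator (sideKernelJump p q n) s * ψ s) := by
  have hz0 : ∀ {φ : ℝ → ℝ}, IsTestFunction unitIoo φ → φ 0 = 0 ∧ φ 1 = 0 := fun hφ =>
    ⟨hφ.eq_zero (by simp), hφ.eq_zero (by simp)⟩
  obtain ⟨z1, z2⟩ := hz0 hψ
  obtain ⟨z3, z4⟩ := hz0 hψ.deriv
  have hIcc : ∀ {x : ℝ}, x ∈ unitIoo → x ∈ Set.Icc (0:ℝ) 1 := fun hx => Set.Ioo_subset_Icc_self hx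
  -- For s outside [0,1] the kernel is p or q alone, without a kink, and the boundary terms vanish
  -- with the test function.
  have hside : ∀ (r : ℝ → ℝ), IsSLSolution I u v r →
      ∫ x in unitIoo, cutDeriv r 0 x * iteratedDeriv n ψ x
        = (-1) ^ n * ∫ x in unitIoo, cutDeriv r n x * ψ x := by
    intro r hr
    obtain ⟨k1, k2⟩ := h.integral_iterate_test hr hψ (Set.left_mem_Icc.2 zero_le_one)
      (Set.right_mem_Icc.2 zero_le_one)
    have e : ∀ m (f : ℝ → ℝ), ∫ x in unitIoo, cutDeriv r m x * f x
        = ∫ x in (0:ℝ)..1, deriv^[m] r x * f x := fun m f => by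
      rw [← integral_unitIoo_eq]
      exact setIntegral_congr_fun measurableSet_Ioo fun x hx => by
        simp only [cutDeriv_of_mem _ _ (hIcc hx)]
    rw [e, e]
    interval_cases n
    · simp
    · simp only [iteratedDeriv_one, Function.iterate_zero, id, Function.iterate_one]
      rw [k1, z1, z2]; ring
    · simp only [iteratedDeriv_succ, iteratedDeriv_zero, Function.iterate_zero, id,
        Function.iterate_succ, Function.comp]
      rw [k2, z1, z2, z3, z4]; ring
  rcases lt_or_ge s 0 with hs0 | hs0
  · have hs : s ∉ unitIoo := fun h => not_lt.2 h.1.le hs0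
    rw [Set.indicator_of_notMem hs, zero_mul, add_zero]
    simp only [sideKernelDeriv, sideKernel, hs0, if_true]
    exact hside q h.right
  rcases lt_or_ge 1 s with hs1 | hs1
  · have hs : s ∉ unitIoo := fun h => not_lt.2 h.2.le hs1
    rw [Set.indicator_of_notMem hs, zero_mul, add_zero]
    simp only [sideKernelDeriv, sideKernel, not_lt.2 hs0, hs1, if_true, if_false]
    exact hside p h.left
  have hs : s ∈ Set.Icc (0:ℝ) 1 := ⟨hs0, hs1⟩
  have e : ∀ m ≤ 2, ∀ f : ℝ → ℝ, Continuous f →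
      ∫ x in unitIoo, sideKernelDeriv p q m x s * f x
        = q s * (∫ x in (0:ℝ)..s, deriv^[m] p x * f x)
          + p s * ∫ x in s..1, deriv^[m] q x * f x := fun m hm f hf => by
    have c1 := (h.left.continuousOn_iterate h.u_ne_zero hm).mono h.Icc_subset
    have c2 := (h.right.continuousOn_iterate h.u_ne_zero hm).mono h.Icc_subset
    rw [integral_unitIoo_split hs (f := fun x => q s * (deriv^[m] p x * f x))
      (g := fun x => p s * (deriv^[m] q x * f x))
      (continuousOn_const.mul (c1.mul hf.continuousOn))
      (continuousOn_const.mul (c2.mul hf.continuousOn))]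
    · simp only [intervalIntegral.integral_const_mul]
    · intro x hx hxs
      simp only [sideKernelDeriv, sideKernel, not_lt.2 hs0, not_lt.2 hs1, if_false, hxs, if_true,
        cutDeriv_of_mem _ _ hs, cutDeriv_of_mem _ _ (hIcc hx), Function.iterate_zero, id]
      ring
    · intro x hx hxs
      simp only [sideKernelDeriv, sideKernel, not_lt.2 hs0, not_lt.2 hs1, if_false, not_lt.2 hxs,
        cutDeriv_of_mem _ _ hs, cutDeriv_of_mem _ _ (hIcc hx), Function.iterate_zero, id]
      ring
  rw [e 0 (by norm_num) _ (hψ.iteratedDeriv n).continuous, e n hn _ hψ.continuous]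
  obtain ⟨k1, k2⟩ := h.integral_iterate_test h.left hψ (Set.left_mem_Icc.2 zero_le_one) hs
  obtain ⟨k3, k4⟩ := h.integral_iterate_test h.right hψ hs (Set.right_mem_Icc.2 zero_le_one)
  have hjump : ∀ m, unitIoo.indicator (sideKernelJump p q m) s * ψ s = sideKernelJump p q m s * ψ s :=
    fun m => by
      by_cases hs' : s ∈ unitIoo
      · rw [Set.indicator_of_mem hs']
      · simp [hψ.eq_zero hs']
  rw [hjump]
  -- The boundary terms at s of the two integrations by parts meet here. Continuity of the kernel
  -- cancels those carrying ψ(s) for n = 1 and ψ'(s) for n = 2; for n = 2 the ψ(s) terms leave the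
  -- jump of the first derivative.
  interval_cases n
  · simp [sideKernelJump]
  · simp only [iteratedDeriv_one, Function.iterate_zero, id, Function.iterate_one, sideKernelJump]
    rw [k1, k3, z1, z2]; norm_num; ring
  · simp only [iteratedDeriv_succ, iteratedDeriv_zero, Function.iterate_zero, id,
      Function.iterate_succ, Function.comp, sideKernelJump, if_true]
    rw [k2, k4, z1, z2, z3, z4]; ring

end SLPair

/-! ### Mixed partial derivatives of test functions on the cube -/

section MixedPartial

variable {d : ℕ}

theorem IsTestFunction.partialDeriv {S : Set (Fin d → ℝ)} {φ : (Fin d → ℝ) → ℝ}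
    (h : IsTestFunction S φ) (j : Fin d) : IsTestFunction S (partialDeriv j φ) := by
  have hsupp : tsupport (_root_.partialDeriv j φ) ⊆ tsupport φ := by
    refine closure_minimal (fun x hx => ?_) isClosed_closure
    by_contra hx'
    have : φ =ᶠ[nhds x] fun _ => 0 := by
      filter_upwards [(isClosed_tsupport φ).isOpen_compl.mem_nhds hx'] with y hy
      exact image_eq_zero_of_notMem_tsupport hy
    exact hx (by simp [_root_.partialDeriv, this.fderiv_eq])
  refine ⟨?_, h.2.1.of_isClosed_subset isClosed_closure hsupp, hsupp.trans h.2.2⟩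
  have h1 : ContDiff ℝ ∞ (fderiv ℝ φ) := h.1.fderiv_right (by norm_cast)
  exact h1.clm_apply contDiff_const

theorem IsTestFunction.iterate_partialDeriv {S : Set (Fin d → ℝ)} {φ : (Fin d → ℝ) → ℝ}
    (h : IsTestFunction S φ) (j : Fin d) (n : ℕ) : IsTestFunction S ((_root_.partialDeriv j)^[n] φ) := by
  induction n with
  | zero => exact h
  | succ n ih => rw [Function.iterate_succ_apply']; exact ih.partialDeriv j

/-- Partial derivatives of order `α j` in the variables listed in `l`. -/
noncomputable def listPartial (α : Fin d → ℕ) (φ : (Fin d → ℝ) → ℝ) (l : List (Fin d)) :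
    (Fin d → ℝ) → ℝ :=
  l.foldr (fun j ψ => (partialDeriv j)^[α j] ψ) φ

theorem IsTestFunction.listPartial {S : Set (Fin d → ℝ)} {φ : (Fin d → ℝ) → ℝ}
    (h : IsTestFunction S φ) (α : Fin d → ℕ) (l : List (Fin d)) :
    IsTestFunction S (listPartial α φ l) := by
  induction l with
  | nil => exact h
  | cons j l ih => exact ih.iterate_partialDeriv j (α j)

theorem hasDerivAt_insertNth {n : ℕ} (i : Fin (n + 1)) (z : Fin n → ℝ) (y : ℝ) :
    HasDerivAt (fun y => i.insertNth (α := fun _ => ℝ) y z) (Pi.single i 1) y := by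
  rw [hasDerivAt_pi]
  intro j
  rcases Fin.eq_self_or_eq_succAbove i j with rfl | ⟨j, rfl⟩
  · simpa using hasDerivAt_id' y
  · simpa [Fin.succAbove_ne] using hasDerivAt_const y (z j)

theorem iteratedDeriv_insertNth {n : ℕ} (i : Fin (n + 1)) (z : Fin n → ℝ)
    {S : Set (Fin (n + 1) → ℝ)} {φ : (Fin (n + 1) → ℝ) → ℝ} (h : IsTestFunction S φ) (m : ℕ) :
    iteratedDeriv m (fun y => φ (i.insertNth y z))
      = fun y => (partialDeriv i)^[m] φ (i.insertNth y z) := by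
  induction m with
  | zero => simp
  | succ m ih =>
    rw [iteratedDeriv_succ, ih]
    funext y
    rw [Function.iterate_succ_apply']
    have h1 := ((h.iterate_partialDeriv i m).1.differentiable (by norm_num)
      (i.insertNth y z)).hasFDerivAt.comp_hasDerivAt y (hasDerivAt_insertNth i z y)
    exact h1.deriv

theorem isTestFunction_insertNth {n : ℕ} (i : Fin (n + 1)) (z : Fin n → ℝ)
    {φ : (Fin (n + 1) → ℝ) → ℝ} (h : IsTestFunction (openCube (n + 1)) φ) :
    IsTestFunction unitIoo (fun y => φ (i.insertNth y z)) := by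
  have hK : IsCompact ((fun x : Fin (n + 1) → ℝ => x i) '' tsupport φ) :=
    h.2.1.image (continuous_apply i)
  have hsub : tsupport (fun y => φ (i.insertNth y z)) ⊆ (fun x : Fin (n + 1) → ℝ => x i) '' tsupport φ := by
    refine closure_minimal (fun y hy => ?_) hK.isClosed
    exact ⟨i.insertNth y z, subset_closure hy, by simp⟩
  refine ⟨h.1.comp ?_, hK.of_isClosed_subset isClosed_closure hsub, hsub.trans ?_⟩
  · rw [contDiff_pi]
    intro j
    rcases Fin.eq_self_or_eq_succAbove i j with rfl | ⟨j, rfl⟩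
    · simp only [Fin.insertNth_apply_same]; exact contDiff_id
    · simpa using contDiff_const
  · rintro _ ⟨x, hx, rfl⟩
    exact h.2.2 hx i

theorem integrable_pi_prod_mul {m : Fin d → Measure ℝ} [∀ j, SigmaFinite (m j)]
    {E : Fin d → ℝ → ℝ} (hE : ∀ j, Integrable (E j) (m j)) {f : (Fin d → ℝ) → ℝ} (hf : IsBddMeas f) :
    Integrable (fun t => (∏ j, E j (t j)) * f t) (Measure.pi m) := by
  obtain ⟨hf, C, hC⟩ := hf
  exact (Integrable.fintype_prod hE).mul_bdd hf.aestronglyMeasurable (ae_of_all _ hC)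

/-- Representations of one-variable derivatives in the sense of distributions combine to a
representation of mixed partial derivatives. -/
theorem integral_prod_mul_mixedPartial {c e r : Fin d → ℝ → ℝ} {α : Fin d → ℕ}
    (hc : ∀ j, Integrable (c j)) (he : ∀ j, Integrable (e j)) (hr : ∀ j, Measurable (r j))
    (h : ∀ j ψ, IsTestFunction unitIoo ψ →
      ∫ x, c j x * iteratedDeriv (α j) ψ x = ∫ t, e j t * ψ (r j t))
    {φ : (Fin d → ℝ) → ℝ} (hφ : IsTestFunction (openCube d) φ) :
    ∫ x : Fin d → ℝ, (∏ j, c j (x j)) * mixedPartial α φ x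
      = ∫ t : Fin d → ℝ, (∏ j, e j (t j)) * φ fun j => r j (t j) := by
  classical
  -- Interpolation between the two sides: coordinates in l still carry c and a derivative, the
  -- others already carry e and evaluation at r. Moving one coordinate across applies the
  -- one-variable hypothesis to a line section of the remaining derivative, which is again a test
  -- function. Hence φ need not be a product.
  have key : ∀ l : List (Fin d), l.Nodup →
      ∫ t : Fin d → ℝ, (∏ j, (if j ∈ l then c j else e j) (t j)) *
        listPartial α φ l (fun j => (if j ∈ l then id else r j) (t j))
      = ∫ t : Fin d → ℝ, (∏ j, e j (t j)) * φ fun j => r j (t j) := by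
    intro l
    induction l with
    | nil => intro _; simp [listPartial]
    | cons i l ih =>
      intro hl
      rw [List.nodup_cons] at hl
      rw [← ih hl.2]
      obtain ⟨n, rfl⟩ : ∃ n, d = n + 1 := ⟨d - 1, by have := i.2; omega⟩
      have hint : ∀ l' l'' : List (Fin (n + 1)), Integrable (fun t : Fin (n + 1) → ℝ =>
          (∏ j, (if j ∈ l' then c j else e j) (t j)) *
          listPartial α φ l'' (fun j => (if j ∈ l' then id else r j) (t j)))
          (Measure.pi fun _ => volume) := by
        intro l' l''
        refine integrable_pi_prod_mul (fun j => ?_)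
          ((IsBddMeas.of_isTestFunction (hφ.listPartial α l'')).comp
            (measurable_pi_lambda _ fun j => ?_))
        · split_ifs
          exacts [hc j, he j]
        · split_ifs
          exacts [measurable_pi_apply j, (hr j).comp (measurable_pi_apply j)]
      have h1 := (integrable_pi_iff_insertNth i).1 (hint (i :: l) (i :: l))
      have h2 := (integrable_pi_iff_insertNth i).1 (hint l l)
      rw [volume_pi, integral_pi_insertNth i, integral_pi_insertNth i, integral_prod_symm _ h1,
        integral_prod_symm _ h2]
      refine integral_congr_ae (ae_of_all _ fun z => ?_)
      dsimp only
      set z' : Fin n → ℝ := fun j => (if i.succAbove j ∈ l then id else r (i.succAbove j)) (z j)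
      set A : ℝ := ∏ j, (if i.succAbove j ∈ l then c (i.succAbove j) else e (i.succAbove j)) (z j)
      have hψ := isTestFunction_insertNth i z' (hφ.listPartial α l)
      have e1 : ∀ (t : ℝ), (∏ j, (if j ∈ i :: l then c j else e j)
          (i.insertNth (α := fun _ => ℝ) t z j)) = c i t * A := fun t => by
        rw [Fin.prod_univ_succAbove _ i]
        simp [Fin.succAbove_ne, A]
      have e2 : ∀ (t : ℝ), (∏ j, (if j ∈ l then c j else e j)
          (i.insertNth (α := fun _ => ℝ) t z j)) = e i t * A := fun t => by
        rw [Fin.prod_univ_succAbove _ i]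
        simp [hl.1, A]
      have e3 : ∀ t : ℝ, (fun j => (if j ∈ i :: l then id else r j)
          (i.insertNth (α := fun _ => ℝ) t z j)) = i.insertNth (α := fun _ => ℝ) t z' := fun t => by
        funext j
        rcases Fin.eq_self_or_eq_succAbove i j with rfl | ⟨j, rfl⟩
        · simp
        · simp [Fin.succAbove_ne, z']
      have e4 : ∀ t : ℝ, (fun j => (if j ∈ l then id else r j)
          (i.insertNth (α := fun _ => ℝ) t z j)) = i.insertNth (α := fun _ => ℝ) (r i t) z' :=
        fun t => by
        funext j
        rcases Fin.eq_self_or_eq_succAbove i j with rfl | ⟨j, rfl⟩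
        · simp [hl.1]
        · simp [z']
      simp_rw [e1, e2, e3, e4]
      have h3 := h i _ hψ
      rw [iteratedDeriv_insertNth i z' (hφ.listPartial α l)] at h3
      have h4 : ∀ t, c i t * A * listPartial α φ (i :: l) (i.insertNth t z')
          = A * (c i t * (partialDeriv i)^[α i] (listPartial α φ l) (i.insertNth t z')) := fun t => by
        simp only [listPartial, List.foldr_cons]; ring
      have h5 : ∀ t, e i t * A * listPartial α φ l (i.insertNth (r i t) z')
          = A * (e i t * listPartial α φ l (i.insertNth (r i t) z')) := fun t => by ring
      simp_rw [h4, h5]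
      rw [integral_const_mul, integral_const_mul, h3]
  have := key (List.finRange d) (List.nodup_finRange d)
  simpa [listPartial, mixedPartial] using this

theorem isTestFunction_prod {η : Fin d → ℝ → ℝ} (hη : ∀ j, IsTestFunction unitIoo (η j)) :
    IsTestFunction (openCube d) (fun x => ∏ j, η j (x j)) := by
  have hK : IsCompact (Set.univ.pi fun j => tsupport (η j)) :=
    isCompact_univ_pi fun j => (hη j).2.1
  have hsub : tsupport (fun x : Fin d → ℝ => ∏ j, η j (x j)) ⊆ Set.univ.pi fun j => tsupport (η j) := by
    refine closure_minimal (fun x hx j _ => ?_) hK.isClosed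
    refine subset_closure fun h0 => hx ?_
    exact Finset.prod_eq_zero (Finset.mem_univ j) h0
  refine ⟨?_, hK.of_isClosed_subset isClosed_closure hsub, fun x hx j => (hη j).2.2 (hsub hx j trivial)⟩
  exact contDiff_prod fun j _ => (hη j).1.comp (contDiff_apply ℝ ℝ j)

theorem iterate_partialDeriv_prod {η : Fin d → ℝ → ℝ} (hη : ∀ j, IsTestFunction unitIoo (η j))
    (i : Fin d) (m : ℕ) :
    (partialDeriv i)^[m] (fun x => ∏ j, η j (x j))
      = fun x => ∏ j, Function.update η i (iteratedDeriv m (η i)) j (x j) := by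
  obtain ⟨n, rfl⟩ : ∃ n, d = n + 1 := ⟨d - 1, by have := i.2; omega⟩
  funext x
  have h1 := congrFun (iteratedDeriv_insertNth i (fun j => x (i.succAbove j))
    (isTestFunction_prod hη) m) (x i)
  have h2 : i.insertNth (x i) (fun j => x (i.succAbove j)) = x := by
    funext j
    rcases Fin.eq_self_or_eq_succAbove i j with rfl | ⟨j, rfl⟩ <;> simp
  rw [h2] at h1
  rw [← h1]
  have h3 : (fun y => ∏ j, η j (i.insertNth (α := fun _ => ℝ) y (fun j => x (i.succAbove j)) j))
      = fun y => (∏ j, η (i.succAbove j) (x (i.succAbove j))) * η i y := by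
    funext y
    rw [Fin.prod_univ_succAbove _ i]
    simp [mul_comm]
  rw [h3, Fin.prod_univ_succAbove _ i]
  simp only [Function.update_self, Fin.succAbove_ne, ne_eq, not_false_eq_true,
    Function.update_of_ne]
  rw [iteratedDeriv_const_mul_field, mul_comm]

theorem mixedPartial_prod {η : Fin d → ℝ → ℝ} (hη : ∀ j, IsTestFunction unitIoo (η j))
    (α : Fin d → ℕ) :
    mixedPartial α (fun x => ∏ j, η j (x j)) = fun x => ∏ j, iteratedDeriv (α j) (η j) (x j) := by
  classical
  have key : ∀ l : List (Fin d), l.Nodup → listPartial α (fun x => ∏ j, η j (x j)) l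
      = fun x => ∏ j, (if j ∈ l then iteratedDeriv (α j) (η j) else η j) (x j) := by
    intro l
    induction l with
    | nil => intro _; simp [listPartial]
    | cons i l ih =>
      intro hl
      rw [List.nodup_cons] at hl
      have h1 : listPartial α (fun x => ∏ j, η j (x j)) (i :: l)
        = (partialDeriv i)^[α i] (listPartial α (fun x => ∏ j, η j (x j)) l) := rfl
      rw [h1, ih hl.2, iterate_partialDeriv_prod (η := fun j => if j ∈ l then
        iteratedDeriv (α j) (η j) else η j)]
      · funext x
        refine Finset.prod_congr rfl fun j _ => ?_
        by_cases hj : j = i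
        · subst hj; simp [hl.1]
        · simp [hj]
      · intro j
        split_ifs
        exacts [(hη j).iteratedDeriv _, hη j]
  have := key (List.finRange d) (List.nodup_finRange d)
  simpa [listPartial, mixedPartial] using this

end MixedPartial

/-! ### Products of measures with density and of measure preserving maps -/

theorem setIntegral_pi_prod_mul {d : ℕ} {A : Set ℝ} (hA : MeasurableSet A) (E : Fin d → ℝ → ℝ)
    (f : (Fin d → ℝ) → ℝ) :
    ∫ t, (∏ j, E j (t j)) * f t ∂Measure.pi (fun _ => volume.restrict A)
      = ∫ t : Fin d → ℝ, (∏ j, A.indicator (E j) (t j)) * f t := by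
  rw [← Measure.restrict_pi_pi, ← volume_pi, ← integral_indicator (MeasurableSet.univ_pi fun _ => hA)]
  refine integral_congr_ae (ae_of_all _ fun t => ?_)
  by_cases ht : t ∈ Set.univ.pi fun _ : Fin d => A
  · have h1 : ∀ j, A.indicator (E j) (t j) = E j (t j) := fun j =>
      Set.indicator_of_mem (ht j (Set.mem_univ j)) _
    simp only [Set.indicator_of_mem ht, h1]
  · have h2 := ht
    simp only [Set.mem_univ_pi, not_forall] at h2
    obtain ⟨j, hj⟩ := h2
    rw [Set.indicator_of_notMem ht]
    change 0 = (∏ j, A.indicator (E j) (t j)) * f t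
    rw [Finset.prod_eq_zero (Finset.mem_univ j), zero_mul]
    exact Set.indicator_of_notMem hj _

theorem pi_smul_measure {ι : Type*} [Fintype ι] {X : ι → Type*} [∀ i, MeasurableSpace (X i)]
    (C : ι → ℝ≥0∞) (ν : ∀ i, Measure (X i)) [∀ i, SigmaFinite (ν i)] [∀ i, SigmaFinite (C i • ν i)] :
    Measure.pi (fun i => C i • ν i) = (∏ i, C i) • Measure.pi ν := by
  refine Measure.pi_eq fun s _ => ?_
  simp [Finset.prod_mul_distrib]

theorem measurePreserving_pi_smul {ι : Type*} [Fintype ι] {X Y : ι → Type*}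
    [∀ i, MeasurableSpace (X i)] [∀ i, MeasurableSpace (Y i)] {m : ∀ i, Measure (X i)}
    {ν : ∀ i, Measure (Y i)} {C : ι → ℝ≥0∞} [∀ i, SigmaFinite (ν i)] [∀ i, SigmaFinite (C i • ν i)]
    {f : ∀ i, X i → Y i} (hf : ∀ i, MeasurePreserving (f i) (m i) (C i • ν i)) :
    MeasurePreserving (fun x i => f i (x i)) (Measure.pi m) ((∏ i, C i) • Measure.pi ν) := by
  have : ∀ i, SigmaFinite ((m i).map (f i)) := fun i => (hf i).map_eq ▸ inferInstance
  refine ⟨measurable_pi_lambda _ fun i => (hf i).measurable.comp (measurable_pi_apply i), ?_⟩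
  rw [Measure.pi_map_pi fun i => (hf i).measurable.aemeasurable, ← pi_smul_measure]
  simp_rw [(hf _).map_eq]

theorem pi_withDensity_ofReal {ι : Type*} [Fintype ι] {m : ι → Measure ℝ} [∀ i, SigmaFinite (m i)]
    {f : ι → ℝ → ℝ} (hf : ∀ i, Integrable (f i) (m i)) (h0 : ∀ i x, 0 ≤ f i x) :
    Measure.pi (fun i => (m i).withDensity fun x => ENNReal.ofReal (f i x))
      = (Measure.pi m).withDensity fun x => ENNReal.ofReal (∏ i, f i (x i)) := by
  have : ∀ i, IsFiniteMeasure ((m i).withDensity fun x => ENNReal.ofReal (f i x)) := fun i =>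
    isFiniteMeasure_withDensity_ofReal (hf i).2
  refine Measure.pi_eq fun s hs => ?_
  rw [withDensity_apply _ (MeasurableSet.univ_pi hs), Measure.restrict_pi_pi,
    ← ofReal_integral_eq_lintegral_ofReal
      (Integrable.fintype_prod fun i => (hf i).integrableOn)
      (ae_of_all _ fun x => Finset.prod_nonneg fun i _ => h0 i _),
    integral_fintype_prod_eq_prod, ENNReal.ofReal_prod_of_nonneg fun i _ => integral_nonneg (h0 i)]
  refine Finset.prod_congr rfl fun i _ => ?_
  rw [withDensity_apply _ (hs i), ofReal_integral_eq_lintegral_ofReal (hf i).integrableOn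
    (ae_of_all _ (h0 i))]

/-! ### The weight of a Sturm–Liouville pair -/

section SideWeight

variable (I : Set ℝ) (p q : ℝ → ℝ)

/-- The weight equal to `p` to the left of `[0,1]`, to `q` to the right of it, and to `1` on it. -/
noncomputable def sideWeight (s : ℝ) : ℝ :=
  (I ∩ Set.Iio 0).indicator p s + (I ∩ Set.Ioi 1).indicator q s
    + ((I ∩ Set.Iio 0) ∪ (I ∩ Set.Ioi 1))ᶜ.indicator 1 s

/-- The measure on `I` whose density is the square of the weight. -/
noncomputable def sideMeasure : Measure ℝ :=
  (volume.restrict I).withDensity fun s => ENNReal.ofReal (sideWeight I p q s ^ 2)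

variable {I p q}

theorem sideWeight_left {s : ℝ} (hs : s ∈ I) (h : s < 0) : sideWeight I p q s = p s := by
  have : ¬ 1 < s := not_lt.2 (by linarith)
  simp [sideWeight, hs, h, this]

theorem sideWeight_right {s : ℝ} (hs : s ∈ I) (h : 1 < s) : sideWeight I p q s = q s := by
  have : ¬ s < 0 := not_lt.2 (by linarith)
  simp [sideWeight, hs, h, this]

theorem sideWeight_mid {s : ℝ} (h0 : 0 ≤ s) (h1 : s ≤ 1) : sideWeight I p q s = 1 := by
  simp [sideWeight, not_lt.2 h0, not_lt.2 h1]

theorem sideWeight_of_notMem {s : ℝ} (hs : s ∉ I) : sideWeight I p q s = 1 := by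
  simp [sideWeight, hs]

end SideWeight

namespace SLPair

variable {I : Set ℝ} {p q u v : ℝ → ℝ} {c : ℝ}

theorem sideWeight_pos (h : SLPair I p q u v c) (s : ℝ) : 0 < sideWeight I p q s := by
  by_cases hs : s ∈ I
  · rcases lt_or_ge s 0 with h0 | h0
    · rw [sideWeight_left hs h0]; exact h.left_pos s hs
    · rcases lt_or_ge 1 s with h1 | h1
      · rw [sideWeight_right hs h1]; exact h.right_pos s hs
      · rw [sideWeight_mid h0 h1]; exact one_pos
  · rw [sideWeight_of_notMem hs]; exact one_pos

theorem measurableSet (h : SLPair I p q u v c) : MeasurableSet I := h.left.isOpen.measurableSet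

theorem measurable_sideWeight (h : SLPair I p q u v c) : Measurable (sideWeight I p q) := by
  classical
  have h1 := h.measurableSet.inter (measurableSet_Iio (a := (0:ℝ)))
  have h2 := h.measurableSet.inter (measurableSet_Ioi (a := (1:ℝ)))
  refine (Measurable.add ?_ ?_).add (measurable_one.indicator (h1.union h2).compl)
  · rw [← Set.piecewise_eq_indicator]
    exact (h.left.contDiffOn.continuousOn.mono Set.inter_subset_left).measurable_piecewise
      continuousOn_const h1
  · rw [← Set.piecewise_eq_indicator]
    exact (h.right.contDiffOn.continuousOn.mono Set.inter_subset_left).measurable_piecewise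
      continuousOn_const h2

/-- The tails of p and q are square integrable and the middle piece has length one. Consequently
`sideMeasure` is finite. -/
theorem memLp_sideWeight (h : SLPair I p q u v c) :
    MemLp (sideWeight I p q) 2 (volume.restrict I) := by
  have h1 := h.measurableSet.inter (measurableSet_Iio (a := (0:ℝ)))
  have h2 := h.measurableSet.inter (measurableSet_Ioi (a := (1:ℝ)))
  have e1 : MemLp ((I ∩ Set.Iio 0).indicator p) 2 (volume.restrict I) :=
    ((memLp_indicator_iff_restrict h1).2 h.memLp_left).restrict I
  have e2 : MemLp ((I ∩ Set.Ioi 1).indicator q) 2 (volume.restrict I) :=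
    ((memLp_indicator_iff_restrict h2).2 h.memLp_right).restrict I
  have e3 : MemLp ((Set.Icc (0:ℝ) 1).indicator (1 : ℝ → ℝ)) 2 (volume.restrict I) :=
    ((memLp_indicator_iff_restrict measurableSet_Icc).2 (memLp_const (1:ℝ))).restrict I
  refine (e1.add e2).add ((memLp_congr_ae ?_).1 e3)
  filter_upwards [ae_restrict_mem h.measurableSet] with s hs
  by_cases hs' : s ∈ Set.Icc (0:ℝ) 1
  · have := not_lt.2 hs'.1
    have := not_lt.2 hs'.2
    simp [hs'.1, hs'.2]
  · simp only [Set.mem_Icc, not_and_or, not_le] at hs'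
    have h3 : s ∉ Set.Icc (0:ℝ) 1 := fun h => hs'.elim (not_lt.2 h.1) (not_lt.2 h.2)
    have h4 : s ∈ I ∩ Set.Iio 0 ∪ I ∩ Set.Ioi 1 := hs'.imp (fun h => ⟨hs, h⟩) fun h => ⟨hs, h⟩
    rw [Set.indicator_of_notMem h3, Set.indicator_of_notMem (Set.notMem_compl_iff.2 h4)]

theorem integrable_sideWeight_sq (h : SLPair I p q u v c) :
    Integrable (fun s => sideWeight I p q s ^ 2) (volume.restrict I) :=
  h.memLp_sideWeight.integrable_sq

theorem isFiniteMeasure (h : SLPair I p q u v c) : IsFiniteMeasure (sideMeasure I p q) :=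
  isFiniteMeasure_withDensity_ofReal h.integrable_sideWeight_sq.2

/-- The weight is 1 on the unit interval; this is the hypothesis needed by
`measurePreserving_splitPoint`. -/
theorem sideMeasure_restrict (h : SLPair I p q u v c) :
    (sideMeasure I p q).restrict unitIoo = unitVolume := by
  have hsub : unitIoo ⊆ I := Set.Ioo_subset_Icc_self.trans h.Icc_subset
  rw [sideMeasure, restrict_withDensity measurableSet_Ioo, Measure.restrict_restrict measurableSet_Ioo,
    Set.inter_eq_self_of_subset_left hsub, withDensity_congr_ae (g := 1), withDensity_one]
  filter_upwards [ae_restrict_mem measurableSet_Ioo] with s hs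
  simp [sideWeight_mid hs.1.le hs.2.le]

/-- For x in the unit interval the whole growth of k(x, s) in s outside [0,1] is the factor p(s) or
q(s), which the weight absorbs. The normalized factor is bounded. -/
theorem kernel_eq (_h : SLPair I p q u v c) {x s : ℝ} (hx : x ∈ unitIoo) (hs : s ∈ I) :
    p (min x s) * q (max x s) = sideKernelDeriv p q 0 x s * sideWeight I p q s := by
  have hx' : x ∈ Set.Icc (0:ℝ) 1 := Set.Ioo_subset_Icc_self hx
  rcases lt_or_ge s 0 with h0 | h0
  · rw [sideWeight_left hs h0, min_eq_right (h0.trans hx.1).le, max_eq_left (h0.trans hx.1).le]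
    simp only [sideKernelDeriv, sideKernel, h0, if_true, cutDeriv_of_mem _ _ hx',
      Function.iterate_zero, id, mul_comm]
  rcases lt_or_ge 1 s with h1 | h1
  · rw [sideWeight_right hs h1, min_eq_left (hx.2.trans h1).le, max_eq_right (hx.2.trans h1).le]
    simp only [sideKernelDeriv, sideKernel, not_lt.2 h0, h1, if_true, if_false,
      cutDeriv_of_mem _ _ hx', Function.iterate_zero, id]
  rw [sideWeight_mid h0 h1, mul_one]
  simp only [sideKernelDeriv, sideKernel, not_lt.2 h0, not_lt.2 h1, if_false,
    cutDeriv_of_mem _ _ hx', cutDeriv_of_mem _ _ (show s ∈ Set.Icc (0:ℝ) 1 from ⟨h0, h1⟩),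
    Function.iterate_zero, id]
  split_ifs with h2
  · rw [min_eq_left h2.le, max_eq_right h2.le]
  · rw [min_eq_right (not_lt.1 h2), max_eq_left (not_lt.1 h2), mul_comm]

end SLPair

/-! ### Tensor products of splitting operators -/

section Split

variable {d : ℕ} {μ : Fin d → Measure ℝ} [∀ j, IsFiniteMeasure (μ j)]

/-- The product of the measures `μ_j ⊗ vol(0,2)`. -/
noncomputable abbrev splitMeasure (μ : Fin d → Measure ℝ) : Measure (Fin d → ℝ × ℝ) :=
  Measure.pi fun j => (μ j).prod doubleVolume

theorem measurePreserving_splitMeasure_fst :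
    MeasurePreserving (fun (z : Fin d → ℝ × ℝ) j => (z j).1) (splitMeasure μ)
      ((∏ _j : Fin d, (2 : ℝ≥0∞)) • Measure.pi μ) := by
  have : ∀ j, SigmaFinite ((2 : ℝ≥0∞) • μ j) := fun j =>
    have : IsFiniteMeasure ((2 : ℝ≥0∞) • μ j) := (μ j).smul_finite (by norm_num)
    inferInstance
  refine measurePreserving_pi_smul (f := fun _ => Prod.fst) fun j => ⟨measurable_fst, ?_⟩
  rw [Measure.map_fst_prod]
  simp

theorem measurePreserving_splitMeasure_splitPoint (hμ : ∀ j, (μ j).restrict unitIoo = unitVolume) :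
    MeasurePreserving (fun (z : Fin d → ℝ × ℝ) j => splitPoint (z j).1 (z j).2) (splitMeasure μ)
      ((∏ j : Fin d, (2 * μ j Set.univ)) • cubeVolume d) := by
  have : ∀ j, SigmaFinite ((2 * μ j Set.univ) • unitVolume) := fun j =>
    have : IsFiniteMeasure ((2 * μ j Set.univ) • unitVolume) :=
      unitVolume.smul_finite (ENNReal.mul_ne_top (by norm_num) (measure_ne_top _ _))
    inferInstance
  exact measurePreserving_pi_smul (f := fun _ (z : ℝ × ℝ) => splitPoint z.1 z.2) fun j =>
    measurePreserving_splitPoint (hμ j)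

theorem splitMeasure_const_ne (hμ : ∀ j, (μ j).restrict unitIoo = unitVolume) :
    (∏ j : Fin d, (2 * μ j Set.univ)) ≠ ⊤ ∧ (∏ j : Fin d, (2 * μ j Set.univ)) ≠ 0 := by
  refine ⟨ENNReal.prod_ne_top fun j _ => ENNReal.mul_ne_top (by norm_num) (measure_ne_top _ _),
    Finset.prod_ne_zero_iff.2 fun j _ => mul_ne_zero (by norm_num) fun h0 => ?_⟩
  have h1 : (μ j).restrict unitIoo Set.univ = 1 := by rw [hμ]; simp
  rw [Measure.restrict_apply_univ] at h1
  have := (measure_mono (μ := μ j) (Set.subset_univ unitIoo)).trans_eq h0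
  rw [h1] at this
  exact absurd this (by norm_num)

theorem isBddMeas_prod_split {K : Fin d → ℝ → ℝ → ℝ} (hK : ∀ j, IsBddMeas fun z : ℝ × ℝ => K j z.1 z.2) :
    IsBddMeas fun z : Fin d → ℝ × ℝ => ∏ j, K j (z j).1 (z j).2 :=
  IsBddMeas.finset_prod fun j => (hK j).comp (measurable_pi_apply j)

theorem integral_splitMeasure (f : (Fin d → ℝ) → (Fin d → ℝ) → ℝ) :
    ∫ z, f (fun j => (z j).1) (fun j => (z j).2) ∂splitMeasure μ
      = ∫ y, f y.1 y.2 ∂(Measure.pi μ).prod (Measure.pi fun _ => doubleVolume) :=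
  (measurePreserving_arrowProdEquivProdArrow ℝ ℝ (Fin d) μ fun _ => doubleVolume).integral_comp
    (MeasurableEquiv.measurableEmbedding _) fun y => f y.1 y.2

end Split

/-! ### Weak mixed derivatives of kernel transforms -/

section Transform

variable {d : ℕ} {I : Fin d → Set ℝ} {p q u v : Fin d → ℝ → ℝ} {c : Fin d → ℝ}

theorem IsBddMeas.prod_prodMk {K : Fin d → ℝ → ℝ → ℝ}
    (hK : ∀ j, IsBddMeas fun z : ℝ × ℝ => K j z.1 z.2) :
    IsBddMeas fun z : (Fin d → ℝ) × (Fin d → ℝ) => ∏ j, K j (z.1 j) (z.2 j) :=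
  IsBddMeas.finset_prod fun j => (hK j).comp (e := fun z : (Fin d → ℝ) × (Fin d → ℝ) => (z.1 j, z.2 j))
    (((measurable_pi_apply j).comp measurable_fst).prodMk
      ((measurable_pi_apply j).comp measurable_snd))

theorem measurable_splitPoint_pi :
    Measurable fun z : (Fin d → ℝ) × (Fin d → ℝ) => fun j => splitPoint (z.1 j) (z.2 j) :=
  measurable_pi_lambda _ fun j => measurable_splitPoint.comp
    (f := fun z : (Fin d → ℝ) × (Fin d → ℝ) => (z.1 j, z.2 j))
    (((measurable_pi_apply j).comp measurable_fst).prodMk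
      ((measurable_pi_apply j).comp measurable_snd))

/-- The kernel of the transform in coordinates normalized by the weights. -/
noncomputable def sideTransform (I : Fin d → Set ℝ) (p q : Fin d → ℝ → ℝ) (w : (Fin d → ℝ) → ℝ)
    (x : Fin d → ℝ) : ℝ :=
  ∫ s, (∏ j, sideKernelDeriv (p j) (q j) 0 (x j) (s j)) * w s
    ∂Measure.pi fun j => sideMeasure (I j) (p j) (q j)

/-- For fixed s the one-variable formulas, each written with its jump term as a single integral over
(0,2), are combined over the coordinates by `integral_prod_mul_mixedPartial`. -/
theorem integral_prod_sideKernelDeriv (h : ∀ j, SLPair (I j) (p j) (q j) (u j) (v j) (c j))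
    {α : Fin d → ℕ} (hα : ∀ j, α j ≤ 2) {φ : (Fin d → ℝ) → ℝ} (hφ : IsTestFunction (openCube d) φ)
    (s : Fin d → ℝ) :
    ∫ x, (∏ j, sideKernelDeriv (p j) (q j) 0 (x j) (s j)) * mixedPartial α φ x ∂cubeVolume d
      = (-1) ^ (∑ j, α j) * ∫ t, (∏ j, splitMul (fun s t => sideKernelDeriv (p j) (q j) (α j) t s)
          (sideKernelJump (p j) (q j) (α j)) (s j) (t j)) * φ (fun j => splitPoint (s j) (t j))
          ∂Measure.pi fun _ => doubleVolume := by
  have hb : ∀ n ≤ 2, ∀ j, IsBddMeas fun x => sideKernelDeriv (p j) (q j) n x (s j) := fun n hn j =>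
    ((h j).isBddMeas_sideKernelDeriv hn).swap.section_right (K := fun y x =>
      sideKernelDeriv (p j) (q j) n x y) (s j)
  have hb' : ∀ j, IsBddMeas fun t => splitMul (fun s t => sideKernelDeriv (p j) (q j) (α j) t s)
          (sideKernelJump (p j) (q j) (α j)) (s j) t := fun j =>
    (isBddMeas_splitMul ((h j).isBddMeas_sideKernelDeriv (hα j)).swap
      (((h j).continuousOn_sideKernelJump (α j)).mono (h j).Icc_subset)).section_right
      (K := splitMul (fun s t => sideKernelDeriv (p j) (q j) (α j) t s)
          (sideKernelJump (p j) (q j) (α j))) (s j)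
  have e1 := setIntegral_pi_prod_mul measurableSet_Ioo
    (fun j x => sideKernelDeriv (p j) (q j) 0 x (s j)) (mixedPartial α φ) (A := unitIoo)
  have e2 := setIntegral_pi_prod_mul measurableSet_Ioo
    (fun j t => (-1) ^ α j * splitMul (fun s t => sideKernelDeriv (p j) (q j) (α j) t s)
          (sideKernelJump (p j) (q j) (α j)) (s j) t)
    (fun t => φ fun j => splitPoint (s j) (t j)) (A := Set.Ioo 0 2)
  rw [e1, integral_prod_mul_mixedPartial (α := α)
    (e := fun j => (Set.Ioo 0 2).indicator fun t => (-1) ^ α j *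
      splitMul (fun s t => sideKernelDeriv (p j) (q j) (α j) t s)
          (sideKernelJump (p j) (q j) (α j)) (s j) t) (r := fun j => splitPoint (s j)) _ _ _ _ hφ, ← e2]
  · simp only [Finset.prod_mul_distrib, Finset.prod_pow_eq_pow_sum, mul_assoc, integral_const_mul]
  · exact fun j => (integrable_indicator_iff measurableSet_Ioo).2 (hb 0 (by norm_num) j).integrable
  · exact fun j => (integrable_indicator_iff measurableSet_Ioo).2
      (((IsBddMeas.const _).mul (hb' j)).integrable (μ := doubleVolume))
  · exact fun j => measurable_splitPoint.comp measurable_prodMk_left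
  · intro j ψ hψ
    simp only [← Set.indicator_mul_left _ _ (iteratedDeriv (α j) ψ),
      ← Set.indicator_mul_left _ _ (fun t => ψ (splitPoint (s j) t))]
    rw [integral_indicator measurableSet_Ioo, integral_indicator measurableSet_Ioo,
      (h j).integral_sideKernel_mul_iteratedDeriv (hα j) hψ]
    simp only [mul_assoc, integral_const_mul]
    rw [integral_splitMul_mul]
    exact ((hb _ (hα j) j).mul (.of_isTestFunction hψ)).integrable

/-- Weak mixed derivatives of order at most two of kernel transforms are square integrable. -/
theorem exists_memLp_sideTransform_mixedPartial
    (h : ∀ j, SLPair (I j) (p j) (q j) (u j) (v j) (c j)) {w : (Fin d → ℝ) → ℝ}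
    (hw : MemLp w 2 (Measure.pi fun j => sideMeasure (I j) (p j) (q j)))
    {α : Fin d → ℕ} (hα : ∀ j, α j ≤ 2) :
    ∃ F, MemLp F 2 (cubeVolume d) ∧ ∀ φ, IsTestFunction (openCube d) φ →
      ∫ x, sideTransform I p q w x * mixedPartial α φ x ∂cubeVolume d
        = (-1) ^ (∑ j, α j) * ∫ x, F x * φ x ∂cubeVolume d := by
  have hfin := fun j => (h j).isFiniteMeasure
  have hn : ∀ j, IsBddMeas fun z : ℝ × ℝ => splitMul
      (fun s t => sideKernelDeriv (p j) (q j) (α j) t s)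
      (sideKernelJump (p j) (q j) (α j)) z.1 z.2 := fun j =>
    isBddMeas_splitMul ((h j).isBddMeas_sideKernelDeriv (hα j)).swap
      (((h j).continuousOn_sideKernelJump (α j)).mono (h j).Icc_subset)
  have hn' := isBddMeas_prod_split hn
  obtain ⟨N, hN⟩ := hn'.2
  -- The input w is read at s and the test function at the split point, so F is the tensor product
  -- of the differentiated one-variable operators applied to w.
  obtain ⟨F, hF, hF'⟩ := exists_transfer (measurePreserving_splitMeasure_fst
    (μ := fun j => sideMeasure (I j) (p j) (q j)))
    (measurePreserving_splitMeasure_splitPoint fun j => (h j).sideMeasure_restrict)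
    (ENNReal.prod_ne_top fun _ _ => by norm_num)
    (splitMeasure_const_ne fun j => (h j).sideMeasure_restrict).1
    (splitMeasure_const_ne fun j => (h j).sideMeasure_restrict).2 hn'.1.aestronglyMeasurable
    (ae_of_all _ hN) hw
  refine ⟨F, hF, fun φ hφ => ?_⟩
  have hwi : Integrable w (Measure.pi fun j => sideMeasure (I j) (p j) (q j)) :=
    hw.integrable (by norm_num)
  have hφb : IsBddMeas φ := .of_isTestFunction hφ
  have hDb : IsBddMeas (mixedPartial α φ) := .of_isTestFunction (hφ.listPartial α _)
  rw [hF' φ hφb.memLp, integral_splitMeasure fun s t => (∏ j, splitMul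
      (fun s t => sideKernelDeriv (p j) (q j) (α j) t s)
      (sideKernelJump (p j) (q j) (α j)) (s j) (t j)) * w s * φ fun j => splitPoint (s j) (t j),
    integral_prod]
  · simp only [sideTransform, ← integral_mul_const]
    rw [integral_integral_swap]
    · rw [← integral_const_mul]
      refine integral_congr_ae (ae_of_all _ fun s => ?_)
      simp only [mul_right_comm _ (w s), integral_mul_const]
      rw [integral_prod_sideKernelDeriv h hα hφ, mul_assoc]
    · have h1 := (IsBddMeas.prod_prodMk fun j => (h j).isBddMeas_sideKernelDeriv (n := 0) (by norm_num)).mul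
        (hDb.comp (measurable_fst (β := Fin d → ℝ)))
      convert h1.integrable_mul (hwi.comp_snd (cubeVolume d)) using 2 with z
      simp only [Function.uncurry]
      ring
  · have h1 := (IsBddMeas.prod_prodMk hn).mul (hφb.comp measurable_splitPoint_pi)
    convert h1.integrable_mul (hwi.comp_fst (Measure.pi fun _ => doubleVolume)) using 2 with z
    ring

end Transform

/-! ### Square densities -/

theorem integral_withDensity_sq {X : Type*} [MeasurableSpace X] {μ : Measure X} {k : X → ℝ}
    (hk : Measurable k) (f : X → ℝ) :
    ∫ x, f x ∂μ.withDensity (fun x => ENNReal.ofReal (k x ^ 2)) = ∫ x, f x * k x ^ 2 ∂μ := by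
  rw [integral_withDensity_eq_integral_toReal_smul (hk.pow_const 2).ennreal_ofReal
    (ae_of_all _ fun _ => ENNReal.ofReal_lt_top)]
  refine integral_congr_ae (ae_of_all _ fun x => ?_)
  simp only [ENNReal.toReal_ofReal (sq_nonneg (k x)), smul_eq_mul, mul_comm]

/-- Multiplication by k is an isometry from L²(k² μ) to L²(μ), invertible on functions because k has
no zeros. -/
theorem memLp_two_withDensity_sq {X : Type*} [MeasurableSpace X] {μ : Measure X} {k : X → ℝ}
    (hk : Measurable k) (hk0 : ∀ x, k x ≠ 0) {f : X → ℝ} :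
    MemLp f 2 (μ.withDensity fun x => ENNReal.ofReal (k x ^ 2)) ↔ MemLp (fun x => f x * k x) 2 μ := by
  have hkm : Measurable fun x => ENNReal.ofReal (k x ^ 2) := (hk.pow_const 2).ennreal_ofReal
  have e : AEStronglyMeasurable f (μ.withDensity fun x => ENNReal.ofReal (k x ^ 2))
      ↔ AEStronglyMeasurable (fun x => f x * k x) μ := by
    constructor
    · intro h
      refine (h.mono_ac (withDensity_absolutelyContinuous' hkm.aemeasurable (ae_of_all _ fun x => ?_))).mul
        hk.aestronglyMeasurable
      simpa [ENNReal.ofReal_eq_zero] using hk0 x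
    · intro h
      refine ((h.mul hk.inv.aestronglyMeasurable).congr (ae_of_all _ fun x => ?_)).mono_ac
        (withDensity_absolutelyContinuous _ _)
      simp [hk0 x]
  have h1 : ∀ {m : Measure X} {g : X → ℝ}, MemLp g 2 m ↔
      AEStronglyMeasurable g m ∧ Integrable (fun x => g x ^ 2) m := fun {m g} =>
    ⟨fun h => ⟨h.1, h.integrable_sq⟩, fun h => (memLp_two_iff_integrable_sq h.1).2 h.2⟩
  rw [h1, h1, e, integrable_withDensity_iff hkm (ae_of_all _ fun _ => ENNReal.ofReal_lt_top)]
  simp only [ENNReal.toReal_ofReal (sq_nonneg (k _)), mul_pow]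

section Box

variable {d : ℕ} {I : Fin d → Set ℝ} {p q u v : Fin d → ℝ → ℝ} {c : Fin d → ℝ}

theorem pi_sideMeasure (h : ∀ j, SLPair (I j) (p j) (q j) (u j) (v j) (c j)) :
    Measure.pi (fun j => sideMeasure (I j) (p j) (q j))
      = (volume.restrict (Set.univ.pi I)).withDensity fun s =>
          ENNReal.ofReal ((∏ j, sideWeight (I j) (p j) (q j) (s j)) ^ 2) := by
  simp only [sideMeasure]
  rw [pi_withDensity_ofReal (fun j => (h j).integrable_sideWeight_sq) fun _ _ => sq_nonneg _,
    volume_pi, Measure.restrict_pi_pi]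
  simp only [Finset.prod_pow]

theorem measurable_prod_sideWeight (h : ∀ j, SLPair (I j) (p j) (q j) (u j) (v j) (c j)) :
    Measurable fun s : Fin d → ℝ => ∏ j, sideWeight (I j) (p j) (q j) (s j) :=
  Finset.measurable_prod _ fun j _ => (h j).measurable_sideWeight.comp (measurable_pi_apply j)

theorem prod_sideWeight_ne_zero (h : ∀ j, SLPair (I j) (p j) (q j) (u j) (v j) (c j)) (s : Fin d → ℝ) :
    ∏ j, sideWeight (I j) (p j) (q j) (s j) ≠ 0 :=
  Finset.prod_ne_zero_iff.2 fun j _ => ((h j).sideWeight_pos _).ne'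

theorem memLp_pi_sideMeasure_iff (h : ∀ j, SLPair (I j) (p j) (q j) (u j) (v j) (c j))
    {f : (Fin d → ℝ) → ℝ} :
    MemLp f 2 (Measure.pi fun j => sideMeasure (I j) (p j) (q j)) ↔
      MemLp (fun s => f s * ∏ j, sideWeight (I j) (p j) (q j) (s j)) 2
        (volume.restrict (Set.univ.pi I)) := by
  rw [pi_sideMeasure h]
  exact memLp_two_withDensity_sq (measurable_prod_sideWeight h) (prod_sideWeight_ne_zero h)

/-- Of the squared weight in the measure, one factor restores the kernel k and the other restores
the unnormalized density. -/
theorem sideTransform_eq (h : ∀ j, SLPair (I j) (p j) (q j) (u j) (v j) (c j))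
    (w : (Fin d → ℝ) → ℝ) {x : Fin d → ℝ} (hx : x ∈ openCube d) :
    sideTransform I p q w x = ∫ s in Set.univ.pi I,
      (∏ j, p j (min (x j) (s j)) * q j (max (x j) (s j))) *
        (w s * ∏ j, sideWeight (I j) (p j) (q j) (s j)) := by
  rw [sideTransform, pi_sideMeasure h, integral_withDensity_sq (measurable_prod_sideWeight h)]
  refine setIntegral_congr_fun (MeasurableSet.univ_pi fun j => (h j).measurableSet) fun s hs => ?_
  have : ∏ j, p j (min (x j) (s j)) * q j (max (x j) (s j))
      = (∏ j, sideKernelDeriv (p j) (q j) 0 (x j) (s j))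
        * ∏ j, sideWeight (I j) (p j) (q j) (s j) := by
    rw [← Finset.prod_mul_distrib]
    exact Finset.prod_congr rfl fun j _ => (h j).kernel_eq (hx j) (hs j trivial)
  simp only [this]
  ring

theorem memLp_sideTransform (h : ∀ j, SLPair (I j) (p j) (q j) (u j) (v j) (c j))
    {w : (Fin d → ℝ) → ℝ} (hw : MemLp w 2 (Measure.pi fun j => sideMeasure (I j) (p j) (q j))) :
    MemLp (sideTransform I p q w) 2 (cubeVolume d) := by
  have hfin := fun j => (h j).isFiniteMeasure
  have hwi : Integrable w (Measure.pi fun j => sideMeasure (I j) (p j) (q j)) :=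
    hw.integrable (by norm_num)
  have hb := IsBddMeas.prod_prodMk fun j => (h j).isBddMeas_sideKernelDeriv (n := 0) (by norm_num)
  obtain ⟨C, hC⟩ := hb.2
  refine MemLp.of_bound (C := ∫ s, C * ‖w s‖ ∂(Measure.pi fun j => sideMeasure (I j) (p j) (q j)))
    ?_ (ae_of_all _ fun x => ?_)
  · exact (hb.integrable_mul (hwi.comp_snd (cubeVolume d))).1.integral_prod_right'
  · refine norm_integral_le_of_norm_le (hwi.norm.const_mul C) (ae_of_all _ fun s => ?_)
    rw [norm_mul]
    exact mul_le_mul_of_nonneg_right (hC (x, s)) (norm_nonneg _)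

end Box

/-! ### The space of dominating mixed smoothness -/

instance instIsFiniteMeasureOpenCube (d : ℕ) : IsFiniteMeasure (volume : Measure (openCube d)) := by
  refine ⟨?_⟩
  have h := congrArg (fun m : Measure (Fin d → ℝ) => m Set.univ)
    ((map_val_volume (measurableSet_openCube d)).trans (volume_restrict_openCube d))
  simp only [Measure.map_apply measurable_subtype_coe MeasurableSet.univ, Set.preimage_univ] at h
  rw [h]
  exact measure_lt_top _ _

/-- Passage from functions on the subtype to functions on ℝ^d with a product measure. Local
integrability comes for free, since the cube has finite volume. -/
theorem mem_mixedSobolev_iff {d m : ℕ} {g : openCube d → ℝ} {G : (Fin d → ℝ) → ℝ}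
    (hG : ∀ x : openCube d, g x = G x) :
    g ∈ mixedSobolev d m ↔ MemLp G 2 (cubeVolume d) ∧ ∀ α : Fin d → ℕ, (∀ j, α j ≤ m) →
      ∃ F, MemLp F 2 (cubeVolume d) ∧ ∀ φ, IsTestFunction (openCube d) φ →
        ∫ x, G x * mixedPartial α φ x ∂cubeVolume d
          = (-1) ^ (∑ j, α j) * ∫ x, F x * φ x ∂cubeVolume d := by
  have hS := measurableSet_openCube d
  have hint : ∀ {f : openCube d → ℝ} {F φ : (Fin d → ℝ) → ℝ}, (∀ x : openCube d, f x = F x) →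
      ∫ x : openCube d, f x * φ x = ∫ x, F x * φ x ∂cubeVolume d := fun {f F φ} hf => by
    rw [← volume_restrict_openCube]
    exact integral_subtype_eq (F := fun x => F x * φ x) hS fun x => by simp only [hf x]
  have hLp : ∀ {f : openCube d → ℝ} {F : (Fin d → ℝ) → ℝ}, (∀ x : openCube d, f x = F x) →
      (MemLp f 2 ↔ MemLp F 2 (cubeVolume d)) := fun {f F} hf => by
    rw [← volume_restrict_openCube]
    exact memLp_subtype_iff hS hf
  have hloc : ∀ {f : openCube d → ℝ}, MemLp f 2 → LocallyIntegrable f := fun hf =>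
    (hf.integrable (by norm_num)).locallyIntegrable
  refine ⟨fun h => ⟨(hLp hG).1 h.1, fun α hα => ?_⟩, fun h => ⟨(hLp hG).2 h.1, fun α hα => ?_⟩⟩
  · obtain ⟨f, hf, -, -, hf'⟩ := h.2 α hα
    have hF : ∀ x : openCube d, f x = Function.extend Subtype.val f 0 (x : Fin d → ℝ) := fun x =>
      (extend_val_of_mem f x.2).symm
    refine ⟨_, (hLp hF).1 hf, fun φ hφ => ?_⟩
    rw [← hint hG, ← hint hF, hf' φ hφ]
  · obtain ⟨F, hF, hF'⟩ := h.2 α hα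
    have hf := (hLp (f := fun x => F x) fun _ => rfl).2 hF
    refine ⟨fun x => F x, hf, hloc ((hLp hG).2 h.1), hloc hf, fun φ hφ => ?_⟩
    rw [hint hG, hint (F := F) fun _ => rfl, hF' φ hφ]

/-! ### Kernel transforms are continuous and of dominating mixed smoothness -/

namespace TensorMarkovKernel

variable {d : ℕ} {T : TensorMarkovKernel d}

theorem box_eq_pi : T.box = Set.univ.pi T.interval := by
  ext x; simp [box]

theorem measurableSet_box : MeasurableSet T.box := by
  rw [box_eq_pi]; exact MeasurableSet.univ_pi fun j => (T.isOpen_interval j).measurableSet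

theorem SturmLiouville.continuous_kernel (hT : T.SturmLiouville) :
    Continuous fun z : T.box × T.box => T.kernel z.1 z.2 := by
  refine continuous_finsetProd _ fun j _ => ?_
  obtain ⟨u, v, c, h⟩ := SturmLiouville.exists_slPair T hT j
  exact (T.continuous_kernel₁ h.left.contDiffOn.continuousOn h.right.contDiffOn.continuousOn).comp
    (g := fun z : T.interval j × T.interval j => T.kernel₁ j z.1 z.2)
    (f := fun z : T.box × T.box => (⟨z.1.1 j, z.1.2 j⟩, ⟨z.2.1 j, z.2.2 j⟩))
    ((((continuous_apply j).comp (continuous_subtype_val.comp continuous_fst)).subtype_mk _).prodMk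
      (((continuous_apply j).comp (continuous_subtype_val.comp continuous_snd)).subtype_mk _))

theorem continuous_of_mem_restrSpaceTwo (hT : T.SturmLiouville) {g : openCube d → ℝ}
    (hg : g ∈ T.restrSpaceTwo) : Continuous g := by
  obtain ⟨h, -, hh⟩ := hg
  have : g = fun x => h (Set.inclusion T.openCube_subset x) := funext fun x => (hh x).symm
  rw [this]
  exact (continuous_coe hT.continuous_kernel h).comp (continuous_inclusion _)

theorem mem_mixedSobolev_of_mem_restrSpaceTwo (hT : T.SturmLiouville) {g : openCube d → ℝ}
    (hg : g ∈ T.restrSpaceTwo) : g ∈ mixedSobolev d 2 := by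
  choose u v c h using SturmLiouville.exists_slPair T hT
  obtain ⟨f, ⟨w, hw, hfw⟩, hfg⟩ := hg
  have hW : ∀ s : T.box, w s = Function.extend Subtype.val w 0 (s : Fin d → ℝ) := fun s =>
    (extend_val_of_mem w s.2).symm
  set W := Function.extend Subtype.val w 0
  -- The density in normalized coordinates: V times the weight is the given L² function, so V is
  -- square integrable for the product of the side measures.
  let V : (Fin d → ℝ) → ℝ := fun s => W s / ∏ j, sideWeight (T.interval j) (T.p j) (T.q j) (s j)
  have hV : ∀ s, V s * ∏ j, sideWeight (T.interval j) (T.p j) (T.q j) (s j) = W s := fun s =>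
    div_mul_cancel₀ _ (prod_sideWeight_ne_zero h s)
  have hVm : MemLp V 2 (Measure.pi fun j => sideMeasure (T.interval j) (T.p j) (T.q j)) := by
    rw [memLp_pi_sideMeasure_iff h]
    simp only [hV]
    rw [← box_eq_pi]
    exact (memLp_subtype_iff measurableSet_box hW).1 hw
  refine (mem_mixedSobolev_iff (G := sideTransform T.interval T.p T.q V) fun x => ?_).2
    ⟨memLp_sideTransform h hVm, fun α hα => exists_memLp_sideTransform_mixedPartial h hVm hα⟩
  rw [← hfg, (hfw _).2, sideTransform_eq h V x.2, ← box_eq_pi]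
  refine integral_subtype_eq measurableSet_box fun s => ?_
  rw [hV, ← hW]
  rfl

end TensorMarkovKernel

/-! ### Inverting the kernel transform in one variable -/

/-- A function on the unit interval together with its first two weak derivatives. -/
structure IsWeakChain (h : Fin 3 → ℝ → ℝ) : Prop where
  integrableOn : ∀ a, IntegrableOn (h a) unitIoo
  integral_mul_iteratedDeriv : ∀ (a : Fin 3) (ψ : ℝ → ℝ), IsTestFunction unitIoo ψ →
    ∫ x in unitIoo, h 0 x * iteratedDeriv a ψ x = (-1) ^ (a : ℕ) * ∫ x in unitIoo, h a x * ψ x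

/-- Integration against `ψ` is a combination of integrations of weak derivatives against `η`. -/
structure Represents (η : Fin 3 → ℝ → ℝ) (ψ : ℝ → ℝ) : Prop where
  isBddMeas : ∀ a, IsBddMeas (η a)
  sum_eq : ∀ h, IsWeakChain h →
    ∑ a, ∫ x in unitIoo, h a x * η a x = ∫ x in unitIoo, h 0 x * ψ x

/-- The trivial representation, using no derivatives; it is the starting point when representations
are exchanged coordinate by coordinate. -/
theorem Represents.single {ψ : ℝ → ℝ} (hψ : IsBddMeas ψ) :
    Represents (fun a => if a = 0 then ψ else 0) ψ := by
  refine ⟨fun a => ?_, fun h _ => ?_⟩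
  · split_ifs
    exacts [hψ, IsBddMeas.const 0]
  · rw [Fin.sum_univ_three]
    simp

/-- Integrals of a test function against the normalized kernel. -/
noncomputable def sidePotential (p q ψ : ℝ → ℝ) (s : ℝ) : ℝ :=
  ∫ x in unitIoo, sideKernelDeriv p q 0 x s * ψ x

/-- The local part of the inverse of the kernel transform. -/
noncomputable def inverseMul (u v : ℝ → ℝ) (c : ℝ) (a : Fin 3) (t : ℝ) : ℝ :=
  c⁻¹ * (![v, fun t => -deriv u t, fun t => -u t] a t)

/-- The boundary part of the inverse of the kernel transform at `0`. -/
noncomputable def inverseLeft (u p : ℝ → ℝ) (c : ℝ) (a : Fin 3) (t : ℝ) : ℝ :=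
  c⁻¹ * (![fun _ => u 0 * deriv p 0, fun t => -(u 0 * (deriv p 0 * (1 - t) + p 0)),
    fun t => u 0 * p 0 * (1 - t)] a t)

/-- The boundary part of the inverse of the kernel transform at `1`. -/
noncomputable def inverseRight (u q : ℝ → ℝ) (c : ℝ) (a : Fin 3) (t : ℝ) : ℝ :=
  c⁻¹ * (![fun _ => -(u 1 * deriv q 1), fun t => u 1 * (q 1 - deriv q 1 * t),
    fun t => u 1 * q 1 * t] a t)

theorem continuous_inverseLeft (u p : ℝ → ℝ) (c : ℝ) (a : Fin 3) :
    Continuous (inverseLeft u p c a) := by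
  unfold inverseLeft
  fin_cases a <;> simp <;> fun_prop

theorem continuous_inverseRight (u p : ℝ → ℝ) (c : ℝ) (a : Fin 3) :
    Continuous (inverseRight u p c a) := by
  unfold inverseRight
  fin_cases a <;> simp <;> fun_prop

namespace SLPair

variable {I : Set ℝ} {p q u v ψ : ℝ → ℝ} {c : ℝ}

theorem continuousOn_inverseMul (h : SLPair I p q u v c) (a : Fin 3) :
    ContinuousOn (inverseMul u v c a) I := by
  refine continuousOn_const.mul ?_
  fin_cases a
  exacts [h.left.v_continuousOn, h.left.continuousOn_deriv_u.neg,
    h.left.u_contDiffOn.continuousOn.neg]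

theorem isBddMeas_sidePotential (h : SLPair I p q u v c) (hψ : IsTestFunction unitIoo ψ) :
    IsBddMeas (sidePotential p q ψ) := by
  have hb := (h.isBddMeas_sideKernelDeriv (n := 0) (by norm_num)).swap (K := sideKernelDeriv p q 0)
  have hb' := hb.mul ((IsBddMeas.of_isTestFunction hψ).comp (measurable_snd (α := ℝ)))
  obtain ⟨C, hC⟩ := hb'.2
  refine ⟨hb'.1.stronglyMeasurable.integral_prod_right'.measurable, C, fun s => ?_⟩
  refine (norm_integral_le_of_norm_le_const (C := C) (ae_of_all _ fun x => hC (s, x))).trans_eq ?_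
  simp

theorem sidePotential_left (_h : SLPair I p q u v c) (ψ : ℝ → ℝ) {s : ℝ} (hs : s < 0) :
    sidePotential p q ψ s = ∫ x in (0:ℝ)..1, q x * ψ x := by
  rw [sidePotential, ← integral_unitIoo_eq]
  refine setIntegral_congr_fun measurableSet_Ioo fun x hx => ?_
  simp only [sideKernelDeriv, sideKernel, hs, if_true,
    cutDeriv_of_mem _ _ (Set.Ioo_subset_Icc_self hx), Function.iterate_zero, id]

theorem sidePotential_right (_h : SLPair I p q u v c) (ψ : ℝ → ℝ) {s : ℝ} (hs : 1 < s) :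
    sidePotential p q ψ s = ∫ x in (0:ℝ)..1, p x * ψ x := by
  rw [sidePotential, ← integral_unitIoo_eq]
  refine setIntegral_congr_fun measurableSet_Ioo fun x hx => ?_
  simp only [sideKernelDeriv, sideKernel, not_lt.2 (zero_le_one.trans hs.le), hs, if_true, if_false,
    cutDeriv_of_mem _ _ (Set.Ioo_subset_Icc_self hx), Function.iterate_zero, id]

theorem sidePotential_mid (h : SLPair I p q u v c) (hψ : Continuous ψ) {s : ℝ}
    (hs : s ∈ Set.Icc (0:ℝ) 1) :
    sidePotential p q ψ s
      = q s * (∫ x in (0:ℝ)..s, p x * ψ x) + p s * ∫ x in s..1, q x * ψ x := by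
  have hIcc : ∀ {x : ℝ}, x ∈ unitIoo → x ∈ Set.Icc (0:ℝ) 1 := fun hx => Set.Ioo_subset_Icc_self hx
  rw [sidePotential, integral_unitIoo_split hs (f := fun x => q s * (p x * ψ x))
      (g := fun x => p s * (q x * ψ x))
      (continuousOn_const.mul ((h.left.contDiffOn.continuousOn.mono h.Icc_subset).mul hψ.continuousOn))
      (continuousOn_const.mul ((h.right.contDiffOn.continuousOn.mono h.Icc_subset).mul hψ.continuousOn))]
  · simp only [intervalIntegral.integral_const_mul]
  · intro x hx hxs
    simp only [sideKernelDeriv, sideKernel, not_lt.2 hs.1, not_lt.2 hs.2, if_false, hxs, if_true,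
      cutDeriv_of_mem _ _ hs, cutDeriv_of_mem _ _ (hIcc hx), Function.iterate_zero, id]
    ring
  · intro x hx hxs
    simp only [sideKernelDeriv, sideKernel, not_lt.2 hs.1, not_lt.2 hs.2, if_false, not_lt.2 hxs,
      cutDeriv_of_mem _ _ hs, cutDeriv_of_mem _ _ (hIcc hx), Function.iterate_zero, id]
    ring

theorem continuous_mul_test {r : ℝ → ℝ} (hr : IsSLSolution I u v r) (hI : Set.Icc 0 1 ⊆ I)
    (hψ : IsTestFunction unitIoo ψ) : Continuous fun x => r x * ψ x := by
  refine (hr.contDiffOn.continuousOn.mul hψ.continuous.continuousOn).continuous_of_tsupport_subset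
    hr.isOpen ?_
  exact (tsupport_mul_subset_right).trans (hψ.2.2.trans (Set.Ioo_subset_Icc_self.trans hI))

/-- Reconstruction of integrals against `ψ` from the potential of `ψ`. -/
theorem integral_eq_sum (h : SLPair I p q u v c) {w : Fin 3 → ℝ → ℝ} (hw : IsWeakChain w)
    (hψ : IsTestFunction unitIoo ψ) :
    ∫ x in unitIoo, w 0 x * ψ x = ∑ a, ∫ x in unitIoo, w a x *
      (inverseMul u v c a x * sidePotential p q ψ x
        + ((∫ y in (0:ℝ)..1, q y * ψ y) * inverseLeft u p c a x
          + (∫ y in (0:ℝ)..1, p y * ψ y) * inverseRight u q c a x)) := by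
  have hp := h.left
  have hq := h.right
  have hI := h.Icc_subset
  have hpψ := continuous_mul_test hp hI hψ
  have hqψ := continuous_mul_test hq hI hψ
  set P : ℝ → ℝ := fun s => ∫ x in (0:ℝ)..s, p x * ψ x with hP
  set Q : ℝ → ℝ := fun s => ∫ x in s..1, q x * ψ x with hQ
  set A : ℝ := ∫ y in (0:ℝ)..1, q y * ψ y
  set B : ℝ := ∫ y in (0:ℝ)..1, p y * ψ y
  have hP' : ∀ x, HasDerivAt P (p x * ψ x) x := fun x =>
    intervalIntegral.integral_hasDerivAt_right (hpψ.intervalIntegrable _ _)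
      hpψ.stronglyMeasurable.stronglyMeasurableAtFilter hpψ.continuousAt
  have hQ' : ∀ x, HasDerivAt Q (-(q x * ψ x)) x := fun x =>
    intervalIntegral.integral_hasDerivAt_left (hqψ.intervalIntegrable _ _)
      hqψ.stronglyMeasurable.stronglyMeasurableAtFilter hqψ.continuousAt
  have hPc : Continuous P := continuous_iff_continuousAt.2 fun x => (hP' x).continuousAt
  have hQc : Continuous Q := continuous_iff_continuousAt.2 fun x => (hQ' x).continuousAt
  -- Variation of constants: Ψ is the potential of ψ on [0,1], and in its derivative Φ the terms
  -- from differentiating P and Q cancel. The Wronskian then yields L[Ψ] = c ψ.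
  let Ψ : ℝ → ℝ := fun s => q s * P s + p s * Q s
  let Φ : ℝ → ℝ := fun s => deriv q s * P s + deriv p s * Q s
  have hΨ : ∀ x ∈ Set.Icc (0:ℝ) 1, HasDerivAt Ψ (Φ x) x := fun x hx => by
    refine (((hq.hasDerivAt (hI hx)).mul (hP' x)).add
      ((hp.hasDerivAt (hI hx)).mul (hQ' x))).congr_deriv ?_
    simp only [Φ]; ring
  have huΦ : ∀ x ∈ Set.Icc (0:ℝ) 1, HasDerivAt (fun s => u s * Φ s) (v x * Ψ x - c * ψ x) x :=
    fun x hx => by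
      have := (((hq.hasDerivAt_mul_deriv x (hI hx)).mul (hP' x)).add
        ((hp.hasDerivAt_mul_deriv x (hI hx)).mul (hQ' x)))
      refine (this.congr_of_eventuallyEq (Filter.Eventually.of_forall fun y => ?_)).congr_deriv ?_
      · simp only [Φ, Pi.add_apply, Pi.mul_apply]; ring
      · rw [← h.wronskian x (hI hx)]; simp only [Ψ]; ring
  have huΨ : ∀ x ∈ Set.Icc (0:ℝ) 1,
      HasDerivAt (fun s => u s * Ψ s) (deriv u x * Ψ x + u x * Φ x) x := fun x hx =>
    (hp.hasDerivAt_u (hI hx)).mul (hΨ x hx)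
  have hpc := hp.contDiffOn.continuousOn.mono hI
  have hqc := hq.contDiffOn.continuousOn.mono hI
  have huc := hp.u_contDiffOn.continuousOn.mono hI
  have hu'c := hp.continuousOn_deriv_u.mono hI
  have hvc := hp.v_continuousOn.mono hI
  have hΨc : ContinuousOn Ψ (Set.Icc 0 1) :=
    (hqc.mul hPc.continuousOn).add (hpc.mul hQc.continuousOn)
  have hΦc : ContinuousOn Φ (Set.Icc 0 1) :=
    ((hq.continuousOn_deriv.mono hI).mul hPc.continuousOn).add
      ((hp.continuousOn_deriv.mono hI).mul hQc.continuousOn)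
  have hint : ∀ a {f : ℝ → ℝ}, ContinuousOn f (Set.Icc 0 1) →
      IntegrableOn (fun x => w a x * f x) unitIoo := fun a f hf => by
    have hi := hw.integrableOn a
    obtain ⟨C, hC⟩ := isCompact_Icc.exists_bound_of_continuousOn hf
    refine Integrable.mul_bdd (c := C) hi ?_ ?_
    · exact (hf.mono Set.Ioo_subset_Icc_self).aestronglyMeasurable measurableSet_Ioo
    · filter_upwards [ae_restrict_mem measurableSet_Ioo] with x hx
      exact hC x (Set.Ioo_subset_Icc_self hx)
  have hw1 : ∀ φ, IsTestFunction unitIoo φ →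
      ∫ x in unitIoo, w 0 x * deriv φ x = -∫ x in unitIoo, w 1 x * φ x := fun φ hφ => by
    simpa using hw.integral_mul_iteratedDeriv 1 φ hφ
  have hw2 : ∀ φ, IsTestFunction unitIoo φ →
      ∫ x in unitIoo, w 1 x * deriv φ x = -∫ x in unitIoo, w 2 x * φ x := fun φ hφ => by
    have h1 := hw1 _ hφ.deriv
    have h2 := hw.integral_mul_iteratedDeriv 2 φ hφ
    simp only [Fin.val_two, iteratedDeriv_succ, iteratedDeriv_zero] at h2
    rw [h2] at h1
    norm_num at h1
    linarith
  obtain ⟨H0, H1, hH⟩ := exists_boundary_values (hw.integrableOn 0) (hw.integrableOn 1) hw1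
  obtain ⟨K0, K1, hK⟩ := exists_boundary_values (hw.integrableOn 1) (hw.integrableOn 2) hw2
  -- Two integrations by parts, with X = u Φ against the pair (w 0, w 1) and X = u Ψ against (w 1, w
  -- 2). Their difference eliminates the integral of w 1 · u Φ.
  have e1 := hH _ _ huΦ ((hvc.mul hΨc).sub (continuousOn_const.mul hψ.continuous.continuousOn))
  have e2 := hK _ _ huΨ ((hu'c.mul hΨc).add (huc.mul hΦc))
  have hid : ∀ x ∈ Set.Icc (0:ℝ) 1, HasDerivAt (fun t : ℝ => t) 1 x := fun x _ => hasDerivAt_id' x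
  have hid' : ∀ x ∈ Set.Icc (0:ℝ) 1, HasDerivAt (fun t : ℝ => 1 - t) (-1) x := fun x _ =>
    (hasDerivAt_id' x).const_sub 1
  -- The choices X = t and X = 1 - t isolate the boundary values at 1 and 0: h(1) = ∫ (h + t h') and
  -- h(0) = ∫ (h - (1 - t) h'), and likewise for h'. They are the source of the coefficients in
  -- `inverseLeft` and `inverseRight`.
  have e3 := hH _ (fun _ => 1) hid continuousOn_const
  have e4 := hH _ (fun _ => -1) hid' continuousOn_const
  have e5 := hK _ (fun _ => 1) hid continuousOn_const
  have e6 := hK _ (fun _ => -1) hid' continuousOn_const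
  -- At 0 only Q contributes and at 1 only P, so the boundary data of Ψ depend on ψ only through A
  -- and B.
  have z0 : Ψ 0 = p 0 * A ∧ Φ 0 = deriv p 0 * A := by simp [Ψ, Φ, hP, hQ, A]
  have z1 : Ψ 1 = q 1 * B ∧ Φ 1 = deriv q 1 * B := by simp [Ψ, Φ, hP, hQ, B]
  have hc := h.ne_zero
  have key : ∀ a, ∫ x in unitIoo, w a x * (inverseMul u v c a x * sidePotential p q ψ x
        + (A * inverseLeft u p c a x + B * inverseRight u q c a x))
      = (∫ x in unitIoo, w a x * (inverseMul u v c a x * Ψ x))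
        + (A * (∫ x in unitIoo, w a x * inverseLeft u p c a x)
          + B * ∫ x in unitIoo, w a x * inverseRight u q c a x) := fun a => by
    rw [← integral_const_mul, ← integral_const_mul, ← integral_add, ← integral_add]
    · refine setIntegral_congr_fun measurableSet_Ioo fun x hx => ?_
      simp only [h.sidePotential_mid hψ.continuous (Set.Ioo_subset_Icc_self hx), Ψ, P, Q]
      ring
    · exact hint a (((h.continuousOn_inverseMul a).mono hI).mul hΨc)
    · exact ((hint a (continuous_inverseLeft u p c a).continuousOn).const_mul A).add
        ((hint a (continuous_inverseRight u q c a).continuousOn).const_mul B)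
    · exact (hint a (continuous_inverseLeft u p c a).continuousOn).const_mul A
    · exact (hint a (continuous_inverseRight u q c a).continuousOn).const_mul B
  simp only [key, Fin.sum_univ_three]
  simp only [inverseMul, inverseLeft, inverseRight, Matrix.cons_val]
  have add : ∀ a {f g : ℝ → ℝ}, ContinuousOn f (Set.Icc 0 1) → ContinuousOn g (Set.Icc 0 1) →
      ∫ x in unitIoo, w a x * (f x + g x)
        = (∫ x in unitIoo, w a x * f x) + ∫ x in unitIoo, w a x * g x := fun a f g hf hg => by
    rw [← integral_add (f := fun x => w a x * f x) (g := fun x => w a x * g x) (hint a hf) (hint a hg)]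
    simp only [mul_add]
  have mul : ∀ a (r : ℝ) (f : ℝ → ℝ),
      ∫ x in unitIoo, w a x * (r * f x) = r * ∫ x in unitIoo, w a x * f x := fun a r f => by
    rw [← integral_const_mul]
    simp only [mul_left_comm]
  have lin : ∀ a (r s : ℝ), ∫ x in unitIoo, w a x * (r + s * x)
      = r * (∫ x in unitIoo, w a x) + s * ∫ x in unitIoo, w a x * x := fun a r s => by
    rw [add a (f := fun _ => r) (g := fun x => s * x) continuousOn_const (by fun_prop), mul a s,
      integral_mul_const, mul_comm r]
  have j1 : ∫ x in unitIoo, w 0 x * (v x * Ψ x - c * ψ x)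
      = (∫ x in unitIoo, w 0 x * (v x * Ψ x)) - c * ∫ x in unitIoo, w 0 x * ψ x := by
    have := add 0 (hvc.mul hΨc) (g := fun x => (-c) * ψ x)
      (continuousOn_const.mul hψ.continuous.continuousOn)
    rw [mul] at this
    simp only [sub_eq_add_neg, ← neg_mul]
    exact this
  have j2 := add 1 (f := fun x => deriv u x * Ψ x) (g := fun x => u x * Φ x) (hu'c.mul hΨc)
    (huc.mul hΦc)
  have k0 : ∫ x in unitIoo, w 0 x * (c⁻¹ * v x * Ψ x) = c⁻¹ * ∫ x in unitIoo, w 0 x * (v x * Ψ x) := by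
    simp only [mul_assoc, mul]
  have k1 : ∫ x in unitIoo, w 1 x * (c⁻¹ * -deriv u x * Ψ x)
      = -c⁻¹ * ∫ x in unitIoo, w 1 x * (deriv u x * Ψ x) := by
    rw [← mul]; congr 1; ext x; ring
  have k2 : ∫ x in unitIoo, w 2 x * (c⁻¹ * -u x * Ψ x) = -c⁻¹ * ∫ x in unitIoo, w 2 x * (u x * Ψ x) := by
    rw [← mul]; congr 1; ext x; ring
  have l0 : ∀ r, ∫ x in unitIoo, w 0 x * r = r * ∫ x in unitIoo, w 0 x := fun r => by
    rw [integral_mul_const, mul_comm]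
  have l1 : ∫ x in unitIoo, w 1 x * (c⁻¹ * -(u 0 * (deriv p 0 * (1 - x) + p 0)))
      = -c⁻¹ * u 0 * (deriv p 0 + p 0) * (∫ x in unitIoo, w 1 x)
        + c⁻¹ * u 0 * deriv p 0 * ∫ x in unitIoo, w 1 x * x := by
    rw [← lin]; congr 1; ext x; ring
  have l2 : ∫ x in unitIoo, w 2 x * (c⁻¹ * (u 0 * p 0 * (1 - x)))
      = c⁻¹ * u 0 * p 0 * (∫ x in unitIoo, w 2 x) + -c⁻¹ * u 0 * p 0 * ∫ x in unitIoo, w 2 x * x := by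
    rw [← lin]; congr 1; ext x; ring
  have r1 : ∫ x in unitIoo, w 1 x * (c⁻¹ * (u 1 * (q 1 - deriv q 1 * x)))
      = c⁻¹ * u 1 * q 1 * (∫ x in unitIoo, w 1 x)
        + -c⁻¹ * u 1 * deriv q 1 * ∫ x in unitIoo, w 1 x * x := by
    rw [← lin]; congr 1; ext x; ring
  have r2 : ∫ x in unitIoo, w 2 x * (c⁻¹ * (u 1 * q 1 * x))
      = c⁻¹ * u 1 * q 1 * ∫ x in unitIoo, w 2 x * x := by
    rw [← mul]; congr 1; ext x; ring
  have t1 : ∀ a, ∫ x in unitIoo, w a x * (1 - x)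
      = 1 * (∫ x in unitIoo, w a x) + (-1) * ∫ x in unitIoo, w a x * x := fun a => by
    rw [← lin]; congr 1; ext x; ring
  rw [k0, k1, k2, l0, l0, l1, l2, r1, r2]
  rw [j1, z0.2, z1.2] at e1
  rw [j2, z0.1, z1.1] at e2
  rw [t1] at e4 e6
  simp only [mul_one, mul_neg, integral_neg, mul_zero, sub_zero, sub_self, zero_sub] at e3 e4 e5 e6
  obtain rfl : H1 = _ := e3.symm
  obtain rfl : K1 = _ := e5.symm
  have e4' : H0 = (∫ x in unitIoo, w 0 x) - (∫ x in unitIoo, w 1 x)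
      + ∫ x in unitIoo, w 1 x * x := by linarith
  have e6' : K0 = (∫ x in unitIoo, w 1 x) - (∫ x in unitIoo, w 2 x)
      + ∫ x in unitIoo, w 2 x * x := by linarith
  subst e4' e6'
  linear_combination c⁻¹ * (e2 - e1) - (∫ x in unitIoo, w 0 x * ψ x) * mul_inv_cancel₀ hc

end SLPair

theorem IsBddMeas.integral_right {X Y : Type*} [MeasurableSpace X] [MeasurableSpace Y]
    {K : X → Y → ℝ} (hK : IsBddMeas fun z : X × Y => K z.1 z.2) (μ : Measure Y)
    [IsFiniteMeasure μ] : IsBddMeas fun x => ∫ y, K x y ∂μ := by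
  obtain ⟨C, hC⟩ := hK.2
  exact ⟨hK.1.stronglyMeasurable.integral_prod_right'.measurable, C * μ.real Set.univ, fun x =>
    norm_integral_le_of_norm_le_const (ae_of_all _ fun y => hC (x, y))⟩

/-- By Fubini, this is the adjoint of the splitting operator applied to Ψ: K is integrated over its
first variable, and the multiplier stays in place since μ is Lebesgue measure on the unit interval.
-/
theorem integral_splitMul_prod {μ : Measure ℝ} [IsFiniteMeasure μ]
    (hμ : μ.restrict unitIoo = unitVolume) {K : ℝ → ℝ → ℝ} {m Ψ φ : ℝ → ℝ}
    (hK : IsBddMeas fun z : ℝ × ℝ => K z.1 z.2) (hm : ContinuousOn m (Set.Icc 0 1))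
    (hΨ : IsBddMeas Ψ) (hφ : IsBddMeas φ) :
    ∫ z, splitMul K m z.1 z.2 * Ψ z.1 * φ (splitPoint z.1 z.2) ∂μ.prod doubleVolume
      = ∫ x, ((∫ s, K s x * Ψ s ∂μ) + unitIoo.indicator m x * Ψ x) * φ x ∂unitVolume := by
  have hm' := IsBddMeas.indicator_of_continuousOn hm measurableSet_Ioo Set.Ioo_subset_Icc_self
  have hKΨφ : IsBddMeas fun z : ℝ × ℝ => K z.1 z.2 * Ψ z.1 * φ z.2 :=
    (hK.mul (hΨ.comp measurable_fst)).mul (hφ.comp measurable_snd)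
  have hKΨ : IsBddMeas fun z : ℝ × ℝ => K z.1 z.2 * Ψ z.1 := hK.mul (hΨ.comp measurable_fst)
  have hKφ : ∀ s, IsBddMeas fun t => K s t * φ t := fun s => (hK.section_right s).mul hφ
  rw [integral_prod _ (((isBddMeas_splitMul hK hm).mul (hΨ.comp measurable_fst)).mul
    (hφ.comp measurable_splitPoint)).integrable]
  have e1 : ∀ s, ∫ t, splitMul K m s t * Ψ s * φ (splitPoint s t) ∂doubleVolume
      = (∫ t, K s t * Ψ s * φ t ∂unitVolume) + unitIoo.indicator m s * Ψ s * φ s := fun s => by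
    simp only [mul_right_comm _ (Ψ s), integral_mul_const]
    rw [integral_splitMul_mul (hKφ s).integrable]
    ring
  have e2 : ∫ s, unitIoo.indicator m s * Ψ s * φ s ∂μ
      = ∫ s, unitIoo.indicator m s * Ψ s * φ s ∂unitVolume := by
    rw [← hμ, ← integral_indicator measurableSet_Ioo]
    refine integral_congr_ae (ae_of_all _ fun s => ?_)
    by_cases hs : s ∈ unitIoo <;> simp [hs]
  simp only [e1]
  rw [integral_add (hKΨφ.integral_right unitVolume).integrable ((hm'.mul hΨ).mul hφ).integrable, e2,
    integral_integral_swap hKΨφ.integrable]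
  simp only [add_mul, integral_mul_const]
  rw [integral_add]
  · exact ((hKΨ.swap (K := fun s t => K s t * Ψ s)).integral_right μ).mul hφ |>.integrable
  · exact ((hm'.mul hΨ).mul hφ).integrable

/-! ### The inverse operator, with boundary terms carried outside the unit interval -/

namespace SLPair

variable {I : Set ℝ} {p q u v : ℝ → ℝ} {c : ℝ}

theorem sideMeasure_real_ne_zero (h : SLPair I p q u v c) {a b : ℝ} (hab : a < b)
    (hI : Set.Ioo a b ⊆ I) : (sideMeasure I p q).real (Set.Ioo a b) ≠ 0 := by
  have := h.isFiniteMeasure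
  rw [Measure.real, ENNReal.toReal_ne_zero]
  refine ⟨fun h0 => ?_, measure_ne_top _ _⟩
  have hac : volume.restrict I ≪ sideMeasure I p q := withDensity_absolutelyContinuous'
    (h.measurable_sideWeight.pow_const 2).ennreal_ofReal.aemeasurable
    (ae_of_all _ fun s => by simpa [ENNReal.ofReal_eq_zero] using (h.sideWeight_pos s).ne')
  have h1 := hac h0
  rw [Measure.restrict_apply measurableSet_Ioo, Set.inter_eq_self_of_subset_left hI,
    Real.volume_Ioo, ENNReal.ofReal_eq_zero] at h1
  linarith

theorem exists_Icc_subset (h : SLPair I p q u v c) : ∃ δ > 0, Set.Icc (-δ) (1 + δ) ⊆ I := by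
  have h0 := h.left.isOpen.mem_nhds (h.Icc_subset (Set.left_mem_Icc.2 zero_le_one))
  have h1 := h.left.isOpen.mem_nhds (h.Icc_subset (Set.right_mem_Icc.2 zero_le_one))
  obtain ⟨ε, hε, hε'⟩ := Metric.mem_nhds_iff.1 h0
  obtain ⟨ρ, hρ, hρ'⟩ := Metric.mem_nhds_iff.1 h1
  refine ⟨min ε ρ / 2, half_pos (lt_min hε hρ), ?_⟩
  have hl : min ε ρ / 2 < min ε ρ := half_lt_self (lt_min hε hρ)
  have hpos := half_pos (lt_min hε hρ)
  have m1 := min_le_left ε ρ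
  have m2 := min_le_right ε ρ
  have := h.ordConnected
  refine Set.Icc_subset I (hε' ?_) (hρ' ?_)
  · rw [Metric.mem_ball, Real.dist_eq, abs_lt]; constructor <;> linarith
  · rw [Metric.mem_ball, Real.dist_eq, abs_lt]; constructor <;> linarith

/-- The operator whose adjoint reconstructs integrals against test functions from potentials. -/
theorem exists_inverse (h : SLPair I p q u v c) :
    ∃ (J : Set ℝ) (N : Fin 3 → ℝ → ℝ → ℝ), IsCompact J ∧ J ⊆ I ∧
      (∀ a, IsBddMeas fun z : ℝ × ℝ => N a z.1 z.2) ∧ (∀ a s t, s ∉ J → N a s t = 0) ∧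
      ∀ ψ, IsTestFunction unitIoo ψ → ∃ η, Represents η ψ ∧ ∀ a φ, IsBddMeas φ →
        ∫ z, N a z.1 z.2 * sidePotential p q ψ z.1 * φ (splitPoint z.1 z.2)
          ∂(sideMeasure I p q).prod doubleVolume = ∫ x, η a x * φ x ∂unitVolume := by
  have hfin := h.isFiniteMeasure
  obtain ⟨δ, hδ, hδI⟩ := h.exists_Icc_subset
  set μ := sideMeasure I p q with hμ
  have sub1 : Set.Ioo (-δ) 0 ⊆ Set.Icc (-δ) (1 + δ) := fun x hx => ⟨hx.1.le, by linarith [hx.2]⟩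
  have sub2 : Set.Ioo 1 (1 + δ) ⊆ Set.Icc (-δ) (1 + δ) := fun x hx => ⟨by linarith [hx.1], hx.2.le⟩
  have n1 := h.sideMeasure_real_ne_zero (show -δ < 0 by linarith) (sub1.trans hδI)
  have n2 := h.sideMeasure_real_ne_zero (show 1 < 1 + δ by linarith) (sub2.trans hδI)
  -- The boundary coefficients are spread evenly over (-δ, 0) and (1, 1 + δ), with total mass
  -- normalized to one. On these sets the potential of ψ is constantly ∫ q ψ and ∫ p ψ, so averaging
  -- it there recovers the numbers A and B of `integral_eq_sum`.
  let K : Fin 3 → ℝ → ℝ → ℝ := fun a s t =>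
    (Set.Ioo (-δ) 0).indicator (fun _ => (μ.real (Set.Ioo (-δ) 0))⁻¹) s
        * (Set.Icc 0 1).indicator (inverseLeft u p c a) t
      + (Set.Ioo 1 (1 + δ)).indicator (fun _ => (μ.real (Set.Ioo 1 (1 + δ)))⁻¹) s
        * (Set.Icc 0 1).indicator (inverseRight u q c a) t
  have hK : ∀ a, IsBddMeas fun z : ℝ × ℝ => K a z.1 z.2 := fun a =>
    ((((IsBddMeas.const _).indicator measurableSet_Ioo).comp measurable_fst).mul
      ((IsBddMeas.indicator_of_continuousOn (continuous_inverseLeft u p c a).continuousOn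
        measurableSet_Icc subset_rfl).comp measurable_snd)).add
    ((((IsBddMeas.const _).indicator measurableSet_Ioo).comp measurable_fst).mul
      ((IsBddMeas.indicator_of_continuousOn (continuous_inverseRight u q c a).continuousOn
        measurableSet_Icc subset_rfl).comp measurable_snd))
  have hm : ∀ a, ContinuousOn (inverseMul u v c a) (Set.Icc 0 1) := fun a =>
    (h.continuousOn_inverseMul a).mono h.Icc_subset
  refine ⟨Set.Icc (-δ) (1 + δ), fun a => splitMul (K a) (inverseMul u v c a), isCompact_Icc, hδI,
    fun a => isBddMeas_splitMul (hK a) (hm a), fun a s t hs => ?_, fun ψ hψ => ?_⟩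
  · have s1 : s ∉ Set.Ioo (-δ) 0 := fun hs' => hs (sub1 hs')
    have s2 : s ∉ Set.Ioo 1 (1 + δ) := fun hs' => hs (sub2 hs')
    have s3 : s ∉ unitIoo := fun hs' => hs ⟨by linarith [hs'.1], by linarith [hs'.2]⟩
    simp only [splitMul, K, Set.indicator_of_notMem s1, Set.indicator_of_notMem s2,
      Set.indicator_of_notMem s3, zero_mul, add_zero, ite_self]
  have hΨ := h.isBddMeas_sidePotential hψ
  have hKΨ : ∀ a, IsBddMeas fun z : ℝ × ℝ => K a z.1 z.2 * sidePotential p q ψ z.1 := fun a =>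
    (hK a).mul (hΨ.comp measurable_fst)
  refine ⟨fun a x => (∫ s, K a s x * sidePotential p q ψ s ∂μ)
    + unitIoo.indicator (inverseMul u v c a) x * sidePotential p q ψ x, ⟨fun a => ?_, fun w hw => ?_⟩,
    fun a φ hφ => integral_splitMul_prod h.sideMeasure_restrict (hK a) (hm a) hΨ hφ⟩
  · exact (((hKΨ a).swap (K := fun s t => K a s t * sidePotential p q ψ s)).integral_right μ).add
      ((IsBddMeas.indicator_of_continuousOn (hm a) measurableSet_Ioo Set.Ioo_subset_Icc_self).mul hΨ)
  rw [h.integral_eq_sum hw hψ]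
  refine Finset.sum_congr rfl fun a _ => setIntegral_congr_fun measurableSet_Ioo fun x hx => ?_
  have hx' : x ∈ Set.Icc (0:ℝ) 1 := Set.Ioo_subset_Icc_self hx
  have e : ∀ s, K a s x * sidePotential p q ψ s
      = (Set.Ioo (-δ) 0).indicator (fun _ => (μ.real (Set.Ioo (-δ) 0))⁻¹
          * (inverseLeft u p c a x * ∫ y in (0:ℝ)..1, q y * ψ y)) s
        + (Set.Ioo 1 (1 + δ)).indicator (fun _ => (μ.real (Set.Ioo 1 (1 + δ)))⁻¹
          * (inverseRight u q c a x * ∫ y in (0:ℝ)..1, p y * ψ y)) s := fun s => by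
    simp only [K, Set.indicator_of_mem hx']
    by_cases s1 : s ∈ Set.Ioo (-δ) 0
    · have s2 : s ∉ Set.Ioo 1 (1 + δ) := fun s2 => by linarith [s1.2, s2.1]
      simp only [Set.indicator_of_mem s1, Set.indicator_of_notMem s2, h.sidePotential_left ψ s1.2]
      ring
    by_cases s2 : s ∈ Set.Ioo 1 (1 + δ)
    · simp only [Set.indicator_of_mem s2, Set.indicator_of_notMem s1, h.sidePotential_right ψ s2.1]
      ring
    · simp only [Set.indicator_of_notMem s2, Set.indicator_of_notMem s1]
      ring
  simp only [e, Set.indicator_of_mem hx]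
  rw [integral_add ((integrable_const _).indicator measurableSet_Ioo)
    ((integrable_const _).indicator measurableSet_Ioo), integral_indicator_const _ measurableSet_Ioo,
    integral_indicator_const _ measurableSet_Ioo, smul_eq_mul, smul_eq_mul,
    mul_inv_cancel_left₀ n1, mul_inv_cancel_left₀ n2]
  ring

end SLPair

/-! ### Tensor products of representations -/

/-- The functions `f α` are the weak partial derivatives of `g`, tested against products. -/
structure IsTensorWeakFamily {d : ℕ} (g : (Fin d → ℝ) → ℝ)
    (f : (Fin d → Fin 3) → (Fin d → ℝ) → ℝ) : Prop where
  integrable : ∀ α, Integrable (f α) (cubeVolume d)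
  integral_mul_prod : ∀ (α : Fin d → Fin 3) (ψ : Fin d → ℝ → ℝ),
    (∀ j, IsTestFunction unitIoo (ψ j)) →
      ∫ x, g x * ∏ j, iteratedDeriv (α j) (ψ j) (x j) ∂cubeVolume d
        = (-1) ^ (∑ j, (α j : ℕ)) * ∫ x, f α x * ∏ j, ψ j (x j) ∂cubeVolume d

namespace IsTensorWeakFamily

variable {n : ℕ}

section Slice

variable {g : (Fin (n + 1) → ℝ) → ℝ} {f : (Fin (n + 1) → Fin 3) → (Fin (n + 1) → ℝ) → ℝ}

theorem integrable_slice (hf : IsTensorWeakFamily g f) (i : Fin (n + 1)) (α : Fin (n + 1) → Fin 3)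
    {φ : ℝ → ℝ} (hφ : IsBddMeas φ) {Y : (Fin n → ℝ) → ℝ} (hY : IsBddMeas Y) :
    Integrable (fun z : ℝ × (Fin n → ℝ) => f α (i.insertNth z.1 z.2) * (φ z.1 * Y z.2))
      (unitVolume.prod (cubeVolume n)) := by
  have h1 := (integrable_pi_iff_insertNth i).1 (hf.integrable α)
  simp only [mul_comm (f α _)]
  exact ((hφ.comp measurable_fst).mul (hY.comp measurable_snd)).integrable_mul h1

theorem integral_slice_prod (f : (Fin (n + 1) → ℝ) → ℝ) (i : Fin (n + 1)) (ψ : Fin (n + 1) → ℝ → ℝ) :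
    ∫ x, f x * ∏ j, ψ j (x j) ∂cubeVolume (n + 1)
      = ∫ z : ℝ × (Fin n → ℝ), f (i.insertNth z.1 z.2) *
          (ψ i z.1 * ∏ j, ψ (i.succAbove j) (z.2 j)) ∂unitVolume.prod (cubeVolume n) := by
  rw [integral_pi_insertNth i]
  simp only [Fin.prod_univ_succAbove _ i, Fin.insertNth_apply_same, Fin.insertNth_apply_succAbove]

/-- The defining relations only concern products of test functions. Both sides, as functionals of Y,
are integrals of Y against integrable functions of the remaining variables; these agree against
products of test functions, hence a.e., so any bounded Y is allowed. -/
theorem integral_slice_mul_iteratedDeriv (hf : IsTensorWeakFamily g f) (i : Fin (n + 1))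
    (α : Fin n → Fin 3) (a : Fin 3) {ψ : ℝ → ℝ} (hψ : IsTestFunction unitIoo ψ)
    {Y : (Fin n → ℝ) → ℝ} (hY : IsBddMeas Y) :
    ∫ z : ℝ × (Fin n → ℝ), f (i.insertNth 0 α) (i.insertNth z.1 z.2) *
        (iteratedDeriv a ψ z.1 * Y z.2) ∂unitVolume.prod (cubeVolume n)
      = (-1) ^ (a : ℕ) * ∫ z : ℝ × (Fin n → ℝ), f (i.insertNth a α) (i.insertNth z.1 z.2) *
        (ψ z.1 * Y z.2) ∂unitVolume.prod (cubeVolume n) := by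
  have hψb : IsBddMeas ψ := .of_isTestFunction hψ
  have hψb' : IsBddMeas (iteratedDeriv a ψ) := .of_isTestFunction (hψ.iteratedDeriv a)
  let G : ℝ × (Fin n → ℝ) → ℝ := fun z =>
    f (i.insertNth 0 α) (i.insertNth z.1 z.2) * (iteratedDeriv a ψ z.1 * 1)
      - (-1) ^ (a : ℕ) * (f (i.insertNth a α) (i.insertNth z.1 z.2) * (ψ z.1 * 1))
  have hG : Integrable G (unitVolume.prod (cubeVolume n)) :=
    (hf.integrable_slice i _ hψb' (.const 1)).sub ((hf.integrable_slice i _ hψb (.const 1)).const_mul _)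
  have hGY : ∀ {Z : (Fin n → ℝ) → ℝ}, IsBddMeas Z →
      ∫ y, (∫ x, G (x, y) ∂unitVolume) * Z y ∂cubeVolume n
        = (∫ z : ℝ × (Fin n → ℝ), f (i.insertNth 0 α) (i.insertNth z.1 z.2) *
            (iteratedDeriv a ψ z.1 * Z z.2) ∂unitVolume.prod (cubeVolume n))
          - (-1) ^ (a : ℕ) * ∫ z : ℝ × (Fin n → ℝ), f (i.insertNth a α) (i.insertNth z.1 z.2) *
            (ψ z.1 * Z z.2) ∂unitVolume.prod (cubeVolume n) := fun {Z} hZ => by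
    have e : ∀ z : ℝ × (Fin n → ℝ), G z * Z z.2
        = f (i.insertNth 0 α) (i.insertNth z.1 z.2) * (iteratedDeriv a ψ z.1 * Z z.2)
          - (-1) ^ (a : ℕ) * (f (i.insertNth a α) (i.insertNth z.1 z.2) * (ψ z.1 * Z z.2)) :=
      fun z => by simp only [G]; ring
    have hI := (hf.integrable_slice i (i.insertNth 0 α) hψb' hZ).sub
      ((hf.integrable_slice i (i.insertNth a α) hψb hZ).const_mul ((-1) ^ (a : ℕ)))
    rw [← integral_const_mul, ← integral_sub (hf.integrable_slice i (i.insertNth 0 α) hψb' hZ)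
      ((hf.integrable_slice i (i.insertNth a α) hψb hZ).const_mul ((-1) ^ (a : ℕ)))]
    simp only [← integral_mul_const]
    simp only [← e]
    rw [integral_prod_symm]
    exact hI.congr (ae_of_all _ fun z => (e z).symm)
  have hz : (fun y => ∫ x, G (x, y) ∂unitVolume) =ᵐ[cubeVolume n] 0 := by
    refine ae_eq_zero_of_integral_mul_prod_test hG.integral_prod_right fun η hη => ?_
    rw [hGY (IsBddMeas.finset_prod fun j =>
      (IsBddMeas.of_isTestFunction (hη j)).comp (measurable_pi_apply j)), sub_eq_zero]
    have t1 : ∀ {φ : ℝ → ℝ}, IsTestFunction unitIoo φ →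
        ∀ j, IsTestFunction unitIoo (i.insertNth (α := fun _ => ℝ → ℝ) φ η j) := fun {φ} hφ j => by
      rcases Fin.eq_self_or_eq_succAbove i j with rfl | ⟨j, rfl⟩
      · simpa using hφ
      · simpa using hη j
    have e1 := hf.integral_mul_prod (i.insertNth 0 α) _ (t1 (hψ.iteratedDeriv a))
    have e2 := hf.integral_mul_prod (i.insertNth a α) _ (t1 hψ)
    rw [integral_slice_prod _ i] at e1 e2
    rw [integral_slice_prod _ i] at e1 e2
    simp only [Fin.sum_univ_succAbove _ i, Fin.insertNth_apply_same, Fin.insertNth_apply_succAbove,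
      Fin.val_zero, iteratedDeriv_zero, zero_add] at e1 e2
    rw [e1, pow_add, mul_assoc, mul_left_comm] at e2
    exact mul_left_cancel₀ (pow_ne_zero _ (by norm_num)) e2
  have h0 := hGY hY
  rw [integral_eq_zero_of_ae (by filter_upwards [hz] with y hy; simp [hy])] at h0
  exact (sub_eq_zero.1 h0.symm)

/-- Integrating out all other variables against a bounded Y leaves a one-variable function with its
two weak derivatives, to which `Represents` applies. -/
theorem isWeakChain_slice (hf : IsTensorWeakFamily g f) (i : Fin (n + 1)) (α : Fin n → Fin 3)
    {Y : (Fin n → ℝ) → ℝ} (hY : IsBddMeas Y) :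
    IsWeakChain fun a x => ∫ y, f (i.insertNth a α) (i.insertNth x y) * Y y ∂cubeVolume n := by
  have hint := fun a {φ} (hφ : IsBddMeas φ) => hf.integrable_slice i (i.insertNth a α) hφ hY
  have e : ∀ a {φ : ℝ → ℝ}, IsBddMeas φ →
      ∫ x, (∫ y, f (i.insertNth a α) (i.insertNth x y) * Y y ∂cubeVolume n) * φ x ∂unitVolume
        = ∫ z : ℝ × (Fin n → ℝ), f (i.insertNth a α) (i.insertNth z.1 z.2) *
          (φ z.1 * Y z.2) ∂unitVolume.prod (cubeVolume n) := fun a φ hφ => by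
    rw [integral_prod _ (hint a hφ)]
    simp only [← integral_mul_const, mul_assoc, mul_comm (Y _)]
  refine ⟨fun a => ?_, fun a ψ hψ => ?_⟩
  · have h1 := (hint a (.const 1)).integral_prod_left
    simp only [one_mul] at h1
    exact h1
  · rw [e 0 (.of_isTestFunction (hψ.iteratedDeriv a)), e a (.of_isTestFunction hψ),
      hf.integral_slice_mul_iteratedDeriv i α a hψ hY]

theorem sum_slice_eq (hf : IsTensorWeakFamily g f) (i : Fin (n + 1)) (α : Fin n → Fin 3)
    {Y : (Fin n → ℝ) → ℝ} (hY : IsBddMeas Y) {η : Fin 3 → ℝ → ℝ} {ψ : ℝ → ℝ} (hη : Represents η ψ) :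
    ∑ a, ∫ z : ℝ × (Fin n → ℝ), f (i.insertNth a α) (i.insertNth z.1 z.2) *
        (η a z.1 * Y z.2) ∂unitVolume.prod (cubeVolume n)
      = ∫ x, (∫ y, f (i.insertNth 0 α) (i.insertNth x y) * Y y ∂cubeVolume n) * ψ x ∂unitVolume := by
  rw [← hη.sum_eq _ (hf.isWeakChain_slice i α hY)]
  refine Finset.sum_congr rfl fun a _ => ?_
  rw [integral_prod _ (hf.integrable_slice i (i.insertNth a α) (hη.isBddMeas a) hY)]
  simp only [← integral_mul_const, mul_assoc, mul_comm (Y _)]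

end Slice

variable {d : ℕ} {g : (Fin d → ℝ) → ℝ} {f : (Fin d → Fin 3) → (Fin d → ℝ) → ℝ}

/-- With the other indices and factors fixed, the sum over the index of coordinate i depends on the
representation only through ψ. Hence one representation of ψ may be exchanged for another. -/
theorem sum_integral_congr (hf : IsTensorWeakFamily g f) (i : Fin d)
    {η θ : Fin d → Fin 3 → ℝ → ℝ} {ψ : ℝ → ℝ} (hη : ∀ j a, IsBddMeas (η j a))
    (h1 : Represents (η i) ψ) (h2 : Represents (θ i) ψ) (h : ∀ j ≠ i, θ j = η j) :
    ∑ α, ∫ x, f α x * ∏ j, η j (α j) (x j) ∂cubeVolume d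
      = ∑ α, ∫ x, f α x * ∏ j, θ j (α j) (x j) ∂cubeVolume d := by
  obtain ⟨n, rfl⟩ : ∃ n, d = n + 1 := ⟨d - 1, by have := i.2; omega⟩
  rw [← (Fin.insertNthEquiv (fun _ => Fin 3) i).sum_comp,
    ← (Fin.insertNthEquiv (fun _ => Fin 3) i).sum_comp, Fintype.sum_prod_type_right,
    Fintype.sum_prod_type_right]
  refine Finset.sum_congr rfl fun α _ => ?_
  have hY : IsBddMeas fun y : Fin n → ℝ => ∏ j, η (i.succAbove j) (α j) (y j) :=
    IsBddMeas.finset_prod fun j => (hη _ _).comp (measurable_pi_apply j)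
  have e : ∀ ζ : Fin (n + 1) → Fin 3 → ℝ → ℝ, (∀ j ≠ i, ζ j = η j) → ∀ a,
      ∫ x, f (i.insertNth a α) x * ∏ j, ζ j (i.insertNth (α := fun _ => Fin 3) a α j) (x j)
          ∂cubeVolume (n + 1)
        = ∫ z : ℝ × (Fin n → ℝ), f (i.insertNth a α) (i.insertNth z.1 z.2) *
          (ζ i a z.1 * ∏ j, η (i.succAbove j) (α j) (z.2 j)) ∂unitVolume.prod (cubeVolume n) :=
    fun ζ hζ a => by
      rw [integral_slice_prod _ i]
      simp only [Fin.insertNth_apply_same, Fin.insertNth_apply_succAbove,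
        hζ _ (Fin.succAbove_ne i _)]
  refine (Finset.sum_congr rfl fun a _ => e η (fun _ _ => rfl) a).trans
    (Eq.trans ?_ (Finset.sum_congr rfl fun a _ => e θ h a).symm)
  rw [hf.sum_slice_eq i α hY h1, hf.sum_slice_eq i α hY h2]

/-- Exchanging each η j in turn for the trivial representation of ψ j leaves only the term α = 0,
which is the pairing of g itself. -/
theorem sum_integral_eq (hf : IsTensorWeakFamily g f) {η : Fin d → Fin 3 → ℝ → ℝ}
    {ψ : Fin d → ℝ → ℝ} (hψ : ∀ j, IsTestFunction unitIoo (ψ j))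
    (hη : ∀ j, Represents (η j) (ψ j)) :
    ∑ α, ∫ x, f α x * ∏ j, η j (α j) (x j) ∂cubeVolume d
      = ∫ x, g x * ∏ j, ψ j (x j) ∂cubeVolume d := by
  classical
  have hs := fun j => Represents.single (IsBddMeas.of_isTestFunction (hψ j))
  let ζ : Finset (Fin d) → Fin d → Fin 3 → ℝ → ℝ := fun S j =>
    if j ∈ S then η j else fun a => if a = 0 then ψ j else 0
  have hζ : ∀ S j, Represents (ζ S j) (ψ j) := fun S j => by
    by_cases hj : j ∈ S
    · simpa only [ζ, hj, if_true] using hη j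
    · simpa only [ζ, hj, if_false] using hs j
  have key : ∀ S, ∑ α, ∫ x, f α x * ∏ j, ζ S j (α j) (x j) ∂cubeVolume d
      = ∑ α, ∫ x, f α x * ∏ j, ζ ∅ j (α j) (x j) ∂cubeVolume d := fun S => by
    induction S using Finset.induction_on with
    | empty => rfl
    | insert i S _ ih =>
      rw [← ih]
      refine (hf.sum_integral_congr i (fun j => (hζ S j).isBddMeas) (hζ S i) (hζ _ i) fun j hj => ?_).symm
      simp only [ζ, Finset.mem_insert, hj, false_or]
  have h1 := key Finset.univ
  simp only [ζ, Finset.mem_univ, if_true] at h1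
  rw [h1, Finset.sum_eq_single 0]
  · have := hf.integral_mul_prod 0 ψ hψ
    simp only [Pi.zero_apply, Fin.val_zero, iteratedDeriv_zero, Finset.sum_const_zero, pow_zero,
      one_mul] at this
    rw [this]
    simp
  · intro α _ hα
    obtain ⟨j, hj⟩ := Function.ne_iff.1 hα
    refine integral_eq_zero_of_ae (ae_of_all _ fun x => ?_)
    dsimp only
    rw [Finset.prod_eq_zero (Finset.mem_univ j), mul_zero]
    · rfl
    · simp only [Finset.notMem_empty, if_false, Pi.zero_apply] at hj ⊢
      rw [if_neg hj]
      rfl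
  · simp

end IsTensorWeakFamily

/-! ### Inverting the kernel transform on the cube -/

section Inverse

variable {d : ℕ}

/-- The case F = ∏ ψ_j is a product of one-variable identities. `exists_transfer` with constant
input shows that the left side is the pairing of F with a fixed L² function, and products of test
functions identify that function. -/
theorem integral_splitMeasure_prod_mul {μ : Fin d → Measure ℝ} [∀ j, IsFiniteMeasure (μ j)]
    (hμ : ∀ j, (μ j).restrict unitIoo = unitVolume) {K : Fin d → ℝ → ℝ → ℝ} {η : Fin d → ℝ → ℝ}
    (hK : ∀ j, IsBddMeas fun z : ℝ × ℝ => K j z.1 z.2) (hη : ∀ j, IsBddMeas (η j))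
    (h : ∀ j φ, IsBddMeas φ → ∫ z, K j z.1 z.2 * φ (splitPoint z.1 z.2) ∂(μ j).prod doubleVolume
      = ∫ x, η j x * φ x ∂unitVolume)
    {F : (Fin d → ℝ) → ℝ} (hF : MemLp F 2 (cubeVolume d)) :
    ∫ z, (∏ j, K j (z j).1 (z j).2) * F (fun j => splitPoint (z j).1 (z j).2) ∂splitMeasure μ
      = ∫ x, F x * ∏ j, η j (x j) ∂cubeVolume d := by
  have hK' := isBddMeas_prod_split hK
  obtain ⟨C, hC⟩ := hK'.2
  have hη' : IsBddMeas fun x : Fin d → ℝ => ∏ j, η j (x j) :=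
    IsBddMeas.finset_prod fun j => (hη j).comp (measurable_pi_apply j)
  obtain ⟨F', hF', hFF'⟩ := exists_transfer (μ := splitMeasure μ) (C₁ := 1) (π := id)
    (by rw [one_smul]; exact MeasurePreserving.id _) (measurePreserving_splitMeasure_splitPoint hμ)
    ENNReal.one_ne_top (splitMeasure_const_ne hμ).1 (splitMeasure_const_ne hμ).2
    hK'.1.aestronglyMeasurable (ae_of_all _ hC) (memLp_const (1:ℝ))
  simp only [mul_one] at hFF'
  have hz : (fun x => F' x - ∏ j, η j (x j)) =ᵐ[cubeVolume d] 0 := by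
    have hi : Integrable F' (cubeVolume d) := hF'.integrable (by norm_num)
    refine ae_eq_zero_of_integral_mul_prod_test (hi.sub hη'.integrable) fun ψ hψ => ?_
    have hψb := fun j => IsBddMeas.of_isTestFunction (hψ j)
    have hψ' : IsBddMeas fun x : Fin d → ℝ => ∏ j, ψ j (x j) :=
      IsBddMeas.finset_prod fun j => (hψb j).comp (measurable_pi_apply j)
    simp only [sub_mul]
    have i1 : Integrable (fun x => F' x * ∏ j, ψ j (x j)) (cubeVolume d) := by
      simp only [mul_comm (F' _)]
      exact hψ'.integrable_mul hi
    rw [integral_sub i1 (hη'.mul hψ').integrable, hFF' _ hψ'.memLp]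
    simp only [← Finset.prod_mul_distrib]
    rw [integral_fintype_prod_eq_prod (fun j (z : ℝ × ℝ) => K j z.1 z.2 * ψ j (splitPoint z.1 z.2)),
      integral_fintype_prod_eq_prod (fun j (x : ℝ) => η j x * ψ j x), sub_eq_zero]
    exact Finset.prod_congr rfl fun j _ => h j _ (hψb j)
  rw [← hFF' F hF]
  refine integral_congr_ae ?_
  filter_upwards [hz] with x hx
  rw [sub_eq_zero.1 hx, mul_comm]

variable {I : Fin d → Set ℝ} {p q u v : Fin d → ℝ → ℝ} {c : Fin d → ℝ}

/-- Fubini: the adjoint of the transform sends a product of test functions to the product of their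
potentials. -/
theorem integral_sideTransform_mul_prod (h : ∀ j, SLPair (I j) (p j) (q j) (u j) (v j) (c j))
    {w : (Fin d → ℝ) → ℝ} (hw : MemLp w 2 (Measure.pi fun j => sideMeasure (I j) (p j) (q j)))
    {ψ : Fin d → ℝ → ℝ} (hψ : ∀ j, IsTestFunction unitIoo (ψ j)) :
    ∫ x, sideTransform I p q w x * ∏ j, ψ j (x j) ∂cubeVolume d
      = ∫ s, w s * ∏ j, sidePotential (p j) (q j) (ψ j) (s j)
        ∂Measure.pi fun j => sideMeasure (I j) (p j) (q j) := by
  have hfin := fun j => (h j).isFiniteMeasure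
  have hwi : Integrable w (Measure.pi fun j => sideMeasure (I j) (p j) (q j)) :=
    hw.integrable (by norm_num)
  have hψ' : IsBddMeas fun x : Fin d → ℝ => ∏ j, ψ j (x j) :=
    IsBddMeas.finset_prod fun j => (IsBddMeas.of_isTestFunction (hψ j)).comp (measurable_pi_apply j)
  simp only [sideTransform, ← integral_mul_const]
  rw [integral_integral_swap]
  · refine integral_congr_ae (ae_of_all _ fun s => ?_)
    simp only [mul_right_comm _ (w s), ← Finset.prod_mul_distrib, integral_mul_const]
    rw [integral_fintype_prod_eq_prod
      (fun j x => sideKernelDeriv (p j) (q j) 0 x (s j) * ψ j x), mul_comm]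
    rfl
  · have h1 := (IsBddMeas.prod_prodMk fun j => (h j).isBddMeas_sideKernelDeriv (n := 0)
      (by norm_num)).mul (hψ'.comp (measurable_fst (β := Fin d → ℝ)))
    convert h1.integrable_mul (hwi.comp_snd (cubeVolume d)) using 2 with z
    simp only [Function.uncurry]
    ring

/-- A function with square integrable weak mixed derivatives is a kernel transform. -/
theorem exists_sideTransform_ae_eq (h : ∀ j, SLPair (I j) (p j) (q j) (u j) (v j) (c j))
    {g : (Fin d → ℝ) → ℝ} {f : (Fin d → Fin 3) → (Fin d → ℝ) → ℝ} (hf : IsTensorWeakFamily g f)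
    (hf2 : ∀ α, MemLp (f α) 2 (cubeVolume d)) (hg : MemLp g 2 (cubeVolume d)) :
    ∃ (J : Fin d → Set ℝ) (w : (Fin d → ℝ) → ℝ), (∀ j, IsCompact (J j)) ∧ (∀ j, J j ⊆ I j) ∧
      MemLp w 2 (Measure.pi fun j => sideMeasure (I j) (p j) (q j)) ∧
      (∀ s ∉ Set.univ.pi J, w s = 0) ∧ sideTransform I p q w =ᵐ[cubeVolume d] g := by
  have hfin := fun j => (h j).isFiniteMeasure
  have hμ := fun j => (h j).sideMeasure_restrict
  choose J N hJ hJI hN hNJ hη using fun j => (h j).exists_inverse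
  have hN' := fun α : Fin d → Fin 3 => isBddMeas_prod_split (K := fun j => N j (α j)) fun j => hN j (α j)
  choose C hC using fun α => (hN' α).2
  -- The maps have exchanged roles compared with the forward direction: f α is read at the split
  -- point and the result lives over s.
  choose F hF hF' using fun α => exists_transfer
    (measurePreserving_splitMeasure_splitPoint hμ)
    (measurePreserving_splitMeasure_fst (μ := fun j => sideMeasure (I j) (p j) (q j)))
    (splitMeasure_const_ne hμ).1 (ENNReal.prod_ne_top fun _ _ => by norm_num)
    (Finset.prod_ne_zero_iff.2 fun _ _ => by norm_num)
    (hN' α).1.aestronglyMeasurable (ae_of_all _ (hC α)) (hf2 α)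
  have hJm : MeasurableSet (Set.univ.pi J) := MeasurableSet.univ_pi fun j => (hJ j).measurableSet
  -- `exists_transfer` determines F α only through integrals, so the support is imposed by hand.
  -- This changes no pairing, since the kernels N vanish when some s_j lies outside J_j.
  let w : (Fin d → ℝ) → ℝ := (Set.univ.pi J).indicator fun s => ∑ α, F α s
  have hw : MemLp w 2 (Measure.pi fun j => sideMeasure (I j) (p j) (q j)) :=
    (memLp_finsetSum _ fun α _ => hF α).indicator hJm
  refine ⟨J, w, hJ, hJI, hw, fun s hs => Set.indicator_of_notMem hs _, ?_⟩
  have hgi : Integrable g (cubeVolume d) := hg.integrable (by norm_num)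
  have hti : Integrable (sideTransform I p q w) (cubeVolume d) :=
    (memLp_sideTransform h hw).integrable (by norm_num)
  have hz : (fun x => sideTransform I p q w x - g x) =ᵐ[cubeVolume d] 0 := by
    refine ae_eq_zero_of_integral_mul_prod_test (hti.sub hgi) fun ψ hψ => ?_
    have hψ' : IsBddMeas fun x : Fin d → ℝ => ∏ j, ψ j (x j) :=
      IsBddMeas.finset_prod fun j =>
        (IsBddMeas.of_isTestFunction (hψ j)).comp (measurable_pi_apply j)
    have hi : ∀ {k : (Fin d → ℝ) → ℝ}, Integrable k (cubeVolume d) →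
        Integrable (fun x => k x * ∏ j, ψ j (x j)) (cubeVolume d) := fun {k} hk => by
      simp only [mul_comm (k _)]
      exact hψ'.integrable_mul hk
    choose η hη1 hη2 using fun j => hη j (ψ j) (hψ j)
    have hΨ := fun j => (h j).isBddMeas_sidePotential (hψ j)
    have hΨ' : IsBddMeas ((Set.univ.pi J).indicator
        fun s : Fin d → ℝ => ∏ j, sidePotential (p j) (q j) (ψ j) (s j)) :=
      (IsBddMeas.finset_prod fun j => (hΨ j).comp (measurable_pi_apply j)).indicator hJm
    simp only [sub_mul]
    rw [integral_sub (hi hti) (hi hgi), sub_eq_zero, ← hf.sum_integral_eq hψ hη1,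
      integral_sideTransform_mul_prod h hw hψ]
    have e1 : ∀ s, w s * ∏ j, sidePotential (p j) (q j) (ψ j) (s j)
        = ∑ α, F α s * (Set.univ.pi J).indicator
          (fun s : Fin d → ℝ => ∏ j, sidePotential (p j) (q j) (ψ j) (s j)) s := fun s => by
      rw [← Finset.sum_mul]
      by_cases hs : s ∈ Set.univ.pi J
      · simp only [w, Set.indicator_of_mem hs]
      · simp only [w, Set.indicator_of_notMem hs, zero_mul, mul_zero]
    have e2 : ∀ α ∈ Finset.univ, Integrable (fun s => F α s * (Set.univ.pi J).indicator
          (fun s : Fin d → ℝ => ∏ j, sidePotential (p j) (q j) (ψ j) (s j)) s)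
        (Measure.pi fun j => sideMeasure (I j) (p j) (q j)) := fun α _ =>
      (hF α).integrable_mul (q := 2) hΨ'.memLp
    simp only [e1]
    rw [integral_finsetSum _ e2]
    refine Finset.sum_congr rfl fun α _ => ?_
    rw [hF' α _ hΨ'.memLp, ← integral_splitMeasure_prod_mul hμ
      (K := fun j s t => N j (α j) s t * sidePotential (p j) (q j) (ψ j) s)
      (fun j => (hN j (α j)).mul ((hΨ j).comp measurable_fst)) (fun j => (hη1 j).isBddMeas (α j))
      (fun j => hη2 j (α j)) (hf2 α)]
    refine integral_congr_ae (ae_of_all _ fun z => ?_)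
    dsimp only
    rw [Finset.prod_mul_distrib]
    by_cases hs : (fun j => (z j).1) ∈ Set.univ.pi J
    · rw [Set.indicator_of_mem hs]
      ring
    · rw [Set.indicator_of_notMem hs]
      simp only [Set.mem_univ_pi, not_forall] at hs
      obtain ⟨j, hj⟩ := hs
      rw [Finset.prod_eq_zero (Finset.mem_univ j) (hNJ j (α j) _ _ hj)]
      ring
  filter_upwards [hz] with x hx using sub_eq_zero.1 hx

end Inverse

/-! ### Kernel transforms and dominating mixed smoothness -/

theorem mixedSobolev_congr {d m : ℕ} {g g' : openCube d → ℝ} (h : g =ᵐ[volume] g')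
    (hg : g ∈ mixedSobolev d m) : g' ∈ mixedSobolev d m := by
  have hg' : MemLp g' 2 := hg.1.ae_eq h
  refine ⟨hg', fun α hα => ?_⟩
  obtain ⟨f, hf, -, hf', hfφ⟩ := hg.2 α hα
  refine ⟨f, hf, (hg'.integrable (by norm_num)).locallyIntegrable, hf', fun φ hφ => ?_⟩
  rw [← hfφ φ hφ]
  refine integral_congr_ae ?_
  filter_upwards [h] with x hx
  rw [hx]

/-- Nonempty open subsets of the cube have positive volume. -/
theorem eq_of_continuous_of_ae_eq {d : ℕ} {g g' : openCube d → ℝ} (hg : Continuous g)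
    (hg' : Continuous g') (h : g =ᵐ[volume] g') : g = g' := by
  have hS := measurableSet_openCube d
  have hext : ∀ {f : openCube d → ℝ}, Continuous f →
      ContinuousOn (Function.extend Subtype.val f 0) (openCube d) := fun {f} hf => by
    rw [continuousOn_iff_continuous_domRestrict]
    convert hf using 1
    funext x
    exact extend_val_of_mem f x.2
  have hae : Function.extend Subtype.val g 0 =ᵐ[volume.restrict (openCube d)]
      Function.extend Subtype.val g' 0 := by
    refine (ae_subtype_iff hS).1 ?_
    filter_upwards [h] with x hx
    rw [extend_val_of_mem g x.2, extend_val_of_mem g' x.2]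
    exact hx
  funext x
  have := Measure.eqOn_open_of_ae_eq hae (isOpen_openCube d) (hext hg) (hext hg') x.2
  rwa [extend_val_of_mem g x.2, extend_val_of_mem g' x.2] at this

theorem exists_isTensorWeakFamily {d : ℕ} {G : (Fin d → ℝ) → ℝ}
    (h : ∀ α : Fin d → ℕ, (∀ j, α j ≤ 2) → ∃ F, MemLp F 2 (cubeVolume d) ∧
      ∀ φ, IsTestFunction (openCube d) φ → ∫ x, G x * mixedPartial α φ x ∂cubeVolume d
        = (-1) ^ (∑ j, α j) * ∫ x, F x * φ x ∂cubeVolume d) :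
    ∃ f, (∀ α, MemLp (f α) 2 (cubeVolume d)) ∧ IsTensorWeakFamily G f := by
  choose f hf hf' using fun α : Fin d → Fin 3 => h (fun j => α j) fun j => by omega
  refine ⟨f, hf, fun α => (hf α).integrable (by norm_num), fun α ψ hψ => ?_⟩
  rw [← hf' α _ (isTestFunction_prod hψ), mixedPartial_prod hψ]

namespace TensorMarkovKernel

variable {d : ℕ} {T : TensorMarkovKernel d}

/-- Kernel transforms of compactly supported square integrable functions. -/
theorem exists_mem_spaceTwo (hT : T.SturmLiouville) {J : Set (Fin d → ℝ)} (hJ : IsCompact J)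
    (hJT : J ⊆ T.box) {V : (Fin d → ℝ) → ℝ} (hV : MemLp V 2 (volume.restrict T.box))
    (hVJ : ∀ s ∉ J, V s = 0) :
    ∃ h ∈ T.spaceTwo, ∀ x : T.box, h x = ∫ s in T.box, T.kernel x s * V s := by
  have hk := hT.continuous_kernel
  have hVi : IntegrableOn V T.box := by
    -- The box may have infinite volume; V is integrable because it lives on a compact set.
    have : IsFiniteMeasure (volume.restrict J) := isFiniteMeasure_restrict.2 hJ.measure_ne_top
    have h1 : IntegrableOn V J := (hV.mono_measure (Measure.restrict_mono hJT le_rfl)).integrable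
      (by norm_num)
    exact ((integrableOn_iff_integrable_of_support_subset fun s hs =>
      by_contra fun hs' => hs (hVJ s hs')).1 h1).integrableOn
  have hw : Integrable fun s : T.box => V s :=
    (integrable_subtype_iff measurableSet_box fun _ => rfl).2 hVi
  have hJ' : IsCompact (Subtype.val ⁻¹' J : Set T.box) := by
    rw [Subtype.isCompact_iff, Subtype.image_preimage_coe, Set.inter_eq_self_of_subset_right hJT]
    exact hJ
  obtain ⟨h, hh⟩ := exists_coe_eq_integral (k := fun x y : T.box => T.kernel x y)
    hk hw hJ' fun s hs => hVJ s hs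
  refine ⟨h, ⟨fun s => V s, (memLp_subtype_iff measurableSet_box fun _ => rfl).2 hV, fun x =>
    ⟨?_, hh x⟩⟩, fun x => ?_⟩
  · have hkx : Continuous fun s : T.box => T.kernel x s :=
      hk.comp (Continuous.prodMk continuous_const continuous_id)
    obtain ⟨C, hC⟩ := hJ'.exists_bound_of_continuousOn hkx.continuousOn
    refine (hw.norm.const_mul C).mono' (hkx.aestronglyMeasurable.mul hw.1) (ae_of_all _ fun s => ?_)
    rw [norm_mul]
    by_cases hs : (s : Fin d → ℝ) ∈ J
    · exact mul_le_mul_of_nonneg_right (hC s hs) (norm_nonneg _)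
    · simp [hVJ s hs]
  · rw [hh x]
    exact integral_subtype_eq measurableSet_box fun _ => rfl

theorem exists_mem_restrSpaceTwo (hT : T.SturmLiouville) {g : openCube d → ℝ}
    (hg : g ∈ mixedSobolev d 2) : ∃ h ∈ T.restrSpaceTwo, h =ᵐ[volume] g := by
  choose u v c h using SturmLiouville.exists_slPair T hT
  have hG : ∀ x : openCube d, g x = Function.extend Subtype.val g 0 (x : Fin d → ℝ) := fun x =>
    (extend_val_of_mem g x.2).symm
  set G : (Fin d → ℝ) → ℝ := Function.extend Subtype.val g 0
  obtain ⟨hG2, hGα⟩ := (mem_mixedSobolev_iff hG).1 hg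
  obtain ⟨f, hf2, hf⟩ := exists_isTensorWeakFamily hGα
  -- In normalized coordinates g is a transform of w; multiplying w by the weight gives a density
  -- for k itself with the same compact support.
  obtain ⟨J, w, hJ, hJI, hw, hwJ, hwg⟩ := exists_sideTransform_ae_eq h hf hf2 hG2
  have hV := (memLp_pi_sideMeasure_iff h).1 hw
  rw [← box_eq_pi] at hV
  obtain ⟨k, hk, hk'⟩ := exists_mem_spaceTwo hT (isCompact_univ_pi hJ)
    (box_eq_pi (T := T) ▸ Set.pi_mono fun j _ => hJI j) hV fun s hs => by rw [hwJ s hs, zero_mul]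
  refine ⟨fun x => k (Set.inclusion T.openCube_subset x), ⟨k, hk, fun _ => rfl⟩, ?_⟩
  rw [← volume_restrict_openCube] at hwg
  have hwg' := (ae_subtype_iff (measurableSet_openCube d)).2 hwg
  filter_upwards [hwg'] with x hx
  rw [hG, ← hx, hk', sideTransform_eq h w x.2, ← box_eq_pi]
  rfl

end TensorMarkovKernel

theorem mainTheorem6 {d : ℕ} (T : TensorMarkovKernel d) (hT : T.SturmLiouville) :
    (∀ g : openCube d → ℝ, g ∈ T.restrSpaceTwo ↔ Continuous g ∧ g ∈ mixedSobolev d 2) ∧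
    (∀ g : openCube d → ℝ,
      g ∈ mixedSobolev d 2 ↔ ∃ h ∈ T.restrSpaceTwo, h =ᵐ[volume] g) := by
  refine ⟨fun g => ⟨fun hg => ?_, fun ⟨hc, hg⟩ => ?_⟩, fun g =>
    ⟨TensorMarkovKernel.exists_mem_restrSpaceTwo hT, fun ⟨h, hh, hhg⟩ => ?_⟩⟩
  · exact ⟨TensorMarkovKernel.continuous_of_mem_restrSpaceTwo hT hg,
      TensorMarkovKernel.mem_mixedSobolev_of_mem_restrSpaceTwo hT hg⟩
  -- The transform provided is continuous and a.e. equal to the continuous g, so the two coincide.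
  · obtain ⟨h, hh, hhg⟩ := TensorMarkovKernel.exists_mem_restrSpaceTwo hT hg
    rwa [← eq_of_continuous_of_ae_eq (TensorMarkovKernel.continuous_of_mem_restrSpaceTwo hT hh) hc
      hhg]
  · exact mixedSobolev_congr hhg (TensorMarkovKernel.mem_mixedSobolev_of_mem_restrSpaceTwo hT hh)
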